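/- Let $\Gamma$ be a lattice in a $d$-dimensional Euclidean space $E$. For a linear isometry $R$ of $E$ put $\Sigma_\Gamma(R)=[\Gamma:\Gamma\cap R\Gamma]$. A coincidence site lattice (CSL) of $\Gamma$ of index $n$ is a lattice of the form $\Gamma\cap R\Gamma$ with $\Sigma_\Gamma(R)=n<\infty$; isometries that generate the same lattice give one CSL. Let $$A_4=\{x\in\mathbb Z^5 : x_1+\dots+x_5=0\},$$ a lattice in the $4$-dimensional Euclidean space $\{x\in\mathbb R^5: x_1+\dots+x_5=0\}$, let $\tau=(1+\sqrt5)/2$, let $$L=\bigl\langle (1,0,0,0),\ \tfrac12(-1,1,1,1),\ (0,-1,0,0),\ \tfrac12(0,1,\tau-1,-\tau)\bigr\rangle_{\mathbb Z}\subset\mathbb R^4$$ (a copy of $A_4$ rescaled by $1/\sqrt2$), and let $L^*=\{x\in\mathbb R^4:\langle x,y\rangle\in\mathbb Z\text{ for all }y\in L\}$ be its dual lattice. For every $n\ge1$ each of the lattices $A_4$, $L$, $L^*$ has only finitely many CSLs of index $n$, and $A_4$ and $L$ have the same number of them, denoted $f(n)$; if $5\nmid n$, then $L^*$ also has exactly $f(n)$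 CSLs of index $n$. The function $f$ is multiplicative ($f(1)=1$ and $f(mn)=f(m)f(n)$ for coprime $m,n$), and for a prime $p$ and $r\ge1$ $$ f(p^r)=\begin{cases} 6\cdot5^{2r-2}, & p=5,\\ (p^2+1)p^{2r-2}, & p\equiv\pm2\pmod 5,\\ \frac{(p+1)^2}{p^3-1}\bigl(p^{2r+1}+p^{2r-2}-2p^{(r-1)/2}\bigr), & p\equiv\pm1\pmod 5,\ r\text{ odd},\\ \frac{(p+1)^2}{p^3-1}\bigl(p^{2r+1}+p^{2r-2}-2\frac{p^2+1}{p+1}p^{(r-2)/2}\bigr), & p\equiv\pm1\pmod 5,\ r\text{ even}. \end{cases} $$ For every complex $s$ with $\operatorname{Re}s>3$ the Dirichlet series $D(s)=\sum_{n\ge1}f(n)n^{-s}$ converges absolutely, the two infinite products below (over primes $p$) converge unconditionally, and $$ D(s)=\Bigl(1+6\,\frac{5^{-s}}{1-5^{2-s}}\Bigr)\prod_{p\equiv\pm1\,(5)}\frac{1+p^{-s}+2p^{1-s}+2p^{-2s}+p^{1-2s}+p^{1-3s}}{(1-p^{2-s})(1-p^{1-2s})}\prod_{p\equiv\pm2\,(5)}\frac{1+p^{-s}}{1-p^{2-s}}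 . $$ Its first terms are $$D(s)=1+\tfrac{5}{2^s}+\tfrac{10}{3^s}+\tfrac{20}{4^s}+\tfrac{6}{5^s}+\tfrac{50}{6^s}+\tfrac{50}{7^s}+\tfrac{80}{8^s}+\tfrac{90}{9^s}+\tfrac{30}{10^s}+\tfrac{144}{11^s}+\cdots .$$ -/

import Mathlib

section CSL

variable {E : Type*} [NormedAddCommGroup E] [InnerProductSpace ℝ E]

/-- The image `R Γ` of a subgroup `Γ` of a Euclidean space under a linear isometry `R`. -/
def isometryImage (R : E ≃ₗᵢ[ℝ] E) (Γ : AddSubgroup E) : AddSubgroup E :=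
  Γ.map R.toLinearEquiv.toLinearMap.toAddMonoidHom

/-- The coincidence index `[Γ : Γ ∩ R Γ]`, with the value `0` standing for an infinite index. -/
noncomputable def coincidenceIndex (Γ : AddSubgroup E) (R : E ≃ₗᵢ[ℝ] E) : ℕ :=
  (Γ ⊓ isometryImage R Γ).relIndex Γ

/-- `R` is a coincidence isometry of `Γ` if `[Γ : Γ ∩ R Γ]` is finite. -/
def IsCoincidenceIsometry (Γ : AddSubgroup E) (R : E ≃ₗᵢ[ℝ] E) : Prop :=
  coincidenceIndex Γ R ≠ 0

/-- The set of coincidence site lattices of `Γ` of index `n`. Different isometries that generate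
the same lattice `Γ ∩ R Γ` contribute one element only. -/
def cslsOfIndex (Γ : AddSubgroup E) (n : ℕ) : Set (AddSubgroup E) :=
  {C | ∃ R : E ≃ₗᵢ[ℝ] E, IsCoincidenceIsometry Γ R ∧ coincidenceIndex Γ R = n ∧
    C = Γ ⊓ isometryImage R Γ}

/-- The number of coincidence site lattices of `Γ` of index `n`. -/
noncomputable def cslCount (Γ : AddSubgroup E) (n : ℕ) : ℕ :=
  (cslsOfIndex Γ n).ncard

/-- The dual lattice: all `x` with `⟨x, y⟩ ∈ ℤ` for every `y ∈ Γ`. -/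
def dualLattice (Γ : AddSubgroup E) : AddSubgroup E where
  carrier := {x | ∀ y ∈ Γ, ∃ m : ℤ, inner ℝ x y = (m : ℝ)}
  zero_mem' := fun y _ => ⟨0, by simp⟩
  add_mem' := by
    intro a b ha hb y hy
    obtain ⟨m, hm⟩ := ha y hy
    obtain ⟨k, hk⟩ := hb y hy
    exact ⟨m + k, by rw [inner_add_left, hm, hk]; push_cast; ring⟩
  neg_mem' := by
    intro a ha y hy
    obtain ⟨m, hm⟩ := ha y hy
    exact ⟨-m, by rw [inner_neg_left, hm]; push_cast; ring⟩

end CSL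

/-- The hyperplane `x₁ + ⋯ + x₅ = 0` of Euclidean 5-space, a 4-dimensional Euclidean space. -/
def sumZeroHyperplane : Submodule ℝ (EuclideanSpace ℝ (Fin 5)) where
  carrier := {x | ∑ i, x i = 0}
  zero_mem' := by simp
  add_mem' := by
    intro a b ha hb
    simp only [Set.mem_ofPred_eq] at ha hb
    simp [Finset.sum_add_distrib, ha, hb]
  smul_mem' := by
    intro c a ha
    simp only [Set.mem_ofPred_eq] at ha
    simp [← Finset.mul_sum, ha]

/-- The root lattice `A₄`: the integer points of the hyperplane `x₁ + ⋯ + x₅ = 0`, as a lattice in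
that hyperplane. -/
def rootLatticeA4 : AddSubgroup sumZeroHyperplane where
  carrier := {x | ∀ i, ∃ m : ℤ, (x : EuclideanSpace ℝ (Fin 5)) i = (m : ℝ)}
  zero_mem' := fun _ => ⟨0, by simp⟩
  add_mem' := by
    intro a b ha hb i
    obtain ⟨m, hm⟩ := ha i
    obtain ⟨k, hk⟩ := hb i
    exact ⟨m + k, by simp [hm, hk]⟩
  neg_mem' := by
    intro a ha i
    obtain ⟨m, hm⟩ := ha i
    exact ⟨-m, by simp [hm]⟩

/-- The realisation `L` of `A₄` (rescaled by `1/√2`) in Euclidean 4-space, spanned over `ℤ` by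
`(1,0,0,0)`, `½(-1,1,1,1)`, `(0,-1,0,0)` and `½(0,1,τ-1,-τ)`, `τ` the golden ratio. -/
noncomputable def latticeL : AddSubgroup (EuclideanSpace ℝ (Fin 4)) :=
  AddSubgroup.closure
    {!₂[1, 0, 0, 0], !₂[-1 / 2, 1 / 2, 1 / 2, 1 / 2], !₂[0, -1, 0, 0],
      !₂[0, 1 / 2, (Real.goldenRatio - 1) / 2, -Real.goldenRatio / 2]}

/-- The primes `p ≡ ±1 (mod 5)`. -/
abbrev PrimesPmOne : Type := {p : ℕ // p.Prime ∧ (p ≡ 1 [MOD 5] ∨ p ≡ 4 [MOD 5])}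

/-- The primes `p ≡ ±2 (mod 5)`. -/
abbrev PrimesPmTwo : Type := {p : ℕ // p.Prime ∧ (p ≡ 2 [MOD 5] ∨ p ≡ 3 [MOD 5])}

/-- The Euler factor at `5`. -/
noncomputable def eulerFactorFive (s : ℂ) : ℂ :=
  1 + 6 * ((5 : ℂ) ^ (-s) / (1 - (5 : ℂ) ^ (2 - s)))

/-- The Euler factor at a prime `p ≡ ±1 (mod 5)`. -/
noncomputable def eulerFactorPmOne (p : ℕ) (s : ℂ) : ℂ :=
  (1 + (p : ℂ) ^ (-s) + 2 * (p : ℂ) ^ (1 - s) + 2 * (p : ℂ) ^ (-2 * s) + (p : ℂ) ^ (1 - 2 * s)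
      + (p : ℂ) ^ (1 - 3 * s)) /
    ((1 - (p : ℂ) ^ (2 - s)) * (1 - (p : ℂ) ^ (1 - 2 * s)))

/-- The Euler factor at a prime `p ≡ ±2 (mod 5)`. -/
noncomputable def eulerFactorPmTwo (p : ℕ) (s : ℂ) : ℂ :=
  (1 + (p : ℂ) ^ (-s)) / (1 - (p : ℂ) ^ (2 - s))

/-! All lattices are handled in `ℤ⁴` with `rootQ`, half the norm form of `A₄` in simple roots. The
lattices `A₄` and `L` are two instances of `IsRootBasis`, so one count serves both.

The key is an intrinsic description of the coincidence site lattices, `IsRootBasis.cslsOfIndex_eq`.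
A sublattice `C` of finite index in `Γ` has the form `Γ ∩ RΓ` exactly when, for `x` in `Γ` with
`x/k` in the dual of `C`, the number `k` divides `Q(x)`. For necessity, the dual of `Γ ∩ RΓ` is `Γ^*
+ RΓ^*`, so `x/k = γ + Rδ`, and comparing the norms of `x/k - γ` and `δ` gives the divisibility
(`IsRootBasis.isCoincident_comap`). For sufficiency, the elementary divisors of `C` provide glue
vectors `x_i/a_i`, which the condition allows to be lifted to vectors of even norm with integral
mutual products. Together with `C` they generate an even lattice of determinant five that meets `Γ`
exactly in `C`. Hermite reduction shows that there is only one class of such lattices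
(`IsEvenFive.gramEquiv_cartan`), so this lattice is `RΓ` for an isometry `R`
(`IsCoincident.exists_isometric`).

The divisibility condition can be tested one prime at a time. Hence the count is multiplicative
(`ncard_coincidentOfIndex_mul`), and prime powers can be counted over `ℤ_p`
(`ncard_coincidentOfIndex_prime_pow`). There a hyperbolic plane splits off, and the discriminant of
the complement is five times the square of a unit; quadratic reciprocity decides whether the
complement is hyperbolic.

For `p ≡ ±2 (mod 5)`, and up to a radical for `p = 5`, the complement is anisotropic modulo `p`.
Then there is no totally isotropic plane modulo `p`, so at most one elementary divisor is
nontrivial, and the lattices of index `p ^ r` correspond to the isotropic lines modulo `p ^ r`,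
which two charts enumerate (`IsAnisotropicSplitting.ncard_coincidentOfIndex`). For `p ≡ ±1 (mod 5)`
the form is the determinant of `2 × 2` matrices. Isotropic vectors are products `u ⊗ t`, and a
lattice with divisors `p ^ (r - b)` and `p ^ b` is given by a point of each of two projective lines,
over `ℤ/p^(r-b)` and `ℤ/p^(r-2b)`, together with a choice between rows and columns when `b ≠ 0`
(`eq_row_or_col`, `ncard_coincidentOfIndex_split`).

The counts are dominated by a fourfold Dirichlet convolution of `n ^ 2` with itself, which yields
absolute convergence and the Euler product. Each Euler factor is a geometric series, for split
primes combined with the recursion `splitSum_add_two`.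

For the dual, `2L` has index five in `L^*` and is singled out there by a condition on norms, which
every isometry preserves. When `n` is coprime to five, intersecting with `2L` therefore matches the
coincidence site lattices of `L^*` with those of `L` (`cslCount_dual`). -/

open Module

/-! ## The quadratic form of the root lattice in coordinates -/

section Forms

variable {R S : Type*} [CommRing R] [CommRing S]

/-- Half the norm form of `A₄` in the coordinates of a base of simple roots. -/
def rootQ (x : Fin 4 → R) : R :=
  x 0 ^ 2 + x 1 ^ 2 + x 2 ^ 2 + x 3 ^ 2 - x 0 * x 1 - x 1 * x 2 - x 2 * x 3

/-- The action of the Cartan matrix of `A₄`. -/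
def cartan (x : Fin 4 → R) : Fin 4 → R :=
  ![2 * x 0 - x 1, 2 * x 1 - x 0 - x 2, 2 * x 2 - x 1 - x 3, 2 * x 3 - x 2]

/-- The polar form of `rootQ`. -/
def rootB (x y : Fin 4 → R) : R := cartan x ⬝ᵥ y

/-- Five times the inverse of the Cartan matrix of `A₄`. -/
def cartanAdj (x : Fin 4 → R) : Fin 4 → R :=
  ![4 * x 0 + 3 * x 1 + 2 * x 2 + x 3, 3 * x 0 + 6 * x 1 + 4 * x 2 + 2 * x 3,
    2 * x 0 + 4 * x 1 + 6 * x 2 + 3 * x 3, x 0 + 2 * x 1 + 3 * x 2 + 4 * x 3]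

/-- Five times the form dual to `rootQ`. -/
def weightQ (x : Fin 4 → R) : R :=
  2 * x 0 ^ 2 + 3 * x 1 ^ 2 + 3 * x 2 ^ 2 + 2 * x 3 ^ 2 + 3 * x 0 * x 1 + 2 * x 0 * x 2
    + x 0 * x 3 + 4 * x 1 * x 2 + 2 * x 1 * x 3 + 3 * x 2 * x 3

lemma dotProduct_four (x y : Fin 4 → R) :
    x ⬝ᵥ y = x 0 * y 0 + x 1 * y 1 + x 2 * y 2 + x 3 * y 3 := by
  simp [dotProduct, Fin.sum_univ_four]

lemma rootB_apply (x y : Fin 4 → R) :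
    rootB x y = (2 * x 0 - x 1) * y 0 + (2 * x 1 - x 0 - x 2) * y 1 + (2 * x 2 - x 1 - x 3) * y 2
      + (2 * x 3 - x 2) * y 3 := by
  simp only [rootB, cartan, dotProduct_four, Matrix.cons_val]

lemma rootB_comm (x y : Fin 4 → R) : rootB x y = rootB y x := by
  simp only [rootB_apply]; ring

lemma rootB_add_left (x y z : Fin 4 → R) : rootB (x + y) z = rootB x z + rootB y z := by
  simp only [rootB_apply, Pi.add_apply]; ring

lemma rootB_add_right (x y z : Fin 4 → R) : rootB x (y + z) = rootB x y + rootB x z := by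
  simp only [rootB_apply, Pi.add_apply]; ring

lemma rootB_sub_right (x y z : Fin 4 → R) : rootB x (y - z) = rootB x y - rootB x z := by
  simp only [rootB_apply, Pi.sub_apply]; ring

lemma rootB_neg_right (x y : Fin 4 → R) : rootB x (-y) = -rootB x y := by
  simp only [rootB_apply, Pi.neg_apply]; ring

lemma rootB_smul_left (c : R) (x y : Fin 4 → R) : rootB (c • x) y = c * rootB x y := by
  simp only [rootB_apply, Pi.smul_apply, smul_eq_mul]; ring

lemma rootB_smul_right (c : R) (x y : Fin 4 → R) : rootB x (c • y) = c * rootB x y := by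
  simp only [rootB_apply, Pi.smul_apply, smul_eq_mul]; ring

lemma rootB_zero_left (y : Fin 4 → R) : rootB 0 y = 0 := by simp [rootB_apply]

lemma rootB_zero_right (x : Fin 4 → R) : rootB x 0 = 0 := by simp [rootB_apply]

lemma rootB_self (x : Fin 4 → R) : rootB x x = 2 * rootQ x := by
  simp only [rootB_apply, rootQ]; ring

lemma rootQ_add (x y : Fin 4 → R) : rootQ (x + y) = rootQ x + rootQ y + rootB x y := by
  simp only [rootB_apply, rootQ, Pi.add_apply]; ring

lemma rootQ_smul (c : R) (x : Fin 4 → R) : rootQ (c • x) = c ^ 2 * rootQ x := by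
  simp only [rootQ, Pi.smul_apply, smul_eq_mul]; ring

lemma rootQ_neg (x : Fin 4 → R) : rootQ (-x) = rootQ x := by
  simp only [rootQ, Pi.neg_apply]; ring

lemma rootB_cartanAdj (x y : Fin 4 → R) : rootB (cartanAdj x) y = 5 * (x ⬝ᵥ y) := by
  simp only [rootB_apply, dotProduct_four, cartanAdj, Matrix.cons_val]; ring

lemma cartanAdj_cartan (x : Fin 4 → R) : cartanAdj (cartan x) = (5 : R) • x := by
  ext i; fin_cases i <;> simp [cartanAdj, cartan] <;> ring

lemma rootQ_cartanAdj (x : Fin 4 → R) : rootQ (cartanAdj x) = 5 * weightQ x := by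
  simp only [rootQ, weightQ, cartanAdj, Matrix.cons_val]; ring

lemma weightQ_cartan (x : Fin 4 → R) : weightQ (cartan x) = 5 * rootQ x := by
  simp only [rootQ, weightQ, cartan, Matrix.cons_val]; ring

lemma map_rootB (f : R →+* S) (x y : Fin 4 → R) :
    rootB (fun i => f (x i)) (fun i => f (y i)) = f (rootB x y) := by
  simp [rootB_apply, map_ofNat]

lemma map_rootQ (f : R →+* S) (x : Fin 4 → R) : rootQ (fun i => f (x i)) = f (rootQ x) := by
  simp [rootQ]

end Forms

/-- Twice the form is the norm of a vector of `ℤ⁵` with coordinate sum zero, a sum of five squares.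
-/
lemma rootQ_pos {x : Fin 4 → ℤ} (hx : x ≠ 0) : 0 < rootQ x := by
  by_contra h
  have e : 2 * rootQ x = x 0 ^ 2 + (x 0 - x 1) ^ 2 + (x 1 - x 2) ^ 2 + (x 2 - x 3) ^ 2
      + x 3 ^ 2 := by simp only [rootQ]; ring
  have s0 := sq_nonneg (x 0)
  have s1 := sq_nonneg (x 0 - x 1)
  have s2 := sq_nonneg (x 1 - x 2)
  have s3 := sq_nonneg (x 2 - x 3)
  have s4 := sq_nonneg (x 3)
  have h0 : x 0 = 0 := pow_eq_zero_iff (two_ne_zero) |>.1 (by linarith)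
  have h1 : x 0 - x 1 = 0 := pow_eq_zero_iff (two_ne_zero) |>.1 (by linarith)
  have h2 : x 1 - x 2 = 0 := pow_eq_zero_iff (two_ne_zero) |>.1 (by linarith)
  have h3 : x 3 = 0 := pow_eq_zero_iff (two_ne_zero) |>.1 (by linarith)
  apply hx
  ext i
  fin_cases i <;> simp <;> lia

/-- A functional on `A₄` is represented by a vector of `A₄` as soon as its coset in the cyclic
group `A₄^* / A₄` of order five vanishes. -/
lemma exists_cartan_eq {φ : Fin 4 → ℤ} (h : 5 ∣ φ 0 + 2 * φ 1 + 3 * φ 2 + 4 * φ 3) :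
    ∃ x, cartan x = φ := by
  obtain ⟨t, ht⟩ := h
  -- Back substitution in the Cartan system, starting from the last coordinate, which `cartanAdj`
  -- forces to be `t`.
  refine ⟨![4 * t - φ 1 - 2 * φ 2 - 3 * φ 3, 3 * t - φ 2 - 2 * φ 3, 2 * t - φ 3, t], ?_⟩
  ext i
  fin_cases i <;> simp [cartan] <;> linarith

/-- The linear form is the class of `φ` in the cyclic group `A₄^* / A₄`. Modulo five the dual norm
depends on this class alone. -/
lemma weightQ_int (φ : Fin 4 → ℤ) : ∃ m, weightQ φ =
    2 * (φ 0 + 2 * φ 1 + 3 * φ 2 + 4 * φ 3) ^ 2 + 5 * m :=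
  ⟨-(φ 1 ^ 2 + 3 * φ 2 ^ 2 + 6 * φ 3 ^ 2 + φ 0 * φ 1 + 2 * φ 0 * φ 2 + 3 * φ 0 * φ 3
    + 4 * φ 1 * φ 2 + 6 * φ 1 * φ 3 + 9 * φ 2 * φ 3), by simp only [weightQ]; ring⟩

/-- The discriminant form on the group of order five is anisotropic, so a functional whose norm
vanishes there has trivial class. -/
lemma exists_cartan_eq_of_dvd_weightQ {φ : Fin 4 → ℤ} (h : 5 ∣ weightQ φ) :
    ∃ x, cartan x = φ := by
  refine exists_cartan_eq ?_
  obtain ⟨m, hm⟩ := weightQ_int φ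
  have h2 : (5 : ℤ) ∣ 2 * (φ 0 + 2 * φ 1 + 3 * φ 2 + 4 * φ 3) ^ 2 := by lia
  have h5 : Prime (5 : ℤ) := Nat.prime_iff_prime_int.1 Nat.prime_five
  exact h5.dvd_of_dvd_pow ((h5.dvd_mul.1 h2).resolve_left (by norm_num))

/-- The characterisation of the coincidence site lattices among the sublattices of `A₄`. -/
def IsCoincident (C : AddSubgroup (Fin 4 → ℤ)) : Prop :=
  ∀ (x : Fin 4 → ℤ) (k : ℕ), 0 < k → (∀ y ∈ C, (k : ℤ) ∣ rootB x y) → (k : ℤ) ∣ rootQ x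

/-- The coincidence site lattices of index `n` in coordinates. -/
def coincidentOfIndex (n : ℕ) : Set (AddSubgroup (Fin 4 → ℤ)) :=
  {C | C.index = n ∧ IsCoincident C}

/-- Elementary divisors of a sublattice of finite index. -/
lemma AddSubgroup.exists_elementary_divisors (C : AddSubgroup (Fin 4 → ℤ)) (hC : C.index ≠ 0) :
    ∃ (e φ : Fin 4 → Fin 4 → ℤ) (a : Fin 4 → ℕ), (∀ i, 0 < a i) ∧
      (∀ i j, φ i ⬝ᵥ e j = if i = j then 1 else 0) ∧
      (∀ y, y ∈ C ↔ ∀ i, (a i : ℤ) ∣ φ i ⬝ᵥ y) ∧ ∏ i, a i = C.index := by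
  classical
  let N := AddSubgroup.toIntSubmodule C
  have hfin : Finite ((Fin 4 → ℤ) ⧸ N) := Nat.finite_of_card_ne_zero hC
  have h := (Submodule.finiteQuotient_iff N).1 hfin
  let b := Pi.basisFun ℤ (Fin 4)
  let a := Submodule.smithNormalFormCoeffs b h
  let b' := Submodule.smithNormalFormTopBasis b h
  let ab := Submodule.smithNormalFormBotBasis b h
  have ab_eq := Submodule.smithNormalFormBotBasis_def b h
  have hφ : ∀ i y, (fun k => b'.coord i (b k)) ⬝ᵥ y = b'.repr y i := by
    intro i y
    conv_rhs => rw [← b.sum_repr y]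
    simp only [map_sum, map_smul, Finsupp.coe_finsetSum, Finset.sum_apply, Finsupp.smul_apply,
      dotProduct, Basis.coord_apply, smul_eq_mul]
    exact Finset.sum_congr rfl fun k _ => by simp [b, mul_comm]
  refine ⟨b', fun i k => b'.coord i (b k), fun i => (a i).natAbs, fun i => ?_, fun i j => ?_,
    fun y => ?_, ?_⟩
  · exact Int.natAbs_pos.2 (Submodule.smithNormalFormCoeffs_ne_zero b h i)
  · rw [hφ]; simp [Finsupp.single_apply, eq_comm]
  · simp only [hφ, Int.natCast_natAbs, abs_dvd]
    change y ∈ N ↔ _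
    simp_rw [ab.mem_submodule_iff', ab, ab_eq]
    have : ∀ (c : Fin 4 → ℤ) (i), b'.repr (∑ j, c j • a j • b' j) i = a i * c i := by
      intro c i
      simp only [← mul_smul, b'.repr_sum_self, mul_comm]
    constructor
    · rintro ⟨c, rfl⟩ i
      exact ⟨c i, this c i⟩
    · rintro ha
      choose c hc using ha
      exact ⟨c, b'.ext_elem fun i => Eq.trans (hc i) (this c i).symm⟩
  · change _ = Nat.card ((Fin 4 → ℤ) ⧸ N)
    simp_rw [Nat.card_congr (Submodule.quotientEquivPiZMod N b h).toEquiv, Nat.card_pi,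
      Nat.card_zmod, a]

/-! ## Even positive definite quaternary forms of determinant five -/

section ClassNumber

open Matrix

/-- Integral equivalence of Gram matrices. -/
def GramEquiv (G H : Matrix (Fin 4) (Fin 4) ℤ) : Prop :=
  ∃ U V : Matrix (Fin 4) (Fin 4) ℤ, U * V = 1 ∧ Uᵀ * G * U = H

lemma GramEquiv.refl (G : Matrix (Fin 4) (Fin 4) ℤ) : GramEquiv G G := ⟨1, 1, by simp, by simp⟩

lemma GramEquiv.trans {G H K : Matrix (Fin 4) (Fin 4) ℤ} (h : GramEquiv G H)
    (h' : GramEquiv H K) : GramEquiv G K := by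
  obtain ⟨U, V, hUV, rfl⟩ := h
  obtain ⟨U', V', hUV', rfl⟩ := h'
  refine ⟨U * U', V' * V, ?_, ?_⟩
  · rw [Matrix.mul_assoc, ← Matrix.mul_assoc U', hUV', Matrix.one_mul, hUV]
  · simp only [Matrix.transpose_mul, Matrix.mul_assoc]

/-- An even positive definite quaternary form of determinant five. -/
structure IsEvenFive (G : Matrix (Fin 4) (Fin 4) ℤ) : Prop where
  even : ∃ H, G = H + Hᵀ
  det : G.det = 5
  pos : ∀ v : Fin 4 → ℤ, v ≠ 0 → 0 < v ⬝ᵥ (G *ᵥ v)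

lemma IsEvenFive.of_equiv {G H : Matrix (Fin 4) (Fin 4) ℤ} (hG : IsEvenFive G)
    (h : GramEquiv G H) : IsEvenFive H := by
  obtain ⟨U, V, hUV, rfl⟩ := h
  have hVU : V * U = 1 := mul_eq_one_comm.1 hUV
  refine ⟨?_, ?_, fun v hv => ?_⟩
  · obtain ⟨H, rfl⟩ := hG.even
    refine ⟨Uᵀ * H * U, ?_⟩
    simp only [Matrix.transpose_mul, Matrix.mul_add, Matrix.add_mul, Matrix.transpose_transpose,
      Matrix.mul_assoc]
  · have h1 : U.det * V.det = 1 := by rw [← Matrix.det_mul, hUV, Matrix.det_one]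
    have h2 : U.det ^ 2 = 1 := by
      have := Int.isUnit_iff.1 (IsUnit.of_mul_eq_one _ h1)
      rcases this with h | h <;> rw [h] <;> norm_num
    rw [Matrix.det_mul, Matrix.det_mul, Matrix.det_transpose, hG.det]
    linear_combination 5 * h2
  · have hne : U *ᵥ v ≠ 0 := by
      intro h0
      apply hv
      have : V *ᵥ (U *ᵥ v) = v := by rw [Matrix.mulVec_mulVec, hVU, Matrix.one_mulVec]
      rw [← this, h0, Matrix.mulVec_zero]
    have := hG.pos _ hne
    rwa [← Matrix.mulVec_mulVec, ← Matrix.mulVec_mulVec, Matrix.dotProduct_mulVec,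
      Matrix.vecMul_transpose]

/-- The symmetric matrix with the given entries on and above the diagonal. -/
def symmGram (a b c d e f g h k l : ℤ) : Matrix (Fin 4) (Fin 4) ℤ :=
  !![a, b, c, d; b, e, f, g; c, f, h, k; d, g, k, l]

/-- The three shears add earlier basis vectors to a later one. The base change is upper
unitriangular, so all leading minors are preserved; only the swaps below can change them. -/
lemma gramEquiv_shear_one (t a b c d e f g h k l : ℤ) :
    GramEquiv (symmGram a b c d e f g h k l)
      (symmGram a (b + t * a) c d (e + 2 * t * b + t ^ 2 * a) (f + t * c) (g + t * d) h k l) := by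
  refine ⟨!![1, t, 0, 0; 0, 1, 0, 0; 0, 0, 1, 0; 0, 0, 0, 1],
    !![1, -t, 0, 0; 0, 1, 0, 0; 0, 0, 1, 0; 0, 0, 0, 1], ?_, ?_⟩ <;>
  · ext i j
    fin_cases i <;> fin_cases j <;>
      simp [symmGram, Matrix.mul_apply, Fin.sum_univ_four] <;> ring

lemma gramEquiv_shear_two (s t a b c d e f g h k l : ℤ) :
    GramEquiv (symmGram a b c d e f g h k l)
      (symmGram a b (c + s * a + t * b) d e (f + s * b + t * e) g
        (h + 2 * s * c + 2 * t * f + s ^ 2 * a + 2 * s * t * b + t ^ 2 * e)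
        (k + s * d + t * g) l) := by
  refine ⟨!![1, 0, s, 0; 0, 1, t, 0; 0, 0, 1, 0; 0, 0, 0, 1],
    !![1, 0, -s, 0; 0, 1, -t, 0; 0, 0, 1, 0; 0, 0, 0, 1], ?_, ?_⟩ <;>
  · ext i j
    fin_cases i <;> fin_cases j <;>
      simp [symmGram, Matrix.mul_apply, Fin.sum_univ_four] <;> ring

lemma gramEquiv_shear_three (s t u a b c d e f g h k l : ℤ) :
    GramEquiv (symmGram a b c d e f g h k l)
      (symmGram a b c (d + s * a + t * b + u * c) e f (g + s * b + t * e + u * f) h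
        (k + s * c + t * f + u * h)
        (l + 2 * s * d + 2 * t * g + 2 * u * k + s ^ 2 * a + t ^ 2 * e + u ^ 2 * h
          + 2 * s * t * b + 2 * s * u * c + 2 * t * u * f)) := by
  refine ⟨!![1, 0, 0, s; 0, 1, 0, t; 0, 0, 1, u; 0, 0, 0, 1],
    !![1, 0, 0, -s; 0, 1, 0, -t; 0, 0, 1, -u; 0, 0, 0, 1], ?_, ?_⟩ <;>
  · ext i j
    fin_cases i <;> fin_cases j <;>
      simp [symmGram, Matrix.mul_apply, Fin.sum_univ_four] <;> ring

lemma gramEquiv_swap_one (a b c d e f g h k l : ℤ) :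
    GramEquiv (symmGram a b c d e f g h k l) (symmGram e b f g a c d h k l) := by
  refine ⟨!![0, 1, 0, 0; 1, 0, 0, 0; 0, 0, 1, 0; 0, 0, 0, 1],
    !![0, 1, 0, 0; 1, 0, 0, 0; 0, 0, 1, 0; 0, 0, 0, 1], ?_, ?_⟩ <;>
  · ext i j
    fin_cases i <;> fin_cases j <;> simp [symmGram, Matrix.mul_apply, Fin.sum_univ_four]

lemma gramEquiv_swap_two (a b c d e f g h k l : ℤ) :
    GramEquiv (symmGram a b c d e f g h k l) (symmGram a c b d h f k e g l) := by
  refine ⟨!![1, 0, 0, 0; 0, 0, 1, 0; 0, 1, 0, 0; 0, 0, 0, 1],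
    !![1, 0, 0, 0; 0, 0, 1, 0; 0, 1, 0, 0; 0, 0, 0, 1], ?_, ?_⟩ <;>
  · ext i j
    fin_cases i <;> fin_cases j <;> simp [symmGram, Matrix.mul_apply, Fin.sum_univ_four]

lemma gramEquiv_swap_three (a b c d e f g h k l : ℤ) :
    GramEquiv (symmGram a b c d e f g h k l) (symmGram a b d c e g f l k h) := by
  refine ⟨!![1, 0, 0, 0; 0, 1, 0, 0; 0, 0, 0, 1; 0, 0, 1, 0],
    !![1, 0, 0, 0; 0, 1, 0, 0; 0, 0, 0, 1; 0, 0, 1, 0], ?_, ?_⟩ <;>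
  · ext i j
    fin_cases i <;> fin_cases j <;> simp [symmGram, Matrix.mul_apply, Fin.sum_univ_four]

lemma gramEquiv_neg_two (a b c d e f g h k l : ℤ) :
    GramEquiv (symmGram a b c d e f g h k l) (symmGram a b (-c) d e (-f) g h (-k) l) := by
  refine ⟨!![1, 0, 0, 0; 0, 1, 0, 0; 0, 0, -1, 0; 0, 0, 0, 1],
    !![1, 0, 0, 0; 0, 1, 0, 0; 0, 0, -1, 0; 0, 0, 0, 1], ?_, ?_⟩ <;>
  · ext i j
    fin_cases i <;> fin_cases j <;> simp [symmGram, Matrix.mul_apply, Fin.sum_univ_four]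

lemma gramEquiv_neg_three (a b c d e f g h k l : ℤ) :
    GramEquiv (symmGram a b c d e f g h k l) (symmGram a b c (-d) e f (-g) h (-k) l) := by
  refine ⟨!![1, 0, 0, 0; 0, 1, 0, 0; 0, 0, 1, 0; 0, 0, 0, -1],
    !![1, 0, 0, 0; 0, 1, 0, 0; 0, 0, 1, 0; 0, 0, 0, -1], ?_, ?_⟩ <;>
  · ext i j
    fin_cases i <;> fin_cases j <;> simp [symmGram, Matrix.mul_apply, Fin.sum_univ_four]

/-! ### Hermite reduction through leading minors -/

/-- The second leading minor of a symmetric matrix. -/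
def minorTwo (a b e : ℤ) : ℤ := a * e - b ^ 2

/-- The third leading minor of a symmetric matrix. -/
def minorThree (a b c e f h : ℤ) : ℤ :=
  a * e * h + 2 * b * c * f - a * f ^ 2 - e * c ^ 2 - h * b ^ 2

lemma IsEvenFive.exists_eq_symmGram {G : Matrix (Fin 4) (Fin 4) ℤ} (hG : IsEvenFive G) :
    ∃ a b c d e f g h k l, G = symmGram (2 * a) b c d e f g h k l := by
  obtain ⟨H, rfl⟩ := hG.even
  refine ⟨H 0 0, H 0 1 + H 1 0, H 0 2 + H 2 0, H 0 3 + H 3 0, H 1 1 + H 1 1, H 1 2 + H 2 1,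
    H 1 3 + H 3 1, H 2 2 + H 2 2, H 2 3 + H 3 2, H 3 3 + H 3 3, ?_⟩
  ext i j
  fin_cases i <;> fin_cases j <;> simp [symmGram] <;> ring

lemma det_symmGram (a b c d e f g h k l : ℤ) : (symmGram a b c d e f g h k l).det =
    l * minorThree a b c e f h - a * (g ^ 2 * h - 2 * g * k * f + k ^ 2 * e)
      + b * (2 * d * g * h - 2 * d * k * f - 2 * g * k * c) + c * (2 * d * k * e - 2 * d * f * g)
      + b ^ 2 * k ^ 2 + c ^ 2 * g ^ 2 + d ^ 2 * f ^ 2 - d ^ 2 * e * h := by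
  simp [symmGram, minorThree, Matrix.det_succ_row_zero, Fin.sum_univ_succ, Fin.succAbove]
  ring

section Entries

variable {a b c d e f g h k l : ℤ}

lemma IsEvenFive.quadratic_pos (hG : IsEvenFive (symmGram a b c d e f g h k l)) (x y z : ℤ)
    (hne : x ≠ 0 ∨ y ≠ 0 ∨ z ≠ 0) :
    0 < a * x ^ 2 + e * y ^ 2 + h * z ^ 2 + 2 * b * x * y + 2 * c * x * z + 2 * f * y * z := by
  have := hG.pos ![x, y, z, 0] (by
    intro h0
    have h1 := congrFun h0 0
    have h2 := congrFun h0 1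
    have h3 := congrFun h0 2
    simp at h1 h2 h3
    tauto)
  simp only [symmGram, Matrix.mulVec, dotProduct_four, Matrix.of_apply, Matrix.cons_val] at this
  linarith

lemma IsEvenFive.entry_pos (hG : IsEvenFive (symmGram a b c d e f g h k l)) : 0 < a := by
  simpa using hG.quadratic_pos 1 0 0 (by simp)

/-- The vector `(-b, a, 0)` has value `a` times the minor. -/
lemma IsEvenFive.minorTwo_pos (hG : IsEvenFive (symmGram a b c d e f g h k l)) :
    0 < minorTwo a b e := by
  have ha := hG.entry_pos
  have := hG.quadratic_pos (-b) a 0 (Or.inr (Or.inl ha.ne'))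
  refine pos_of_mul_pos_right (a := a) ?_ ha.le
  simp only [minorTwo]
  linarith

/-- The test vector is the last column of the adjugate of the leading block; its value is the
product of the second and third minors. -/
lemma IsEvenFive.minorThree_pos (hG : IsEvenFive (symmGram a b c d e f g h k l)) :
    0 < minorThree a b c e f h := by
  have ha := hG.minorTwo_pos
  have := hG.quadratic_pos (b * f - c * e) (b * c - a * f) (minorTwo a b e)
    (Or.inr (Or.inr ha.ne'))
  refine pos_of_mul_pos_right (a := minorTwo a b e) ?_ ha.le
  refine this.trans_eq ?_
  simp only [minorTwo, minorThree]
  ring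

end Entries

/-- A reduced form in a class: the sum of the first three leading minors is minimal. -/
lemma IsEvenFive.exists_reduced {G : Matrix (Fin 4) (Fin 4) ℤ} (hG : IsEvenFive G) :
    ∃ a b c d e f g h k l : ℤ, GramEquiv G (symmGram a b c d e f g h k l) ∧
      ∀ a' b' c' d' e' f' g' h' k' l',
        GramEquiv (symmGram a b c d e f g h k l) (symmGram a' b' c' d' e' f' g' h' k' l') →
        a + minorTwo a b e + minorThree a b c e f h ≤
          a' + minorTwo a' b' e' + minorThree a' b' c' e' f' h' := by
  classical
  let P : ℕ → Prop := fun m => ∃ a b c d e f g h k l : ℤ,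
    GramEquiv G (symmGram a b c d e f g h k l) ∧
      (m : ℤ) = a + minorTwo a b e + minorThree a b c e f h
  have key : ∀ a b c d e f g h k l : ℤ, GramEquiv G (symmGram a b c d e f g h k l) →
      P (a + minorTwo a b e + minorThree a b c e f h).toNat := by
    intro a b c d e f g h k l hE
    have hG' := hG.of_equiv hE
    have h1 := hG'.entry_pos
    have h2 := hG'.minorTwo_pos
    have h3 := hG'.minorThree_pos
    exact ⟨a, b, c, d, e, f, g, h, k, l, hE, by lia⟩
  have hP : ∃ m, P m := by
    obtain ⟨a, b, c, d, e, f, g, h, k, l, rfl⟩ := hG.exists_eq_symmGram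
    exact ⟨_, key _ _ _ _ _ _ _ _ _ _ (GramEquiv.refl _)⟩
  obtain ⟨a, b, c, d, e, f, g, h, k, l, hE, hm⟩ := Nat.find_spec hP
  refine ⟨a, b, c, d, e, f, g, h, k, l, hE, fun a' b' c' d' e' f' g' h' k' l' hE' => ?_⟩
  have hE'' := hE.trans hE'
  have := Nat.find_min' hP (key _ _ _ _ _ _ _ _ _ _ hE'')
  have hG' := hG.of_equiv hE''
  have h1 := hG'.entry_pos
  have h2 := hG'.minorTwo_pos
  have h3 := hG'.minorThree_pos
  lia

/-- Rounding to the nearest integer. -/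
lemma exists_abs_two_mul_add_le (m : ℤ) {n : ℤ} (hn : 0 < n) :
    ∃ t : ℤ, 4 * (m + t * n) ^ 2 ≤ n ^ 2 := by
  -- The quotient is `m / n` rounded to the nearest integer.
  obtain ⟨q, hq⟩ : ∃ q, q = (2 * m + n) / (2 * n) := ⟨_, rfl⟩
  have h1 : 0 ≤ 2 * m + n - 2 * n * q := by
    have := Int.emod_nonneg (2 * m + n) (b := 2 * n) (by lia)
    have := Int.emod_add_mul_ediv (2 * m + n) (2 * n)
    rw [hq]; linarith
  have h2 : 2 * m + n - 2 * n * q < 2 * n := by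
    have := Int.emod_lt_of_pos (2 * m + n) (b := 2 * n) (by lia)
    have := Int.emod_add_mul_ediv (2 * m + n) (2 * n)
    rw [hq]; linarith
  refine ⟨-q, ?_⟩
  nlinarith

/-- The sizes of the minors of a reduced form are forced. -/
lemma minors_eq {x y z : ℤ} (hx : 0 < x) (hy : 0 < y) (hz : 0 < z) (h1 : 3 * (2 * x) ^ 2 ≤ 4 * y)
    (h2 : 3 * y ^ 2 ≤ 4 * (2 * x) * z) (h3 : 3 * z ^ 2 ≤ 20 * y) : x = 1 ∧ y = 3 ∧ z = 4 := by
  have hx1 : x = 1 := by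
    by_contra hne
    have hx2 : 2 ≤ x := by lia
    have a1 : 3 * x ^ 2 ≤ y := by nlinarith
    have a2 : 3 * y ^ 2 ≤ 8 * x * z := by nlinarith
    have a3 : 9 * x ^ 2 * y ≤ 8 * x * z := by nlinarith
    have a4 : 9 * x * y ≤ 8 * z := by
      have : x * (9 * x * y) ≤ x * (8 * z) := by nlinarith
      exact le_of_mul_le_mul_left this hx
    have a5 : 9 * y ≤ 4 * z := by nlinarith
    -- Now `9 y ≤ 4 z` and `3 z ^ 2 ≤ 20 y` give `27 z ≤ 80`, whereas `y ≥ 12` forces `z ≥ 27`.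
    nlinarith
  subst hx1
  have hy1 : 3 ≤ y := by lia
  have hz1 : z < 6 := by
    by_contra hh
    have hz6 : 6 ≤ z := by lia
    have b1 : 9 * y ≤ 8 * z := by nlinarith
    have b2 : 3 * z * 9 * z ≤ 20 * 8 * z := by nlinarith
    have b3 : 27 * z ≤ 160 := by nlinarith
    lia
  have hy2 : y < 4 := by
    by_contra hh
    have : 4 ≤ y := by lia
    interval_cases z <;> nlinarith
  have hy3 : y = 3 := by lia
  subst hy3
  refine ⟨rfl, rfl, ?_⟩
  interval_cases z <;> lia

/-- Every even positive definite quaternary form of determinant five is equivalent to `A₄`. -/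
theorem IsEvenFive.gramEquiv_cartan {G : Matrix (Fin 4) (Fin 4) ℤ} (hG : IsEvenFive G) :
    GramEquiv G (symmGram 2 (-1) 0 0 2 (-1) 0 2 (-1) 2) := by
  obtain ⟨a, b, c, d, e, f, g, h, k, l, hE, hmin⟩ := hG.exists_reduced
  have hG' := hG.of_equiv hE
  obtain ⟨a₀, _, _, _, _, _, _, _, _, _, hga⟩ := hG'.exists_eq_symmGram
  have ha₀ : a = 2 * a₀ := by simpa [symmGram] using congrFun (congrFun hga 0) 0
  have p1 := hG'.entry_pos
  have p2 := hG'.minorTwo_pos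
  have p3 := hG'.minorThree_pos
  have hdet := hG'.det
  -- In each of the three inequalities a shear makes an off-diagonal quantity small, and a swap of
  -- neighbouring basis vectors then changes only one of the three minors. Minimality of the sum
  -- thus bounds that minor alone.
  have i1 : 3 * a ^ 2 ≤ 4 * minorTwo a b e := by
    obtain ⟨t, ht⟩ := exists_abs_two_mul_add_le b p1
    have := hmin _ _ _ _ _ _ _ _ _ _ ((gramEquiv_shear_one t a b c d e f g h k l).trans
      (gramEquiv_swap_one _ _ _ _ _ _ _ _ _ _))
    have hle : a ≤ e + 2 * t * b + t ^ 2 * a := by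
      simp only [minorTwo, minorThree] at this
      linarith
    have hid : minorTwo a b e = a * (e + 2 * t * b + t ^ 2 * a) - (b + t * a) ^ 2 := by
      simp only [minorTwo]; ring
    nlinarith
  have i2 : 3 * minorTwo a b e ^ 2 ≤ 4 * a * minorThree a b c e f h := by
    obtain ⟨t, ht⟩ := exists_abs_two_mul_add_le (a * f - b * c) p2
    have := hmin _ _ _ _ _ _ _ _ _ _ ((gramEquiv_shear_two 0 t a b c d e f g h k l).trans
      (gramEquiv_swap_two _ _ _ _ _ _ _ _ _ _))
    have hle : minorTwo a b e ≤ minorTwo a (c + t * b) (h + 2 * t * f + t ^ 2 * e) := by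
      simp only [minorTwo, minorThree] at this ⊢
      linarith
    -- Sylvester's identity for bordered minors; below it is used once more with the full
    -- determinant, which is five.
    have hid : a * minorThree a b c e f h = minorTwo a b e *
        minorTwo a (c + t * b) (h + 2 * t * f + t ^ 2 * e)
        - (a * f - b * c + t * minorTwo a b e) ^ 2 := by
      simp only [minorTwo, minorThree]; ring
    nlinarith
  have i3 : 3 * minorThree a b c e f h ^ 2 ≤ 20 * minorTwo a b e := by
    obtain ⟨t, ht⟩ := exists_abs_two_mul_add_le
      (a * e * k + b * f * d + c * b * g - c * e * d - b * b * k - a * f * g) p3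
    have := hmin _ _ _ _ _ _ _ _ _ _ ((gramEquiv_shear_three 0 0 t a b c d e f g h k l).trans
      (gramEquiv_swap_three _ _ _ _ _ _ _ _ _ _))
    have hle : minorThree a b c e f h ≤
        minorThree a b (d + t * c) e (g + t * f) (l + 2 * t * k + t ^ 2 * h) := by
      simp only [minorTwo, minorThree] at this ⊢
      linarith
    have hid : minorTwo a b e * (symmGram a b c d e f g h k l).det = minorThree a b c e f h *
        minorThree a b (d + t * c) e (g + t * f) (l + 2 * t * k + t ^ 2 * h)
        - (a * e * k + b * f * d + c * b * g - c * e * d - b * b * k - a * f * g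
          + t * minorThree a b c e f h) ^ 2 := by
      rw [det_symmGram]
      simp only [minorTwo, minorThree]; ring
    rw [hdet] at hid
    nlinarith
  subst ha₀
  obtain ⟨rfl, m2, m3⟩ := minors_eq (by lia) p2 p3 i1 i2 i3
  clear hmin i1 i2 i3 p1 p2 p3 hga
  -- make the second basis vector a root
  obtain ⟨t, ht⟩ : ∃ t, b + t * 2 = 0 ∨ b + t * 2 = -1 := ⟨-((b + 1) / 2), by lia⟩
  have hE1 := hE.trans (gramEquiv_shear_one t _ b c d e f g h k l)
  have hb : b + t * (2 * 1) = -1 ∧ e + 2 * t * b + t ^ 2 * (2 * 1) = 2 := by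
    have : (2 * 1) * (e + 2 * t * b + t ^ 2 * (2 * 1)) - (b + t * (2 * 1)) ^ 2 = 3 := by
      rw [← m2]; simp only [minorTwo]; ring
    rcases ht with h0 | h0
    -- If the off-diagonal entry vanished, the second minor `3` would be even.
    · rw [mul_one, h0] at this; lia
    · rw [mul_one, h0] at this ⊢; lia
  have m3' : minorThree (2 * 1) (b + t * (2 * 1)) c (e + 2 * t * b + t ^ 2 * (2 * 1))
      (f + t * c) h = 4 := by
    rw [← m3]; simp only [minorThree]; ring
  rw [hb.1, hb.2] at m3' hE1
  generalize f + t * c = f at m3' hE1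
  generalize g + t * d = g at hE1
  -- make the third basis vector a root
  obtain ⟨s, hs⟩ : ∃ s, f + 2 * c + 3 * s = 0 ∨ f + 2 * c + 3 * s = 1 ∨ f + 2 * c + 3 * s = -1 :=
    ⟨-((f + 2 * c + 1) / 3), by lia⟩
  -- The two coefficients make the third vector orthogonal to the first. The remaining freedom `s`
  -- moves its product with the second vector by multiples of `3`; the product `0` is then excluded
  -- because the third minor `4` is not divisible by `3`.
  have hE2 := hE1.trans (gramEquiv_shear_two s (2 * s + c) _ _ c d _ f g h k l)
  rw [show c + s * (2 * 1) + (2 * s + c) * (-1) = 0 by ring,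
    show f + s * (-1) + (2 * s + c) * 2 = f + 2 * c + 3 * s by ring] at hE2
  generalize hh' : h + 2 * s * c + 2 * (2 * s + c) * f + s ^ 2 * (2 * 1) +
    2 * s * (2 * s + c) * -1 + (2 * s + c) ^ 2 * 2 = h' at hE2
  generalize k + s * d + (2 * s + c) * g = k at hE2
  have m3'' : 3 * h' - 2 * (f + 2 * c + 3 * s) ^ 2 = 4 := by
    rw [← m3', ← hh']; simp only [minorThree]; ring
  generalize f + 2 * c + 3 * s = f at *
  have hE3 : h' = 2 ∧ ∃ k, GramEquiv G (symmGram (2 * 1) (-1) 0 d 2 (-1) g 2 k l) := by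
    rcases hs with rfl | rfl | rfl
    · lia
    · obtain rfl : h' = 2 := by lia
      have := hE2.trans (gramEquiv_neg_two _ _ _ _ _ _ _ _ _ _)
      exact ⟨rfl, _, by simpa using this⟩
    · obtain rfl : h' = 2 := by lia
      exact ⟨rfl, _, hE2⟩
  obtain ⟨-, k, hE3⟩ := hE3
  -- make the last basis vector a root
  obtain ⟨s, hs⟩ : ∃ s, k + 2 * g + 3 * d + 4 * s = 0 ∨ k + 2 * g + 3 * d + 4 * s = 1 ∨
      k + 2 * g + 3 * d + 4 * s = -1 ∨ k + 2 * g + 3 * d + 4 * s = 2 :=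
    ⟨-((k + 2 * g + 3 * d + 1) / 4), by lia⟩
  -- These coefficients make the last vector orthogonal to the first two, and `s` is left to reduce
  -- its product with the third vector modulo `4`.
  have hE4 := hE3.trans (gramEquiv_shear_three s (2 * s + d) (g + 2 * d + 3 * s) _ _ _ d _ _ g _ k l)
  rw [show d + s * (2 * 1) + (2 * s + d) * (-1) + (g + 2 * d + 3 * s) * 0 = 0 by ring,
    show g + s * (-1) + (2 * s + d) * 2 + (g + 2 * d + 3 * s) * (-1) = 0 by ring,
    show k + s * 0 + (2 * s + d) * (-1) + (g + 2 * d + 3 * s) * 2 = k + 2 * g + 3 * d + 4 * s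
      by ring] at hE4
  generalize l + 2 * s * d + 2 * (2 * s + d) * g + 2 * (g + 2 * d + 3 * s) * k + s ^ 2 * (2 * 1)
    + (2 * s + d) ^ 2 * 2 + (g + 2 * d + 3 * s) ^ 2 * 2 + 2 * s * (2 * s + d) * -1
    + 2 * s * (g + 2 * d + 3 * s) * 0 + 2 * (2 * s + d) * (g + 2 * d + 3 * s) * -1 = l' at hE4
  generalize k + 2 * g + 3 * d + 4 * s = k at *
  have hd := (hG.of_equiv hE4).det
  rw [det_symmGram] at hd
  simp only [minorThree] at hd
  -- The determinant now reads `4 l' - 3 k ^ 2 = 5`, which excludes `k = 0` and `k = 2` and gives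
  -- `l' = 2` for `k = ±1`.
  rcases hs with rfl | rfl | rfl | rfl
  · lia
  · obtain rfl : l' = 2 := by lia
    have := hE4.trans (gramEquiv_neg_three _ _ _ _ _ _ _ _ _ _)
    simpa using this
  · obtain rfl : l' = 2 := by lia
    simpa using hE4
  · lia

end ClassNumber

/-! ## Coincident sublattices come from isometric overlattices -/

section Overlattice

open Matrix

/-- The Cartan matrix of `A₄`. -/
def cartanMatrix : Matrix (Fin 4) (Fin 4) ℤ := symmGram 2 (-1) 0 0 2 (-1) 0 2 (-1) 2

lemma rootB_eq_mulVec (x y : Fin 4 → ℤ) : rootB x y = x ⬝ᵥ (cartanMatrix *ᵥ y) := by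
  simp only [rootB_apply, cartanMatrix, symmGram, Matrix.mulVec, dotProduct_four, Matrix.of_apply,
    Matrix.cons_val]
  ring

lemma det_cartanMatrix : cartanMatrix.det = 5 := by
  rw [cartanMatrix, det_symmGram]; norm_num [minorThree]

lemma rootB_sum_right (x : Fin 4 → ℤ) (c : Fin 4 → ℤ) (e : Fin 4 → Fin 4 → ℤ) :
    rootB x (∑ k, c k • e k) = ∑ k, c k * rootB x (e k) := by
  simp only [Fin.sum_univ_four, rootB_add_right, rootB_smul_right]

/-- Elementary divisors of a coincident sublattice, with the functionals represented by vectors of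
the root lattice. -/
lemma IsCoincident.exists_root_divisors {C : AddSubgroup (Fin 4 → ℤ)} (hC : IsCoincident C)
    (h0 : C.index ≠ 0) :
    ∃ (e x : Fin 4 → Fin 4 → ℤ) (a : Fin 4 → ℕ), (∀ i, 0 < a i) ∧
      (∀ i j, (a i : ℤ) ∣ rootB (x i) (e j) - if i = j then 1 else 0) ∧
      (∀ y, y ∈ C ↔ ∀ i, (a i : ℤ) ∣ rootB (x i) y) ∧ ∏ i, a i = C.index := by
  obtain ⟨e, φ, a, ha, hφ, hmem, hprod⟩ := C.exists_elementary_divisors h0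
  have hx : ∀ i, ∃ x, ∃ g : Fin 4 → ℤ, cartan x = φ i - (a i : ℤ) • g := by
    intro i
    -- If `5 ∣ a i`, coincidence applied to five times the dual vector with modulus `5 a i` shows
    -- that the class of `φ i` in `A₄^* / A₄` is trivial. Otherwise `a i` is invertible modulo five
    -- and a multiple of `a i` can be subtracted to kill the class.
    by_cases h5 : (5 : ℤ) ∣ a i
    · have h1 : ((5 * a i : ℕ) : ℤ) ∣ rootQ (cartanAdj (φ i)) := by
        refine hC _ _ (by have := ha i; positivity) fun y hy => ?_
        rw [rootB_cartanAdj]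
        push_cast
        exact mul_dvd_mul_left 5 ((hmem y).1 hy i)
      rw [rootQ_cartanAdj] at h1
      push_cast at h1
      have h2 : (a i : ℤ) ∣ weightQ (φ i) := Int.dvd_of_mul_dvd_mul_left (by norm_num) h1
      obtain ⟨x, hx⟩ := exists_cartan_eq_of_dvd_weightQ (h5.trans h2)
      exact ⟨x, 0, by simpa using hx⟩
    · have hco : IsCoprime (5 : ℤ) (a i) :=
        (Nat.prime_iff_prime_int.1 Nat.prime_five).coprime_iff_not_dvd.2 h5
      obtain ⟨s, t, hst⟩ := hco
      set m := φ i 0 + 2 * φ i 1 + 3 * φ i 2 + 4 * φ i 3 with hm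
      obtain ⟨x, hx⟩ := exists_cartan_eq (φ := φ i - (a i : ℤ) • ![t * m, 0, 0, 0]) (by
        refine ⟨s * m, ?_⟩
        simp only [Pi.sub_apply, Pi.smul_apply, smul_eq_mul, Matrix.cons_val]
        linear_combination -hm - m * hst)
      exact ⟨x, _, hx⟩
  choose x g hxg using hx
  have key : ∀ i y, rootB (x i) y = φ i ⬝ᵥ y - a i * (g i ⬝ᵥ y) := by
    intro i y
    rw [rootB, hxg, sub_dotProduct, smul_dotProduct, smul_eq_mul]
  refine ⟨e, x, a, ha, fun i j => ?_, fun y => ?_, hprod⟩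
  · rw [key, hφ]
    exact ⟨-(g i ⬝ᵥ e j), by ring⟩
  · rw [hmem]
    refine forall_congr' fun i => ?_
    rw [key, dvd_sub_left (dvd_mul_right _ _)]

/-- The vectors representing the elementary divisors can be chosen isotropic modulo squares. -/
lemma IsCoincident.exists_isotropic_divisors {C : AddSubgroup (Fin 4 → ℤ)} (hC : IsCoincident C)
    (h0 : C.index ≠ 0) :
    ∃ (e x : Fin 4 → Fin 4 → ℤ) (a : Fin 4 → ℕ), (∀ i, 0 < a i) ∧
      (∀ i j, (a i : ℤ) ∣ rootB (x i) (e j) - if i = j then 1 else 0) ∧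
      (∀ y, y ∈ C ↔ ∀ i, (a i : ℤ) ∣ rootB (x i) y) ∧ ∏ i, a i = C.index ∧
      (∀ i, (a i : ℤ) ^ 2 ∣ rootQ (x i)) ∧ ∀ i j, (a i * a j : ℤ) ∣ rootB (x i) (x j) := by
  obtain ⟨e, x, a, ha, hd, hmem, hprod⟩ := hC.exists_root_divisors h0
  have hq : ∀ i, (a i : ℤ) ∣ rootQ (x i) := fun i =>
    hC _ _ (ha i) fun y hy => (hmem y).1 hy i
  have hb : ∀ i j, (Int.gcd (a i) (a j) : ℤ) ∣ rootB (x i) (x j) := by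
    intro i j
    have hi : (Int.gcd (a i) (a j) : ℤ) ∣ a i := Int.gcd_dvd_left ..
    have hj : (Int.gcd (a i) (a j) : ℤ) ∣ a j := Int.gcd_dvd_right ..
    have h1 := hC (x i + x j) (Int.gcd (a i) (a j)) (Int.gcd_pos_of_ne_zero_left _ (by
      exact_mod_cast (ha i).ne')) fun y hy => by
        rw [rootB_add_left]
        exact dvd_add (hi.trans ((hmem y).1 hy i)) (hj.trans ((hmem y).1 hy j))
    rw [rootQ_add] at h1
    exact (dvd_add_right (dvd_add (hi.trans (hq i)) (hj.trans (hq j)))).1 h1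
  have hst : ∀ i j, ∃ s t : ℤ, rootB (x i) (x j) + a j * t + a i * s = 0 := by
    intro i j
    obtain ⟨m, hm⟩ := hb i j
    rw [Int.gcd_eq_gcd_ab] at hm
    exact ⟨-m * Int.gcdA (a i) (a j), -m * Int.gcdB (a i) (a j), by rw [hm]; ring⟩
  choose s t hst using hst
  choose q hq using hq
  -- The vectors are changed to `x i + a i • w i`. Modulo `a i ^ 2` and `a i * a j` the new form
  -- values depend linearly on the pairings of `x i` with `w j`, and `c j i` is the value that this
  -- pairing must have modulo `a i`. The dual vectors `e` realise all prescribed values.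
  let c : Fin 4 → Fin 4 → ℤ := fun i j => if i < j then s i j else if j < i then t j i else -q i
  have hcq : ∀ i, rootQ (x i) + a i * c i i = 0 := by
    intro i; simp [c, hq i]
  have hcb : ∀ i j, i ≠ j → rootB (x i) (x j) + a j * c j i + a i * c i j = 0 := by
    intro i j hij
    rcases lt_or_gt_of_ne hij with h | h
    · simp [c, h, h.not_gt, hst i j]
    · simp only [c, h, h.not_gt, if_true, if_false]
      rw [rootB_comm]
      linarith [hst j i]
  have hw : ∀ i j, (a i : ℤ) ∣ rootB (x i) (∑ k, c j k • e k) - c j i := by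
    intro i j
    have : rootB (x i) (∑ k, c j k • e k) - c j i
        = ∑ k, c j k * (rootB (x i) (e k) - if i = k then 1 else 0) := by
      rw [rootB_sum_right]
      simp [mul_sub, Finset.sum_sub_distrib]
    rw [this]
    exact Finset.dvd_sum fun k _ => Dvd.dvd.mul_left (hd i k) _
  generalize hwdef : (fun j => ∑ k, c j k • e k) = w at hw
  have hw : ∀ i j, (a i : ℤ) ∣ rootB (x i) (w j) - c j i := by
    intro i j; rw [← hwdef]; exact hw i j
  have hx' : ∀ i y, (a i : ℤ) ∣ rootB (x i + (a i : ℤ) • w i) y - rootB (x i) y := by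
    intro i y
    rw [rootB_add_left, rootB_smul_left]
    exact ⟨rootB (w i) y, by ring⟩
  refine ⟨e, fun i => x i + (a i : ℤ) • w i, a, ha, fun i j => ?_, fun y => ?_, hprod,
    fun i => ?_, fun i j => ?_⟩
  · have := dvd_add (hx' i (e j)) (hd i j)
    rwa [sub_add_sub_cancel] at this
  · rw [hmem]
    refine forall_congr' fun i => ?_
    constructor
    · intro h; simpa using dvd_add (hx' i y) h
    · intro h; simpa using dvd_sub h (hx' i y)
  · obtain ⟨m, hm⟩ := hw i i
    refine ⟨m + rootQ (w i), ?_⟩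
    rw [rootQ_add, rootQ_smul, rootB_smul_right]
    linear_combination hcq i + a i * hm
  · by_cases hij : i = j
    · subst hij
      obtain ⟨m, hm⟩ := hw i i
      refine ⟨2 * (m + rootQ (w i)), ?_⟩
      rw [rootB_self, rootQ_add, rootQ_smul, rootB_smul_right]
      linear_combination 2 * hcq i + 2 * a i * hm
    · obtain ⟨m, hm⟩ := hw i j
      obtain ⟨m', hm'⟩ := hw j i
      refine ⟨m + m' + rootB (w i) (w j), ?_⟩
      simp only [rootB_add_left, rootB_add_right, rootB_smul_left, rootB_smul_right]
      rw [rootB_comm (w i) (x j)]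
      linear_combination hcb i j hij + a j * hm + a i * hm'

lemma dvd_rootB_of_mem_closure {T : Set (Fin 4 → ℤ)} {D : ℤ}
    (hB : ∀ s ∈ T, ∀ t ∈ T, D ∣ rootB s t) {v w : Fin 4 → ℤ} (hv : v ∈ AddSubgroup.closure T)
    (hw : w ∈ AddSubgroup.closure T) : D ∣ rootB v w := by
  have h1 : ∀ s ∈ T, D ∣ rootB s w := by
    intro s hs
    induction hw using AddSubgroup.closure_induction with
    | mem t ht => exact hB s hs t ht
    | zero => simp [rootB_zero_right]
    | add a b _ _ ha hb => rw [rootB_add_right]; exact dvd_add ha hb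
    | neg a _ ha => rw [rootB_neg_right]; exact (dvd_neg).2 ha
  induction hv using AddSubgroup.closure_induction with
  | mem t ht => exact h1 t ht
  | zero => simp [rootB_zero_left]
  | add a b _ _ ha hb => rw [rootB_add_left]; exact dvd_add ha hb
  | neg a _ ha => rw [rootB_comm, rootB_neg_right, rootB_comm]; exact (dvd_neg).2 ha

lemma dvd_rootQ_of_mem_closure {T : Set (Fin 4 → ℤ)} {D : ℤ}
    (hB : ∀ s ∈ T, ∀ t ∈ T, D ∣ rootB s t) (hQ : ∀ s ∈ T, D ∣ rootQ s) {v : Fin 4 → ℤ}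
    (hv : v ∈ AddSubgroup.closure T) : D ∣ rootQ v := by
  induction hv using AddSubgroup.closure_induction with
  | mem t ht => exact hQ t ht
  | zero => simp [rootQ]
  | add a b ha' hb' ha hb =>
    rw [rootQ_add]
    exact dvd_add (dvd_add ha hb) (dvd_rootB_of_mem_closure hB ha' hb')
  | neg a _ ha => rwa [rootQ_neg]

/-- The sublattice `n ℤ⁴`. -/
def scaledLattice (n : ℕ) : AddSubgroup (Fin 4 → ℤ) := (⊤ : AddSubgroup (Fin 4 → ℤ)).map
  (nsmulAddMonoidHom n)

lemma mem_scaledLattice {n : ℕ} {y : Fin 4 → ℤ} : y ∈ scaledLattice n ↔ ∃ z, n • z = y := by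
  simp [scaledLattice]

lemma index_scaledLattice (n : ℕ) (hn : n ≠ 0) : (scaledLattice n).index = n ^ 4 := by
  have : NeZero n := ⟨hn⟩
  let f : (Fin 4 → ℤ) →+ (Fin 4 → ZMod n) := (Int.castAddHom (ZMod n)).compLeft (Fin 4)
  have hf : Function.Surjective f := by
    intro y
    choose z hz using fun i => ZMod.intCast_surjective (y i)
    exact ⟨z, funext hz⟩
  have : scaledLattice n = f.ker := by
    ext y
    rw [mem_scaledLattice, AddMonoidHom.mem_ker, funext_iff]
    simp only [f, AddMonoidHom.compLeft_apply, Function.comp, Int.coe_castAddHom, Pi.zero_apply,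
      ZMod.intCast_zmod_eq_zero_iff_dvd]
    constructor
    · rintro ⟨z, rfl⟩ i
      simp
    · intro h
      choose z hz using h
      exact ⟨z, funext fun i => by simp [hz i]⟩
  rw [this, AddSubgroup.index_ker, AddMonoidHom.range_eq_top.2 hf]
  simp

/-- A coincident sublattice of index `n` consists of the vectors `y` with `n y` in a lattice that is
isometric to the root lattice scaled by `n`. -/
theorem IsCoincident.exists_isometric {C : AddSubgroup (Fin 4 → ℤ)} (hC : IsCoincident C)
    (h0 : C.index ≠ 0) :
    ∃ M : Matrix (Fin 4) (Fin 4) ℤ, Mᵀ * cartanMatrix * M = ((C.index : ℤ) ^ 2) • cartanMatrix ∧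
      ∀ y, y ∈ C ↔ ∃ z, (C.index : ℤ) • y = M *ᵥ z := by
  obtain ⟨e, x, a, ha, hd, hmem, hprod, hQ, hB⟩ := hC.exists_isotropic_divisors h0
  generalize hn : C.index = n at *
  have hn0 : (n : ℤ) ≠ 0 := by exact_mod_cast h0
  have hq : ∀ i, ∃ q : ℕ, n = a i * q := fun i => by
    rw [← hprod]; exact Finset.dvd_prod_of_mem a (Finset.mem_univ i)
  choose q hq using hq
  have hqz : ∀ i, (n : ℤ) = a i * q i := fun i => by exact_mod_cast hq i
  -- The span of `T` is `n` times the lattice generated by `C` and the glue vectors `x i / a i`;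
  -- scaling by `n` keeps everything inside `ℤ⁴`.
  let T : Set (Fin 4 → ℤ) := {v | ∃ c ∈ C, v = (n : ℤ) • c} ∪ Set.range fun i => (q i : ℤ) • x i
  let N := AddSubgroup.closure T
  have hTB : ∀ s ∈ T, ∀ t ∈ T, (n : ℤ) ^ 2 ∣ rootB s t := by
    have mixed : ∀ c ∈ C, ∀ i, (n : ℤ) ^ 2 ∣ rootB ((n : ℤ) • c) ((q i : ℤ) • x i) := by
      intro c hc i
      rw [rootB_smul_left, rootB_smul_right, rootB_comm, sq]
      refine mul_dvd_mul_left _ ?_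
      nth_rw 1 [hqz i, mul_comm]
      exact mul_dvd_mul_left _ ((hmem c).1 hc i)
    rintro s (⟨c, hc, rfl⟩ | ⟨i, rfl⟩) t (⟨c', hc', rfl⟩ | ⟨j, rfl⟩)
    · rw [rootB_smul_left, rootB_smul_right]
      exact ⟨rootB c c', by ring⟩
    · exact mixed c hc j
    · rw [rootB_comm]; exact mixed c' hc' i
    · simp only [rootB_smul_left, rootB_smul_right]
      obtain ⟨m, hm⟩ := hB i j
      refine ⟨m, ?_⟩
      rw [hm, sq]
      nth_rw 1 [hqz i]
      rw [hqz j]; ring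
  have hTQ : ∀ s ∈ T, (n : ℤ) ^ 2 ∣ rootQ s := by
    rintro s (⟨c, hc, rfl⟩ | ⟨i, rfl⟩)
    · rw [rootQ_smul]; exact dvd_mul_right _ _
    · simp only [rootQ_smul]
      rw [hqz i, mul_pow, mul_comm]
      exact mul_dvd_mul_left _ (hQ i)
  have hNB : ∀ {v w}, v ∈ N → w ∈ N → (n : ℤ) ^ 2 ∣ rootB v w := fun hv hw =>
    dvd_rootB_of_mem_closure hTB hv hw
  have hNQ : ∀ {v}, v ∈ N → (n : ℤ) ^ 2 ∣ rootQ v := fun hv => dvd_rootQ_of_mem_closure hTB hTQ hv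
  have hCN : ∀ y, y ∈ C ↔ (n : ℤ) • y ∈ N := by
    intro y
    refine ⟨fun hy => AddSubgroup.subset_closure (Or.inl ⟨y, hy, rfl⟩), fun hy => ?_⟩
    rw [hmem]
    intro i
    have h1 := hNB (AddSubgroup.subset_closure (Or.inr ⟨i, rfl⟩)) hy
    simp only [rootB_smul_left, rootB_smul_right] at h1
    have h2 : (q i * n : ℤ) * a i ∣ (q i * n : ℤ) * rootB (x i) y := by
      convert h1 using 1
      · rw [sq]; nth_rw 2 [hqz i]; ring
      · ring
    refine Int.dvd_of_mul_dvd_mul_left ?_ h2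
    have : (q i : ℤ) ≠ 0 := fun h => hn0 (by rw [hqz i, h, mul_zero])
    exact mul_ne_zero this hn0
  -- the index of `N`
  have hNH : N.relIndex (scaledLattice n) = n := by
    rw [← AddSubgroup.inf_relIndex_right]
    have : N ⊓ scaledLattice n = C.map (nsmulAddMonoidHom n) := by
      ext v
      simp only [AddSubgroup.mem_inf, mem_scaledLattice, AddSubgroup.mem_map,
        nsmulAddMonoidHom_apply]
      constructor
      · rintro ⟨hv, z, rfl⟩
        exact ⟨z, (hCN z).2 (by simpa using hv), rfl⟩
      · rintro ⟨z, hz, rfl⟩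
        exact ⟨by simpa using (hCN z).1 hz, z, rfl⟩
    rw [this, scaledLattice, AddSubgroup.relIndex_map_map_of_injective, AddSubgroup.relIndex_top_right,
      hn]
    intro u v huv
    exact smul_right_injective _ h0 huv
  have hxN : ∀ i, (q i : ℤ) • x i ∈ N := fun i => AddSubgroup.subset_closure (Or.inr ⟨i, rfl⟩)
  -- The index of `N ∩ nℤ⁴` in `ℤ⁴` is computed through `N` and through `nℤ⁴`.
  have hmul : N.index * (scaledLattice n).relIndex N = n ^ 4 * n := by
    rw [mul_comm, ← AddSubgroup.inf_relIndex_right, AddSubgroup.relIndex_mul_index inf_le_right,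
      inf_comm, ← AddSubgroup.relIndex_mul_index (inf_le_right : N ⊓ scaledLattice n ≤ _),
      AddSubgroup.inf_relIndex_right, hNH, index_scaledLattice n h0, mul_comm]
  have hHN : n ≤ (scaledLattice n).relIndex N ∧ N.index ≠ 0 := by
    have hne : N.index * (scaledLattice n).relIndex N ≠ 0 := by rw [hmul]; positivity
    refine ⟨?_, left_ne_zero_of_mul hne⟩
    have hfin : Finite (N ⧸ (scaledLattice n).addSubgroupOf N) :=
      Nat.finite_of_card_ne_zero (right_ne_zero_of_mul hne)
    -- The glue vectors generate at least `n` classes: pairing with `e j` recovers the coefficient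
    -- of the `j`-th one modulo `a j`.
    let F : (∀ i, Fin (a i)) → N ⧸ (scaledLattice n).addSubgroupOf N := fun m =>
      QuotientAddGroup.mk (⟨∑ i, (m i : ℤ) • ((q i : ℤ) • x i), sum_mem fun i _ =>
        zsmul_mem (hxN i) _⟩ : N)
    have hF : Function.Injective F := by
      intro m m' hmm
      rw [QuotientAddGroup.eq, AddSubgroup.mem_addSubgroupOf, mem_scaledLattice] at hmm
      obtain ⟨z, hz⟩ := hmm
      simp only [AddSubgroup.coe_add, AddSubgroup.coe_neg] at hz
      funext j
      have h1 := congrArg (fun v => rootB (e j) v) hz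
      simp only [rootB_add_right, rootB_neg_right, rootB_sum_right, rootB_smul_right] at h1
      rw [← Nat.cast_smul_eq_nsmul ℤ, rootB_smul_right] at h1
      have h2 : ∀ m : ∀ i, Fin (a i), ∃ u, ∑ i, (m i : ℤ) * ((q i : ℤ) * rootB (e j) (x i))
          = (m j : ℤ) * q j + n * u := by
        intro m
        choose u hu using fun i => hd i j
        refine ⟨∑ i, m i * u i, ?_⟩
        rw [Finset.mul_sum, ← sub_eq_iff_eq_add']
        have : (m j : ℤ) * q j = ∑ i, (m i : ℤ) * q i * (if i = j then 1 else 0) := by simp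
        rw [this, ← Finset.sum_sub_distrib]
        refine Finset.sum_congr rfl fun i _ => ?_
        have := hu i
        rw [rootB_comm] at this
        rw [hqz i]
        linear_combination (m i : ℤ) * q i * this
      obtain ⟨u, hu⟩ := h2 m
      obtain ⟨u', hu'⟩ := h2 m'
      rw [hu, hu'] at h1
      have hq0 : (q j : ℤ) ≠ 0 := fun h => hn0 (by rw [hqz j, h, mul_zero])
      have h3 : (a j : ℤ) ∣ (m' j : ℤ) - m j := by
        refine Int.dvd_of_mul_dvd_mul_left hq0 ⟨rootB (e j) z + u - u', ?_⟩
        have := hqz j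
        linear_combination -h1 + (rootB (e j) z + u - u') * this
      have h4 : (m j : ℕ) ≡ m' j [MOD a j] := (Nat.modEq_iff_dvd).2 h3
      exact Fin.ext (Nat.ModEq.eq_of_lt_of_lt h4 (m j).2 (m' j).2)
    have := Nat.card_le_card_of_injective F hF
    rw [Nat.card_pi] at this
    rw [AddSubgroup.relIndex, AddSubgroup.index]
    simpa [hprod] using this
  have hidx : N.index ≤ n ^ 4 := by
    have hpos : 0 < n := Nat.pos_of_ne_zero h0
    refine Nat.le_of_mul_le_mul_right ?_ hpos
    rw [← hmul]
    exact Nat.mul_le_mul_left _ hHN.1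
  -- a basis of `N` and its Gram matrix
  have hfin : Finite ((Fin 4 → ℤ) ⧸ AddSubgroup.toIntSubmodule N) :=
    Nat.finite_of_card_ne_zero hHN.2
  have hrank := (Submodule.finiteQuotient_iff (AddSubgroup.toIntSubmodule N)).1 hfin
  rw [Module.finrank_fin_fun] at hrank
  let β : Basis (Fin 4) ℤ N := Module.finBasisOfFinrankEq ℤ (AddSubgroup.toIntSubmodule N) hrank
  let M : Matrix (Fin 4) (Fin 4) ℤ := Matrix.of fun i j => (β j : Fin 4 → ℤ) i
  have hM : ∀ w, M *ᵥ w = ((∑ i, w i • β i : N) : Fin 4 → ℤ) := by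
    intro w
    ext k
    simp [M, Matrix.mulVec, dotProduct, mul_comm]
  have hMN : ∀ v, v ∈ N ↔ ∃ w, v = M *ᵥ w := by
    intro v
    constructor
    · intro hv
      refine ⟨β.repr ⟨v, hv⟩, ?_⟩
      rw [hM, β.sum_repr]
    · rintro ⟨w, rfl⟩
      rw [hM]; exact Subtype.property _
  have hMdet : N.index = M.det.natAbs := by
    rw [AddSubgroup.index_eq_natAbs_det (Pi.basisFun ℤ (Fin 4)) N β, Basis.det_apply]
    rfl
  have hMG : ∀ v w, v ⬝ᵥ ((Mᵀ * cartanMatrix * M) *ᵥ w) = rootB (M *ᵥ v) (M *ᵥ w) := by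
    intro v w
    rw [rootB_eq_mulVec, ← Matrix.mulVec_mulVec, ← Matrix.mulVec_mulVec, Matrix.dotProduct_mulVec,
      Matrix.vecMul_transpose]
  have hent : ∀ i j, (Mᵀ * cartanMatrix * M) i j = rootB (M *ᵥ Pi.single i 1)
      (M *ᵥ Pi.single j 1) := by
    intro i j
    rw [← hMG]
    simp
  have hdvd : ∀ i j, (n : ℤ) ^ 2 ∣ (Mᵀ * cartanMatrix * M) i j := by
    intro i j
    rw [hent]
    exact hNB ((hMN _).2 ⟨_, rfl⟩) ((hMN _).2 ⟨_, rfl⟩)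
  choose G hG using hdvd
  have hGM : Mᵀ * cartanMatrix * M = ((n : ℤ) ^ 2) • Matrix.of G := by
    ext i j; rw [hG]; simp
  have hdetG : (n : ℤ) ^ 8 * (Matrix.of G).det = 5 * (N.index : ℤ) ^ 2 := by
    have := congrArg Matrix.det hGM
    rw [Matrix.det_mul, Matrix.det_mul, Matrix.det_transpose, det_cartanMatrix, Matrix.det_smul]
      at this
    rw [hMdet, Int.natCast_natAbs, sq_abs]
    simp only [Fintype.card_fin] at this
    linear_combination -this
  have hGE : IsEvenFive (Matrix.of G) := by
    refine ⟨?_, ?_, fun v hv => ?_⟩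
    · choose r hr using fun i => hNQ ((hMN _).2 ⟨Pi.single i 1, rfl⟩)
      refine ⟨Matrix.of fun i j => if i < j then G i j else if i = j then r i else 0, ?_⟩
      have hsymm : ∀ i j, G i j = G j i := by
        intro i j
        have h1 := hG i j
        have h2 := hG j i
        rw [hent] at h1 h2
        rw [rootB_comm] at h2
        exact mul_left_cancel₀ (pow_ne_zero 2 hn0) (h1.symm.trans h2)
      ext i j
      simp only [Matrix.of_apply, Matrix.add_apply, Matrix.transpose_apply]
      rcases lt_trichotomy i j with h | h | h
      · simp [h, h.not_gt, h.ne']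
      · subst h
        have h1 := hG i i
        rw [hent, rootB_self, hr] at h1
        simp only [lt_irrefl, if_false, if_true]
        exact mul_left_cancel₀ (pow_ne_zero 2 hn0) (by linear_combination -h1)
      · simp [h, h.not_gt, h.ne', hsymm i j]
    · generalize (Matrix.of G).det = D at hdetG
      have hn4 : (0 : ℤ) < (n : ℤ) ^ 4 := by positivity
      -- With `k = 5 [ℤ⁴ : N] / n ^ 4` the determinant identity becomes `k ^ 2 = 5 D`. The bound on
      -- the index gives `k ≤ 5`, and `5 ∣ k ^ 2` leaves only `k = 5`.
      have h1 : ((n : ℤ) ^ 4) ^ 2 ∣ (5 * (N.index : ℤ)) ^ 2 := ⟨5 * D, by linear_combination -5 * hdetG⟩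
      obtain ⟨k, hk⟩ := (Int.pow_dvd_pow_iff two_ne_zero).1 h1
      have h2 : k ^ 2 = 5 * D := by
        have : ((n : ℤ) ^ 4) ^ 2 * k ^ 2 = ((n : ℤ) ^ 4) ^ 2 * (5 * D) := by
          linear_combination -5 * hdetG - (5 * (N.index : ℤ) + (n : ℤ) ^ 4 * k) * hk
        exact mul_left_cancel₀ (by positivity) this
      have h3 : k ≤ 5 := by
        have : (N.index : ℤ) ≤ (n : ℤ) ^ 4 := by exact_mod_cast hidx
        by_contra hcon
        nlinarith
      have h4 : 0 < k := by
        have : 0 < (N.index : ℤ) := by exact_mod_cast Nat.pos_of_ne_zero hHN.2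
        by_contra hcon
        nlinarith
      interval_cases k <;> lia
    · have hne : M *ᵥ v ≠ 0 := by
        rw [hM]
        intro h
        have h1 : (∑ i, v i • β i : N) = 0 := Subtype.ext h
        exact hv (funext (Fintype.linearIndependent_iff.1 β.linearIndependent v h1))
      have h1 := rootQ_pos hne
      have h2 := hMG v v
      rw [rootB_self, hGM, Matrix.smul_mulVec, dotProduct_smul, smul_eq_mul] at h2
      have : 0 < (n : ℤ) ^ 2 := by positivity
      by_contra hcon
      nlinarith
  obtain ⟨U, V, hUV, hU⟩ := hGE.gramEquiv_cartan
  refine ⟨M * U, ?_, fun y => ?_⟩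
  · rw [Matrix.transpose_mul, show Uᵀ * Mᵀ * cartanMatrix * (M * U)
      = Uᵀ * (Mᵀ * cartanMatrix * M) * U by simp only [Matrix.mul_assoc], hGM]
    rw [Matrix.mul_smul, Matrix.smul_mul, hU]
    rfl
  · rw [hCN, hMN]
    constructor
    · rintro ⟨w, hw⟩
      refine ⟨V *ᵥ w, ?_⟩
      rw [hw, Matrix.mulVec_mulVec, Matrix.mul_assoc, hUV, Matrix.mul_one]
    · rintro ⟨z, hz⟩
      exact ⟨U *ᵥ z, by rw [hz, Matrix.mulVec_mulVec]⟩

end Overlattice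

/-! ## Coincidence site lattices of a root lattice in a Euclidean space -/

section Geometry

open Matrix

variable {E : Type*} [NormedAddCommGroup E] [InnerProductSpace ℝ E]

/-- The embedding of `ℤ⁴` as the lattice spanned by a basis. -/
noncomputable def latticeHom (b : Basis (Fin 4) ℝ E) : (Fin 4 → ℤ) →+ E where
  toFun x := b.equivFun.symm fun i => (x i : ℝ)
  map_zero' := by
    rw [← map_zero b.equivFun.symm]
    congr 1; ext i; simp
  map_add' x y := by
    rw [← map_add b.equivFun.symm]
    congr 1; ext i; simp

lemma latticeHom_apply (b : Basis (Fin 4) ℝ E) (x : Fin 4 → ℤ) :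
    latticeHom b x = b.equivFun.symm fun i => (x i : ℝ) := rfl

lemma latticeHom_injective (b : Basis (Fin 4) ℝ E) : Function.Injective (latticeHom b) := by
  intro x y h
  have := b.equivFun.symm.injective h
  ext i
  exact_mod_cast congrFun this i

lemma latticeHom_single (b : Basis (Fin 4) ℝ E) (n : ℤ) (i : Fin 4) :
    latticeHom b (n • Pi.single i 1) = (n : ℝ) • b i := by
  rw [latticeHom_apply, Basis.equivFun_symm_apply, Finset.sum_eq_single i]
  · simp
  · intro j _ hj; simp [hj]
  · simp

lemma range_latticeHom (b : Basis (Fin 4) ℝ E) :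
    (latticeHom b).range = AddSubgroup.closure (Set.range b) := by
  apply le_antisymm
  · rintro _ ⟨x, rfl⟩
    rw [latticeHom_apply, Basis.equivFun_symm_apply]
    refine sum_mem fun i _ => ?_
    have hi : b i ∈ AddSubgroup.closure (Set.range b) :=
      AddSubgroup.subset_closure (Set.mem_range_self i)
    rw [Int.cast_smul_eq_zsmul]
    exact zsmul_mem hi _
  · rw [AddSubgroup.closure_le]
    rintro _ ⟨i, rfl⟩
    exact ⟨(1 : ℤ) • Pi.single i 1, by rw [latticeHom_single]; simp⟩

/-- `b` is a base of simple roots of a root system `A₄` with roots of norm `2c`. -/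
structure IsRootBasis (b : Basis (Fin 4) ℝ E) (c : ℝ) : Prop where
  pos : 0 < c
  inner_eq : ∀ i j, inner ℝ (b i) (b j) = c * cartanMatrix i j

variable {b : Basis (Fin 4) ℝ E} {c : ℝ}

lemma IsRootBasis.inner_equivFun_symm (hb : IsRootBasis b c) (x y : Fin 4 → ℝ) :
    inner ℝ (b.equivFun.symm x) (b.equivFun.symm y) = c * rootB x y := by
  simp only [Basis.equivFun_symm_apply, Fin.sum_univ_four, inner_add_left, inner_add_right,
    real_inner_smul_left, real_inner_smul_right, hb.inner_eq, rootB_apply]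
  simp only [cartanMatrix, symmGram, Matrix.of_apply, Matrix.cons_val]
  push_cast
  ring

lemma coincidenceIndex_range (R : E ≃ₗᵢ[ℝ] E) :
    coincidenceIndex (latticeHom b).range R =
      ((isometryImage R (latticeHom b).range).comap (latticeHom b)).index := by
  rw [coincidenceIndex, ← AddSubgroup.map_comap_eq, AddMonoidHom.range_eq_map,
    AddSubgroup.relIndex_map_map_of_injective _ _ (latticeHom_injective b),
    AddSubgroup.relIndex_top_right]

lemma mem_isometryImage {R : E ≃ₗᵢ[ℝ] E} {Γ : AddSubgroup E} {v : E} :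
    v ∈ isometryImage R Γ ↔ ∃ w ∈ Γ, R w = v := Iff.rfl

/-- Integral functionals on the intersection of two lattices extend. -/
lemma exists_functional_extension (R : E ≃ₗᵢ[ℝ] E) (x : Fin 4 → ℤ) (k : ℕ)
    (hx : ∀ y z, latticeHom b y = R (latticeHom b z) → (k : ℤ) ∣ rootB x y) :
    ∃ γ δ : Fin 4 → ℤ, ∀ y z, latticeHom b y = R (latticeHom b z) →
      rootB x y = k * (γ ⬝ᵥ y + δ ⬝ᵥ z) := by
  -- The kernel of `(y, z) ↦ y - Rz` is the intersection of the two lattices. Its image is finitely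
  -- generated and torsion free, hence free, so the kernel is a direct summand.
  let f : ((Fin 4 → ℤ) × (Fin 4 → ℤ)) →ₗ[ℤ] E :=
    (AddMonoidHom.toIntLinearMap (latticeHom b)).comp (LinearMap.fst ℤ _ _) -
      (AddMonoidHom.toIntLinearMap
        ((R.toLinearEquiv.toLinearMap.toAddMonoidHom).comp (latticeHom b))).comp
          (LinearMap.snd ℤ _ _)
  have hf : ∀ y z, f (y, z) = latticeHom b y - R (latticeHom b z) := fun y z => rfl
  have hfree : Module.Free ℤ (LinearMap.range f) := by
    have : Module.IsTorsionFree ℤ E := by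
      let _ : Module ℚ E := Module.compHom E (algebraMap ℚ ℝ)
      have : IsAddTorsionFree E := IsAddTorsionFree.of_module_rat E
      infer_instance
    infer_instance
  obtain ⟨s, hs⟩ := f.rangeRestrict.exists_rightInverse_of_surjective f.range_rangeRestrict
  have hs' : ∀ w, f (s w) = w := fun w => by
    have := LinearMap.congr_fun hs w
    exact congrArg Subtype.val this
  let B : (Fin 4 → ℤ) →ₗ[ℤ] ℤ :=
    { toFun := rootB x
      map_add' := rootB_add_right x
      map_smul' := fun m y => rootB_smul_right m x y }
  -- The functional is extended by composing it with the projection onto the kernel, so all its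
  -- values remain divisible by `k`.
  let Ψ : ((Fin 4 → ℤ) × (Fin 4 → ℤ)) →ₗ[ℤ] ℤ :=
    (B.comp (LinearMap.fst ℤ _ _)).comp (LinearMap.id - s.comp f.rangeRestrict)
  have hdvd : ∀ w, (k : ℤ) ∣ Ψ w := by
    intro w
    have h0 : f (w - s (f.rangeRestrict w)) = 0 := by
      rw [map_sub, hs']
      exact sub_self _
    exact hx (w - s (f.rangeRestrict w)).1 (w - s (f.rangeRestrict w)).2
      (sub_eq_zero.1 ((hf _ _).symm.trans h0))
  choose g hg using hdvd
  refine ⟨fun i => g (fun j => if i = j then 1 else 0, 0),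
    fun i => g (0, fun j => if i = j then 1 else 0), fun y z hyz => ?_⟩
  have h0 : f.rangeRestrict (y, z) = 0 := Subtype.ext (by
    change f (y, z) = 0
    rw [hf, hyz, sub_self])
  have h1 : Ψ (y, z) = rootB x y := by
    change rootB x ((y, z) - s (f.rangeRestrict (y, z))).1 = _
    rw [h0, map_zero, sub_zero]
  have h2 : Ψ (y, z) = (Ψ.comp (LinearMap.inl ℤ _ _)) y + (Ψ.comp (LinearMap.inr ℤ _ _)) z := by
    simp only [LinearMap.comp_apply]
    rw [← map_add]
    simp
  rw [← h1, h2, LinearMap.pi_apply_eq_sum_univ, LinearMap.pi_apply_eq_sum_univ _ z, mul_add,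
    dotProduct, dotProduct, Finset.mul_sum, Finset.mul_sum]
  congr 1 <;> refine Finset.sum_congr rfl fun i _ => ?_
  · simp only [LinearMap.comp_apply, LinearMap.inl_apply, smul_eq_mul, hg]; ring
  · simp only [LinearMap.comp_apply, LinearMap.inr_apply, smul_eq_mul, hg]; ring

/-- The factor five, the discriminant, does no harm: it is cancelled when it is prime to `k`, and
otherwise `k ^ 2` is divisible by `5 k`. -/
lemma dvd_of_norm_identity {k : ℕ} {q m g d : ℤ}
    (h : 5 * q - 5 * k * m + k ^ 2 * g = k ^ 2 * d) : (k : ℤ) ∣ q := by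
  by_cases h5 : (5 : ℤ) ∣ k
  · obtain ⟨l, hl⟩ := h5
    refine ⟨m + l * (d - g), ?_⟩
    have : (5 : ℤ) * q = 5 * (k * (m + l * (d - g))) := by
      linear_combination h + (k * (d - g) : ℤ) * hl
    exact mul_left_cancel₀ (by norm_num) this
  · have hco : IsCoprime (5 : ℤ) k :=
      (Nat.prime_iff_prime_int.1 Nat.prime_five).coprime_iff_not_dvd.2 h5
    exact hco.symm.dvd_of_dvd_mul_left ⟨5 * m + k * (d - g), by linear_combination h⟩

/-- A vector `x/k` in the dual of `Γ ∩ RΓ` is a sum `γ + Rδ` with `γ` and `δ` in the dual of `Γ`.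
Equality of the norms of `x/k - γ` and `δ`, multiplied by `5 k ^ 2`, is the identity of
`dvd_of_norm_identity`. -/
lemma IsRootBasis.isCoincident_comap (hb : IsRootBasis b c) (R : E ≃ₗᵢ[ℝ] E)
    (h0 : ((isometryImage R (latticeHom b).range).comap (latticeHom b)).index ≠ 0) :
    IsCoincident ((isometryImage R (latticeHom b).range).comap (latticeHom b)) := by
  intro x k hk hx
  obtain ⟨γ, δ, hγδ⟩ := exists_functional_extension (b := b) R x k (fun y z hyz =>
    hx y ⟨_, ⟨z, rfl⟩, hyz.symm⟩)
  have hk' : (k : ℝ) ≠ 0 := by positivity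
  let cast : (Fin 4 → ℤ) → Fin 4 → ℝ := fun v i => Int.castRingHom ℝ (v i)
  have hcast : ∀ v, latticeHom b v = b.equivFun.symm (cast v) := fun v => rfl
  have hdot : ∀ u v, cast u ⬝ᵥ cast v = ((u ⬝ᵥ v : ℤ) : ℝ) := by
    intro u v; simp [cast, dotProduct_four]
  have hweight : ∀ u, weightQ (cast u) = ((weightQ u : ℤ) : ℝ) := by
    intro u; simp [cast, weightQ]
  let dual : (Fin 4 → ℤ) → Fin 4 → ℝ := fun φ => (1 / 5 : ℝ) • cartanAdj (cast φ)
  have hdualB : ∀ φ v, rootB (dual φ) (cast v) = ((φ ⬝ᵥ v : ℤ) : ℝ) := by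
    intro φ v
    rw [rootB_smul_left, rootB_cartanAdj, hdot]; ring
  have hdualQ : ∀ φ, rootQ (dual φ) = (1 / 5 : ℝ) * ((weightQ φ : ℤ) : ℝ) := by
    intro φ
    rw [rootQ_smul, rootQ_cartanAdj, hweight]; ring
  have hu : b.equivFun.symm ((k : ℝ)⁻¹ • cast x + (-1 : ℝ) • dual γ)
      = R (b.equivFun.symm (dual δ)) := by
    refine InnerProductSpace.ext_inner_left_basis b fun i => ?_
    obtain ⟨n, hn⟩ : ∃ n, n = ((isometryImage R (latticeHom b).range).comap
      (latticeHom b)).index := ⟨_, rfl⟩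
    -- Finite index puts multiples of all basis vectors into the intersection, so the equality of
    -- vectors may be tested on the intersection, where the functional is known.
    have hmem : (n : ℤ) • Pi.single i 1 ∈
        (isometryImage R (latticeHom b).range).comap (latticeHom b) := by
      rw [hn, Nat.cast_smul_eq_nsmul]
      exact AddSubgroup.nsmul_index_mem _ _
    obtain ⟨_, ⟨z, rfl⟩, hz⟩ := hmem
    change R (latticeHom b z) = _ at hz
    have hz' := hγδ _ _ hz.symm
    have h1 : inner ℝ (latticeHom b ((n : ℤ) • Pi.single i 1))
        (b.equivFun.symm ((k : ℝ)⁻¹ • cast x + (-1 : ℝ) • dual γ))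
        = inner ℝ (latticeHom b ((n : ℤ) • Pi.single i 1)) (R (b.equivFun.symm (dual δ))) := by
      conv_rhs => rw [← hz, LinearIsometryEquiv.inner_map_map]
      rw [hcast, hcast, hb.inner_equivFun_symm, hb.inner_equivFun_symm, rootB_comm,
        rootB_add_left, rootB_smul_left, rootB_smul_left, hdualB, rootB_comm _ (dual δ), hdualB,
        map_rootB (Int.castRingHom ℝ), hz']
      simp only [eq_intCast, Int.cast_mul, Int.cast_add, Int.cast_natCast]
      field_simp
      ring
    rw [latticeHom_single, real_inner_smul_left, real_inner_smul_left] at h1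
    refine mul_left_cancel₀ ?_ h1
    rw [← hn] at h0
    exact_mod_cast h0
  have hnorm : rootQ ((k : ℝ)⁻¹ • cast x + (-1 : ℝ) • dual γ) = rootQ (dual δ) := by
    have h1 := congrArg (fun v => inner ℝ v v) hu
    simp only [LinearIsometryEquiv.inner_map_map, hb.inner_equivFun_symm, rootB_self] at h1
    have := hb.pos
    have h2 := mul_left_cancel₀ this.ne' h1
    linarith
  rw [rootQ_add, rootQ_smul, rootQ_smul, rootB_smul_left, rootB_smul_right, rootB_comm, hdualB,
    hdualQ, hdualQ, map_rootQ (Int.castRingHom ℝ)] at hnorm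
  refine dvd_of_norm_identity (m := γ ⬝ᵥ x) (g := weightQ γ) (d := weightQ δ) ?_
  have : (5 * rootQ x - 5 * k * (γ ⬝ᵥ x) + k ^ 2 * weightQ γ : ℝ) = k ^ 2 * weightQ δ := by
    simp only [eq_intCast] at hnorm
    field_simp at hnorm
    linarith
  exact_mod_cast this

/-- The rational matrix `M / n` preserves the Gram matrix. -/
lemma IsRootBasis.exists_isometry (hb : IsRootBasis b c) {M : Matrix (Fin 4) (Fin 4) ℤ} {n : ℕ}
    (hn : n ≠ 0) (hM : Mᵀ * cartanMatrix * M = ((n : ℤ) ^ 2) • cartanMatrix) :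
    ∃ R : E ≃ₗᵢ[ℝ] E, ∀ z, (n : ℝ) • R (latticeHom b z) = latticeHom b (M *ᵥ z) := by
  have hn' : (n : ℝ) ≠ 0 := by exact_mod_cast hn
  have hfd : FiniteDimensional ℝ E := Module.Finite.of_basis b
  let T : E →ₗ[ℝ] E := b.equivFun.symm.toLinearMap ∘ₗ
    ((n : ℝ)⁻¹ • Matrix.mulVecLin (M.map (Int.cast : ℤ → ℝ))) ∘ₗ b.equivFun.toLinearMap
  have hT : ∀ v : Fin 4 → ℝ, T (b.equivFun.symm v)
      = b.equivFun.symm ((n : ℝ)⁻¹ • (M.map (Int.cast : ℤ → ℝ) *ᵥ v)) := by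
    intro v
    simp only [T, LinearMap.comp_apply, LinearEquiv.coe_coe, LinearEquiv.apply_symm_apply,
      LinearMap.smul_apply, Matrix.mulVecLin_apply]
  have hBr : ∀ u v : Fin 4 → ℝ, rootB u v = u ⬝ᵥ (cartanMatrix.map (Int.cast : ℤ → ℝ) *ᵥ v) := by
    intro u v
    simp only [rootB_apply, cartanMatrix, symmGram, Matrix.mulVec, dotProduct_four, Matrix.of_apply,
      Matrix.cons_val, Matrix.map_apply]
    push_cast
    ring
  have hMr : (M.map (Int.cast : ℤ → ℝ))ᵀ * cartanMatrix.map (Int.cast : ℤ → ℝ) *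
      M.map (Int.cast : ℤ → ℝ) = ((n : ℝ) ^ 2) • cartanMatrix.map (Int.cast : ℤ → ℝ) := by
    have := congrArg (fun A => A.map (Int.castRingHom ℝ)) hM
    simp only [Matrix.map_mul] at this
    rw [← Matrix.transpose_map]
    refine this.trans ?_
    ext i j
    simp only [Matrix.map_apply, Matrix.smul_apply, smul_eq_mul, eq_intCast, Int.cast_mul,
      Int.cast_pow, Int.cast_natCast]
  have hinner : ∀ u v, inner ℝ (T u) (T v) = inner ℝ u v := by
    intro u v
    obtain ⟨u, rfl⟩ := b.equivFun.symm.surjective u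
    obtain ⟨v, rfl⟩ := b.equivFun.symm.surjective v
    rw [hT, hT, hb.inner_equivFun_symm, hb.inner_equivFun_symm, rootB_smul_left, rootB_smul_right,
      hBr, hBr, Matrix.mulVec_mulVec, ← Matrix.vecMul_transpose, ← Matrix.dotProduct_mulVec,
      Matrix.mulVec_mulVec, ← Matrix.mul_assoc, hMr, Matrix.smul_mulVec, dotProduct_smul,
      smul_eq_mul]
    field_simp
  refine ⟨(T.isometryOfInner hinner).toLinearIsometryEquiv rfl, fun z => ?_⟩
  rw [LinearIsometry.toLinearIsometryEquiv_apply]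
  change (n : ℝ) • T _ = _
  rw [latticeHom_apply, hT, ← map_smul, smul_smul, mul_inv_cancel₀ hn', one_smul, latticeHom_apply]
  congr 1
  ext i
  simp [Matrix.mulVec, dotProduct]

/-- The coincidence site lattices of a root lattice `A₄` in coordinates. -/
theorem IsRootBasis.cslsOfIndex_eq (hb : IsRootBasis b c) {n : ℕ} (hn : n ≠ 0) :
    cslsOfIndex (latticeHom b).range n = AddSubgroup.map (latticeHom b) '' coincidentOfIndex n := by
  ext D
  constructor
  · rintro ⟨R, h1, h2, rfl⟩
    rw [IsCoincidenceIsometry, coincidenceIndex_range] at h1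
    rw [coincidenceIndex_range] at h2
    exact ⟨_, ⟨h2, hb.isCoincident_comap R h1⟩, AddSubgroup.map_comap_eq _ _⟩
  · rintro ⟨C, ⟨hC, hgood⟩, rfl⟩
    obtain ⟨M, hM, hmem⟩ := hgood.exists_isometric (by rwa [hC])
    rw [hC] at hM
    simp only [hC] at hmem
    obtain ⟨R, hR⟩ := hb.exists_isometry hn hM
    have hn' : (n : ℝ) ≠ 0 := by exact_mod_cast hn
    have hcomap : (isometryImage R (latticeHom b).range).comap (latticeHom b) = C := by
      ext y
      rw [hmem, AddSubgroup.mem_comap, mem_isometryImage]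
      have key : ∀ z, R (latticeHom b z) = latticeHom b y ↔ (n : ℤ) • y = M *ᵥ z := by
        intro z
        rw [← (latticeHom_injective b).eq_iff, ← hR, map_zsmul, ← Int.cast_smul_eq_zsmul ℝ,
          Int.cast_natCast, (smul_right_injective E hn').eq_iff, eq_comm]
      constructor
      · rintro ⟨_, ⟨z, rfl⟩, hz⟩
        exact ⟨z, (key z).1 hz⟩
      · rintro ⟨z, hz⟩
        exact ⟨_, ⟨z, rfl⟩, (key z).2 hz⟩
    refine ⟨R, ?_, ?_, ?_⟩
    · rwa [IsCoincidenceIsometry, coincidenceIndex_range, hcomap, hC]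
    · rw [coincidenceIndex_range, hcomap, hC]
    · rw [← AddSubgroup.map_comap_eq, hcomap]

/-- The value `0` encodes an infinite index, which a coincidence isometry excludes. -/
lemma cslsOfIndex_zero (Γ : AddSubgroup E) : cslsOfIndex Γ 0 = ∅ := by
  ext D
  simp only [cslsOfIndex, IsCoincidenceIsometry, Set.mem_ofPred_eq, Set.mem_empty_iff_false,
    iff_false]
  rintro ⟨R, h1, h2, -⟩
  exact h1 h2

theorem IsRootBasis.cslCount_eq (hb : IsRootBasis b c) {n : ℕ} (hn : n ≠ 0) :
    cslCount (latticeHom b).range n = (coincidentOfIndex n).ncard := by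
  rw [cslCount, hb.cslsOfIndex_eq hn]
  exact Set.ncard_image_of_injective _ (AddSubgroup.map_injective (latticeHom_injective b))

end Geometry

/-! ## Finiteness and multiplicativity -/

section Multiplicative

lemma scaledLattice_index_le {n : ℕ} {C : AddSubgroup (Fin 4 → ℤ)} (hC : C.index = n) :
    scaledLattice n ≤ C := by
  intro y hy
  obtain ⟨z, rfl⟩ := mem_scaledLattice.1 hy
  rw [← hC]
  exact AddSubgroup.nsmul_index_mem _ _

/-- There are finitely many sublattices of given index. -/
lemma finite_setOf_index_eq {n : ℕ} (hn : n ≠ 0) :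
    {C : AddSubgroup (Fin 4 → ℤ) | C.index = n}.Finite := by
  have : NeZero n := ⟨hn⟩
  let f : (Fin 4 → ℤ) →+ (Fin 4 → ZMod n) := (Int.castAddHom (ZMod n)).compLeft (Fin 4)
  refine (Set.finite_range (AddSubgroup.comap f)).subset fun C hC => ⟨C.map f, ?_⟩
  rw [AddSubgroup.comap_map_eq, sup_eq_left]
  refine le_trans (fun y hy => ?_) (scaledLattice_index_le hC)
  rw [AddMonoidHom.mem_ker, funext_iff] at hy
  simp only [f, AddMonoidHom.compLeft_apply, Function.comp, Int.coe_castAddHom, Pi.zero_apply,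
    ZMod.intCast_zmod_eq_zero_iff_dvd] at hy
  choose z hz using hy
  exact mem_scaledLattice.2 ⟨z, funext fun i => by simp [hz i]⟩

lemma finite_cslsOfIndex_range {E : Type*} [NormedAddCommGroup E] [InnerProductSpace ℝ E]
    (b : Basis (Fin 4) ℝ E) (n : ℕ) : (cslsOfIndex (latticeHom b).range n).Finite := by
  rcases eq_or_ne n 0 with rfl | hn
  · rw [cslsOfIndex_zero]; exact Set.finite_empty
  · refine ((finite_setOf_index_eq hn).image (AddSubgroup.map (latticeHom b))).subset ?_
    rintro _ ⟨R, -, h, rfl⟩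
    rw [coincidenceIndex_range] at h
    exact ⟨_, h, AddSubgroup.map_comap_eq _ _⟩

lemma IsCoincident.mono {C D : AddSubgroup (Fin 4 → ℤ)} (hC : IsCoincident C) (h : C ≤ D) :
    IsCoincident D := fun x k hk hx => hC x k hk fun y hy => hx y (h hy)

lemma intCast_dvd_of_prime_pow {k : ℕ} {q : ℤ}
    (h : ∀ p j : ℕ, p.Prime → p ^ j ∣ k → ((p ^ j : ℕ) : ℤ) ∣ q) : (k : ℤ) ∣ q := by
  rw [Int.natCast_dvd]
  refine (Nat.dvd_iff_prime_pow_dvd_dvd _ _).2 fun p j hp hj => ?_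
  exact Int.natCast_dvd.1 (h p j hp hj)

/-- It suffices to test coincidence for prime powers. -/
lemma isCoincident_iff_prime_pow {C : AddSubgroup (Fin 4 → ℤ)} :
    IsCoincident C ↔ ∀ (p j : ℕ), p.Prime → ∀ x : Fin 4 → ℤ,
      (∀ y ∈ C, ((p ^ j : ℕ) : ℤ) ∣ rootB x y) → ((p ^ j : ℕ) : ℤ) ∣ rootQ x := by
  refine ⟨fun h p j hp x hx => h x _ (pow_pos hp.pos j) hx, fun h x k hk hx => ?_⟩
  refine intCast_dvd_of_prime_pow fun p j hp hj => h p j hp x fun y hy => ?_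
  exact (Int.natCast_dvd_natCast.2 hj).trans (hx y hy)

/-- Multiplication by `m` is invertible modulo `q`, so congruences modulo `q` on `C` carry over to
any `D` with `mD ⊆ C`. -/
lemma dvd_rootB_of_coprime {m : ℕ} {D : AddSubgroup (Fin 4 → ℤ)} {q : ℕ}
    (hco : q.Coprime m) {x : Fin 4 → ℤ} {C : AddSubgroup (Fin 4 → ℤ)}
    (hD : ∀ y ∈ D, m • y ∈ C) (hx : ∀ y ∈ C, (q : ℤ) ∣ rootB x y) :
    ∀ y ∈ D, (q : ℤ) ∣ rootB x y := by
  intro y hy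
  have := hx _ (hD y hy)
  rw [← Nat.cast_smul_eq_nsmul ℤ, rootB_smul_right] at this
  exact (Nat.isCoprime_iff_coprime.2 hco).dvd_of_dvd_mul_left this

/-- Coincidence is tested prime by prime. At a prime dividing `n` the intersection is
indistinguishable from `D`, at every other prime from `C`. -/
lemma IsCoincident.inf {m n : ℕ} (hmn : m.Coprime n) {C D : AddSubgroup (Fin 4 → ℤ)}
    (hC : IsCoincident C) (hD : IsCoincident D) (hm : C.index = m) (hn : D.index = n) :
    IsCoincident (C ⊓ D) := by
  rw [isCoincident_iff_prime_pow]
  intro p j hp x hx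
  by_cases hpn : p ∣ n
  · have hpm : ¬ p ∣ m := fun h => hp.one_lt.ne' (Nat.eq_one_of_dvd_coprimes hmn h hpn)
    refine hD x _ (pow_pos hp.pos j) (dvd_rootB_of_coprime (m := m) ?_ ?_ hx)
    · exact Nat.Coprime.pow_left _ (hp.coprime_iff_not_dvd.2 hpm)
    · intro y hy
      exact ⟨scaledLattice_index_le hm (mem_scaledLattice.2 ⟨y, rfl⟩), nsmul_mem hy m⟩
  · refine hC x _ (pow_pos hp.pos j) (dvd_rootB_of_coprime (m := n) ?_ ?_ hx)
    · exact Nat.Coprime.pow_left _ (hp.coprime_iff_not_dvd.2 hpn)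
    · intro y hy
      exact ⟨nsmul_mem hy n, scaledLattice_index_le hn (mem_scaledLattice.2 ⟨y, rfl⟩)⟩

lemma exists_nsmul_add_nsmul_eq {m n : ℕ} (hmn : m.Coprime n) (y : Fin 4 → ℤ) :
    ∃ u v : ℤ, y = m • (u • y) + n • (v • y) := by
  obtain ⟨u, v, huv⟩ := Nat.isCoprime_iff_coprime.2 hmn
  refine ⟨u, v, ?_⟩
  rw [← Nat.cast_smul_eq_nsmul ℤ, ← Nat.cast_smul_eq_nsmul ℤ, smul_smul, smul_smul, ← add_smul,
    mul_comm (m : ℤ), mul_comm (n : ℤ), huv, one_smul]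

lemma nsmul_mem_scaledLattice (n : ℕ) (y : Fin 4 → ℤ) : n • y ∈ scaledLattice n :=
  mem_scaledLattice.2 ⟨y, rfl⟩

/-- This recovers each factor from the intersection, so the factorisation into coprime indices is
unique. -/
lemma inf_sup_scaledLattice {m n : ℕ} (hmn : m.Coprime n) {C D : AddSubgroup (Fin 4 → ℤ)}
    (hm : C.index = m) (hn : D.index = n) : (C ⊓ D) ⊔ scaledLattice m = C := by
  refine le_antisymm (sup_le inf_le_left (scaledLattice_index_le hm)) fun y hy => ?_
  obtain ⟨u, v, h⟩ := exists_nsmul_add_nsmul_eq hmn y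
  rw [h]
  refine add_mem (AddSubgroup.mem_sup_right (nsmul_mem_scaledLattice _ _))
    (AddSubgroup.mem_sup_left ⟨nsmul_mem (zsmul_mem hy v) n, ?_⟩)
  exact scaledLattice_index_le hn (nsmul_mem_scaledLattice _ _)

lemma index_inf_of_coprime {C D : AddSubgroup (Fin 4 → ℤ)} (h : C.index.Coprime D.index)
    (hC : C.index ≠ 0) (hD : D.index ≠ 0) : (C ⊓ D).index = C.index * D.index := by
  refine Nat.dvd_antisymm ?_ (h.mul_dvd_of_dvd_of_dvd (AddSubgroup.index_dvd_of_le inf_le_left)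
    (AddSubgroup.index_dvd_of_le inf_le_right))
  have h1 : C.index ∣ (C ⊓ D).index := AddSubgroup.index_dvd_of_le inf_le_left
  have h2 : (C ⊓ D).index ≤ C.index * D.index := AddSubgroup.index_inf_le
  have h3 : (C ⊓ D).index ≠ 0 := AddSubgroup.index_inf_ne_zero hC hD
  have h4 := h.mul_dvd_of_dvd_of_dvd h1 (AddSubgroup.index_dvd_of_le inf_le_right)
  rw [le_antisymm h2 (Nat.le_of_dvd (Nat.pos_of_ne_zero h3) h4)]

theorem ncard_coincidentOfIndex_mul {m n : ℕ} (hm : m ≠ 0) (hn : n ≠ 0) (hmn : m.Coprime n) :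
    (coincidentOfIndex (m * n)).ncard =
      (coincidentOfIndex m).ncard * (coincidentOfIndex n).ncard := by
  have himage : coincidentOfIndex (m * n) =
      (fun p : AddSubgroup (Fin 4 → ℤ) × AddSubgroup (Fin 4 → ℤ) => p.1 ⊓ p.2) ''
        (coincidentOfIndex m ×ˢ coincidentOfIndex n) := by
    ext C
    constructor
    · rintro ⟨hC, hgood⟩
      have hmnC := scaledLattice_index_le hC
      have key : ∀ k l : ℕ, k * l = m * n → ∀ y ∈ C ⊔ scaledLattice k, l • y ∈ C := by
        intro k l hkl y hy
        obtain ⟨c, hc, z, hz, rfl⟩ := AddSubgroup.mem_sup.1 hy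
        obtain ⟨w, rfl⟩ := mem_scaledLattice.1 hz
        rw [smul_add, smul_smul, mul_comm l, hkl]
        exact add_mem (nsmul_mem hc l) (hmnC (nsmul_mem_scaledLattice _ _))
      -- Bézout's identity: `m` carries the second summand into `C` and `n` carries the first.
      have hinf : (C ⊔ scaledLattice m) ⊓ (C ⊔ scaledLattice n) = C := by
        refine le_antisymm (fun y hy => ?_) (le_inf le_sup_left le_sup_left)
        obtain ⟨u, v, h⟩ := exists_nsmul_add_nsmul_eq hmn y
        rw [h]
        obtain ⟨h1, h2⟩ := AddSubgroup.mem_inf.1 hy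
        exact add_mem (key n m (mul_comm _ _) _ (zsmul_mem h2 u)) (key m n rfl _ (zsmul_mem h1 v))
      -- The crude bound `k ^ 4` suffices: it makes the two indices coprime to the opposite factor,
      -- and their product `m * n` then determines both.
      have hi : ∀ k : ℕ, k ≠ 0 → (C ⊔ scaledLattice k).index ∣ k ^ 4 := fun k hk => by
        rw [← index_scaledLattice k hk]
        exact AddSubgroup.index_dvd_of_le le_sup_right
      have hi1 := hi m hm
      have hi2 := hi n hn
      have hco : (C ⊔ scaledLattice m).index.Coprime (C ⊔ scaledLattice n).index :=
        Nat.Coprime.of_dvd hi1 hi2 (Nat.Coprime.pow 4 4 hmn)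
      have hprod := index_inf_of_coprime hco
        (fun h => by rw [h, zero_dvd_iff] at hi1; exact pow_ne_zero 4 hm hi1)
        (fun h => by rw [h, zero_dvd_iff] at hi2; exact pow_ne_zero 4 hn hi2)
      rw [hinf, hC] at hprod
      have d1 : (C ⊔ scaledLattice m).index ∣ m :=
        (Nat.Coprime.of_dvd_left hi1 (Nat.Coprime.pow_left 4 hmn)).dvd_of_dvd_mul_right
          (hprod ▸ dvd_mul_right _ _)
      have d2 : (C ⊔ scaledLattice n).index ∣ n :=
        (Nat.Coprime.of_dvd_left hi2 (Nat.Coprime.pow_left 4 hmn.symm)).dvd_of_dvd_mul_left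
          (hprod ▸ dvd_mul_left _ _)
      obtain ⟨s, hs⟩ := d1
      obtain ⟨t, ht⟩ := d2
      have hst : s * t = 1 := by
        have h0 : (C ⊔ scaledLattice m).index * (C ⊔ scaledLattice n).index ≠ 0 := by
          rw [← hprod]; positivity
        refine Nat.eq_of_mul_eq_mul_left (Nat.pos_of_ne_zero h0) ?_
        rw [mul_one, mul_mul_mul_comm, ← hs, ← ht, hprod]
      obtain rfl : s = 1 := Nat.eq_one_of_mul_eq_one_right hst
      obtain rfl : t = 1 := by simpa using hst
      refine ⟨(C ⊔ scaledLattice m, C ⊔ scaledLattice n), ⟨⟨?_, ?_⟩, ⟨?_, ?_⟩⟩, hinf⟩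
      · rw [mul_one] at hs; exact hs.symm
      · exact hgood.mono le_sup_left
      · rw [mul_one] at ht; exact ht.symm
      · exact hgood.mono le_sup_left
    · rintro ⟨⟨C, D⟩, ⟨⟨hC, hgC⟩, ⟨hD, hgD⟩⟩, rfl⟩
      refine ⟨?_, hgC.inf hmn hgD hC hD⟩
      change (C ⊓ D).index = _
      change C.index = m at hC
      change D.index = n at hD
      rw [index_inf_of_coprime (by rwa [hC, hD]) (by rwa [hC]) (by rwa [hD]), hC, hD]
  rw [himage, Set.InjOn.ncard_image, Set.ncard_prod]
  rintro ⟨C, D⟩ ⟨hC, hD⟩ ⟨C', D'⟩ ⟨hC', hD'⟩ h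
  change C ⊓ D = C' ⊓ D' at h
  have e1 := inf_sup_scaledLattice hmn hC.1 hD.1
  have e2 := inf_sup_scaledLattice hmn hC'.1 hD'.1
  have e3 := inf_sup_scaledLattice hmn.symm hD.1 hC.1
  have e4 := inf_sup_scaledLattice hmn.symm hD'.1 hC'.1
  rw [h] at e1
  rw [inf_comm, h, inf_comm] at e3
  exact Prod.ext (e1.symm.trans e2) (e3.symm.trans e4)

/-- Here `cartan x` is `k` times an integral functional `g`, hence `5 Q(x)` is `k ^ 2` times the
dual norm of `g`. -/
lemma isCoincident_top : IsCoincident ⊤ := by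
  intro x k hk hx
  have hi : ∀ i, (k : ℤ) ∣ cartan x i := by
    intro i
    have := hx (Pi.single i 1) trivial
    rwa [rootB, dotProduct_single_one] at this
  choose g hg using hi
  have hg' : cartan x = (k : ℤ) • g := funext hg
  refine dvd_of_norm_identity (m := 0) (g := 0) (d := weightQ g) ?_
  have : weightQ ((k : ℤ) • g) = k ^ 2 * weightQ g := by
    simp only [weightQ, Pi.smul_apply, smul_eq_mul]; ring
  rw [← this, ← hg', weightQ_cartan]
  ring

lemma coincidentOfIndex_one : coincidentOfIndex 1 = {⊤} := by
  ext C
  simp only [coincidentOfIndex, Set.mem_ofPred_eq, AddSubgroup.index_eq_one, Set.mem_singleton_iff]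
  exact ⟨fun h => h.1, fun h => ⟨h, h ▸ isCoincident_top⟩⟩

end Multiplicative

/-! ## The quadratic form over the `p`-adic integers -/

lemma ZMod.two_sub_one_eq_zero : ∀ y : ZMod 2, y ≠ 0 → y - 1 = 0 := by decide

/-- The finite checks behind the prime two: the middle coefficient is odd, the discriminant identity
divided by four then makes the outer coefficients odd, and `c ^ 2 + c d + d ^ 2` is anisotropic
modulo two. -/
lemma ZMod.two_ne_zero_of_discrim :
    ∀ u b a c : ZMod 2, u ≠ 0 → b ^ 2 - 4 * a * c = 5 * u ^ 2 → b ≠ 0 := by decide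

lemma ZMod.two_eq_one_of_reduced_discrim :
    ∀ k b a c : ZMod 2, b ^ 2 + b - a * c = 5 * (k ^ 2 + k) + 1 → a = 1 ∧ c = 1 := by decide

lemma ZMod.two_anisotropic :
    ∀ b c d : ZMod 2, 1 * c ^ 2 + (2 * b + 1) * c * d + 1 * d ^ 2 = 0 → c = 0 ∧ d = 0 := by decide

section Padic

variable {p : ℕ} [hp : Fact p.Prime]

lemma PadicInt.isUnit_iff_not_dvd {x : ℤ_[p]} : IsUnit x ↔ ¬ (p : ℤ_[p]) ∣ x := by
  rw [← PadicInt.norm_lt_one_iff_dvd, ← PadicInt.not_isUnit_iff, not_not]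

lemma PadicInt.natCast_dvd_intCast {m : ℤ} : (p : ℤ_[p]) ∣ (m : ℤ_[p]) ↔ (p : ℤ) ∣ m := by
  simpa using PadicInt.pow_p_dvd_int_iff (p := p) 1 m

/-- A solution modulo `p` of a quadratic equation with unit derivative lifts. -/
lemma PadicInt.exists_quadratic_root {A B C : ℤ_[p]} (hC : (p : ℤ_[p]) ∣ C) (hB : IsUnit B) :
    ∃ t : ℤ_[p], A * t ^ 2 + B * t + C = 0 ∧ IsUnit (2 * A * t + B) := by
  let F : Polynomial ℤ_[p] := .C A * .X ^ 2 + .C B * .X + .C C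
  have hF : ∀ t, F.aeval t = A * t ^ 2 + B * t + C := by intro t; simp [F]
  have hF' : ∀ t, F.derivative.aeval t = 2 * A * t + B := by
    intro t; simp [F, Polynomial.derivative_pow]; ring
  have hB1 : ‖B‖ = 1 := PadicInt.isUnit_iff.1 hB
  obtain ⟨z, hz, -, hz', -⟩ := hensels_lemma (F := F) (a := (0 : ℤ_[p])) (by
    rw [hF, hF']
    simpa [hB1] using (PadicInt.norm_lt_one_iff_dvd C).2 hC)
  rw [hF] at hz
  rw [hF', hF'] at hz'
  exact ⟨z, hz, PadicInt.isUnit_iff.2 (by simpa [hB1] using hz')⟩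

lemma rootB_single_right {R : Type*} [CommRing R] (x : Fin 4 → R) (i : Fin 4) :
    rootB x (Pi.single i 1) = cartan x i := by
  rw [rootB, dotProduct_single_one]

/-- The quadratic form represents zero modulo `p` at a point with nonzero gradient. -/
lemma exists_isotropic_mod (p : ℕ) [hp : Fact p.Prime] :
    ∃ (x : Fin 4 → ℤ) (i : Fin 4), (p : ℤ) ∣ rootQ x ∧ ¬ (p : ℤ) ∣ cartan x i := by
  rcases hp.out.eq_two_or_odd' with rfl | hodd
  · exact ⟨![1, 0, 1, 0], 3, by decide, by decide⟩
  · obtain ⟨a, c, hac⟩ := ZMod.sq_add_sq p (-2)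
    obtain ⟨a, rfl⟩ := ZMod.intCast_surjective a
    obtain ⟨c, rfl⟩ := ZMod.intCast_surjective c
    have h1 : (p : ℤ) ∣ a ^ 2 + c ^ 2 + 2 := by
      rw [← ZMod.intCast_zmod_eq_zero_iff_dvd]
      push_cast
      rw [hac]; ring
    have h2 : ¬ (p : ℤ) ∣ 2 := by
      intro h
      have h' : p ∣ 2 := by exact_mod_cast h
      have := (Nat.prime_dvd_prime_iff_eq hp.out Nat.prime_two).1 h'
      subst this
      exact absurd hodd (by decide)
    have hpp : Prime (p : ℤ) := Nat.prime_iff_prime_int.1 hp.out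
    -- On this vector the form equals `a ^ 2 + c ^ 2 + 2`. Its gradient has the entries `2 c` and
    -- `-(c + 1)`, which cannot both vanish modulo an odd `p`.
    have hQ : (p : ℤ) ∣ rootQ ![a + 1, 2, c + 1, 0] := by
      convert h1 using 1
      simp [rootQ]; ring
    by_cases hc : (p : ℤ) ∣ c
    · refine ⟨![a + 1, 2, c + 1, 0], 3, hQ, fun h => ?_⟩
      simp only [cartan, Matrix.cons_val] at h
      have : (p : ℤ) ∣ 1 := by
        have := dvd_add h hc
        rw [← dvd_neg]
        convert this using 1; ring
      exact hpp.not_isUnit (isUnit_of_dvd_one this)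
    · refine ⟨![a + 1, 2, c + 1, 0], 2, hQ, fun h => ?_⟩
      simp only [cartan, Matrix.cons_val] at h
      have h' : (p : ℤ) ∣ 2 * c := by convert h using 1; ring
      exact (hpp.dvd_mul.1 h').elim h2 hc

/-- A hyperbolic pair. -/
lemma exists_hyperbolic_pair (p : ℕ) [hp : Fact p.Prime] :
    ∃ e f : Fin 4 → ℤ_[p], rootQ e = 0 ∧ rootQ f = 0 ∧ rootB e f = 1 := by
  obtain ⟨x, i, hx, hi⟩ := exists_isotropic_mod p
  let e₀ : Fin 4 → ℤ_[p] := fun j => Int.castRingHom ℤ_[p] (x j)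
  let f₀ : Fin 4 → ℤ_[p] := Pi.single i 1
  have hQ : (p : ℤ_[p]) ∣ rootQ e₀ := by
    rw [map_rootQ]; exact PadicInt.natCast_dvd_intCast.2 hx
  have hB : IsUnit (rootB e₀ f₀) := by
    have : rootB e₀ f₀ = ((cartan x i : ℤ) : ℤ_[p]) := by
      rw [rootB_single_right]
      fin_cases i <;> simp [cartan, e₀]
    rw [this, PadicInt.isUnit_iff_not_dvd, PadicInt.natCast_dvd_intCast]
    exact hi
  -- Hensel's lemma along the line `e₀ + t f₀`, on which the form is quadratic in `t` with unit
  -- linear term.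
  obtain ⟨t, ht, hu⟩ := PadicInt.exists_quadratic_root (A := rootQ f₀) hQ hB
  have he : rootQ (e₀ + t • f₀) = 0 := by
    rw [rootQ_add, rootQ_smul, rootB_smul_right]; linear_combination ht
  have hb : rootB (e₀ + t • f₀) f₀ = 2 * rootQ f₀ * t + rootB e₀ f₀ := by
    rw [rootB_add_left, rootB_smul_left, rootB_self]; ring
  rw [← hb] at hu
  obtain ⟨w, hw⟩ := hu.exists_left_inv
  generalize e₀ + t • f₀ = e at *
  have h1 : rootB e (w • f₀) = 1 := by rw [rootB_smul_right, hw]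
  generalize w • f₀ = f at *
  -- Subtracting `Q(f) e` makes `f` isotropic and keeps its product with `e`.
  refine ⟨e, f + (-rootQ f) • e, he, ?_, ?_⟩
  · rw [rootQ_add, rootQ_smul, rootB_smul_right, rootB_comm, he, h1]; ring
  · rw [rootB_add_right, rootB_smul_right, rootB_self, he, h1]; ring

/-- A hyperbolic plane splits off. -/
lemma exists_hyperbolic_splitting (p : ℕ) [hp : Fact p.Prime] :
    ∃ (P : (Fin 4 → ℤ_[p]) ≃ₗ[ℤ_[p]] (Fin 4 → ℤ_[p])) (α β γ : ℤ_[p]),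
      ∀ v, rootQ (P v) = v 0 * v 1 + (α * v 2 ^ 2 + β * v 2 * v 3 + γ * v 3 ^ 2) := by
  obtain ⟨e, f, he, hf, hef⟩ := exists_hyperbolic_pair p
  let Bl : (Fin 4 → ℤ_[p]) → (Fin 4 → ℤ_[p]) →ₗ[ℤ_[p]] ℤ_[p] := fun x =>
    { toFun := rootB x
      map_add' := rootB_add_right x
      map_smul' := fun m y => rootB_smul_right m x y }
  have hBl : ∀ x y, Bl x y = rootB x y := fun _ _ => rfl
  let K : Submodule ℤ_[p] (Fin 4 → ℤ_[p]) := LinearMap.ker (Bl e) ⊓ LinearMap.ker (Bl f)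
  let Φ : ((ℤ_[p] × ℤ_[p]) × K) →ₗ[ℤ_[p]] (Fin 4 → ℤ_[p]) :=
    LinearMap.coprod (LinearMap.coprod (LinearMap.toSpanSingleton _ _ e)
      (LinearMap.toSpanSingleton _ _ f)) K.subtype
  have hΦ : ∀ a b k, Φ ((a, b), k) = a • e + b • f + k := fun _ _ _ => rfl
  have hK : ∀ k : K, rootB e k = 0 ∧ rootB f k = 0 := fun k => k.2
  have hee : rootB e e = 0 := by rw [rootB_self, he, mul_zero]
  have hff : rootB f f = 0 := by rw [rootB_self, hf, mul_zero]
  have hfe : rootB f e = 1 := by rw [rootB_comm, hef]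
  have hinj : Function.Injective Φ := by
    rw [← LinearMap.ker_eq_bot, LinearMap.ker_eq_bot']
    rintro ⟨⟨a, b⟩, k⟩ h
    rw [hΦ] at h
    have h1 := congrArg (rootB e) h
    have h2 := congrArg (rootB f) h
    simp only [rootB_add_right, rootB_smul_right, hee, hef, hff, hfe, (hK k).1, (hK k).2,
      rootB_zero_right] at h1 h2
    have hb : b = 0 := by linear_combination h1
    have ha : a = 0 := by linear_combination h2
    subst ha hb
    have : (k : Fin 4 → ℤ_[p]) = 0 := by simpa using h
    rw [Subtype.ext (a2 := (0 : K)) this]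
    rfl
  have hsurj : Function.Surjective Φ := by
    intro x
    refine ⟨((rootB f x, rootB e x), ⟨x - (rootB f x • e + rootB e x • f), ?_, ?_⟩), ?_⟩
    · change rootB e _ = 0
      simp only [rootB_sub_right, rootB_add_right, rootB_smul_right, hee, hef]; ring
    · change rootB f _ = 0
      simp only [rootB_sub_right, rootB_add_right, rootB_smul_right, hff, hfe]; ring
    · rw [hΦ]; simp
  let Ψ := LinearEquiv.ofBijective Φ ⟨hinj, hsurj⟩
  have hrank : Module.finrank ℤ_[p] K = 2 := by
    have := Ψ.finrank_eq
    rw [Module.finrank_prod, Module.finrank_prod, Module.finrank_self, Module.finrank_fin_fun]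
      at this
    omega
  let κ : Basis (Fin 2) ℤ_[p] K := Module.finBasisOfFinrankEq ℤ_[p] K hrank
  let Θ : (Fin 4 → ℤ_[p]) ≃ₗ[ℤ_[p]] ((ℤ_[p] × ℤ_[p]) × K) :=
    { toFun := fun v => ((v 0, v 1), v 2 • κ 0 + v 3 • κ 1)
      map_add' := fun v w => by
        refine Prod.ext rfl ?_
        simp only [Pi.add_apply, add_smul, Prod.mk_add_mk]
        abel
      map_smul' := fun m v => by
        refine Prod.ext rfl ?_
        simp [mul_smul]
      invFun := fun w => ![w.1.1, w.1.2, κ.repr w.2 0, κ.repr w.2 1]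
      left_inv := fun v => by
        ext i
        fin_cases i <;> simp
      right_inv := fun w => by
        refine Prod.ext rfl ?_
        have := κ.sum_repr w.2
        rw [Fin.sum_univ_two] at this
        simpa using this }
  refine ⟨Θ.trans Ψ, rootQ (κ 0 : Fin 4 → ℤ_[p]), rootB (κ 0 : Fin 4 → ℤ_[p]) (κ 1),
    rootQ (κ 1 : Fin 4 → ℤ_[p]), fun v => ?_⟩
  change rootQ (Φ ((v 0, v 1), v 2 • κ 0 + v 3 • κ 1)) = _
  rw [hΦ]
  simp only [rootQ_add, rootQ_smul, rootB_smul_left, rootB_smul_right, he, hf, hef,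
    rootB_add_left, rootB_add_right, (hK _).1, (hK _).2, Submodule.coe_add, Submodule.coe_smul]
  ring

lemma rootB_eq_of_rootQ {R : Type*} [CommRing R] (x y : Fin 4 → R) :
    rootB x y = rootQ (x + y) - rootQ x - rootQ y := by rw [rootQ_add]; ring

/-- The polar form in the coordinates of a splitting. -/
lemma rootB_splitting {P : (Fin 4 → ℤ_[p]) ≃ₗ[ℤ_[p]] (Fin 4 → ℤ_[p])} {α β γ : ℤ_[p]}
    (hP : ∀ v, rootQ (P v) = v 0 * v 1 + (α * v 2 ^ 2 + β * v 2 * v 3 + γ * v 3 ^ 2))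
    (v w : Fin 4 → ℤ_[p]) :
    rootB (P v) (P w) = v 0 * w 1 + v 1 * w 0 + (2 * α * v 2 + β * v 3) * w 2
      + (β * v 2 + 2 * γ * v 3) * w 3 := by
  rw [rootB_eq_of_rootQ, ← map_add, hP, hP, hP]
  simp only [Pi.add_apply]
  ring

/-- The discriminant of the complement of a hyperbolic plane. -/
lemma discrim_splitting {P : (Fin 4 → ℤ_[p]) ≃ₗ[ℤ_[p]] (Fin 4 → ℤ_[p])} {α β γ : ℤ_[p]}
    (hP : ∀ v, rootQ (P v) = v 0 * v 1 + (α * v 2 ^ 2 + β * v 2 * v 3 + γ * v 3 ^ 2)) :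
    ∃ u, IsUnit u ∧ β ^ 2 - 4 * α * γ = 5 * u ^ 2 := by
  let M := LinearMap.toMatrix' (P : (Fin 4 → ℤ_[p]) →ₗ[ℤ_[p]] (Fin 4 → ℤ_[p]))
  have hdet : IsUnit M.det := by
    rw [LinearMap.det_toMatrix']; exact P.isUnit_det'
  refine ⟨M.det, hdet, ?_⟩
  let A : Matrix (Fin 4) (Fin 4) ℤ_[p] := cartanMatrix.map (Int.castRingHom ℤ_[p])
  have hA : A.det = 5 := by
    rw [show A.det = Int.castRingHom ℤ_[p] cartanMatrix.det from (RingHom.map_det _ _).symm,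
      det_cartanMatrix]
    simp
  have hBA : ∀ x y : Fin 4 → ℤ_[p], rootB x y = x ⬝ᵥ (A.mulVec y) := by
    intro x y
    simp only [A, rootB_apply, cartanMatrix, symmGram, Matrix.mulVec, dotProduct_four,
      Matrix.of_apply, Matrix.cons_val, Matrix.map_apply, eq_intCast]
    push_cast
    ring
  have hG : M.transpose * A * M = !![0, 1, 0, 0; 1, 0, 0, 0; 0, 0, 2 * α, β; 0, 0, β, 2 * γ] := by
    ext i j
    have h1 : (M.transpose * A * M) i j = rootB (P (Pi.single i 1)) (P (Pi.single j 1)) := by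
      have hMv : ∀ v, P v = M.mulVec v := fun v => by
        simp only [M, LinearMap.toMatrix'_mulVec]; rfl
      rw [hBA, hMv, hMv, ← Matrix.vecMul_transpose, ← Matrix.dotProduct_mulVec,
        Matrix.mulVec_mulVec, Matrix.mulVec_mulVec]
      simp [Matrix.mul_assoc]
    rw [h1, rootB_splitting hP]
    fin_cases i <;> fin_cases j <;> simp
  have := congrArg Matrix.det hG
  rw [Matrix.det_mul, Matrix.det_mul, Matrix.det_transpose, hA] at this
  have h2 : (!![0, 1, 0, 0; 1, 0, 0, 0; 0, 0, 2 * α, β; 0, 0, β, 2 * γ] :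
      Matrix (Fin 4) (Fin 4) ℤ_[p]).det = β ^ 2 - 4 * α * γ := by
    simp [Matrix.det_succ_row_zero, Fin.sum_univ_succ, Fin.succAbove]
    ring
  rw [h2] at this
  linear_combination -this

/-- A linear change of the last two coordinates. -/
lemma exists_plane_equiv {a b c d : ℤ_[p]} (h : IsUnit (a * d - b * c)) :
    ∃ T : (Fin 4 → ℤ_[p]) ≃ₗ[ℤ_[p]] (Fin 4 → ℤ_[p]),
      ∀ v, T v = ![v 0, v 1, a * v 2 + b * v 3, c * v 2 + d * v 3] := by
  obtain ⟨w, hw⟩ := h.exists_left_inv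
  refine ⟨{ toFun := fun v => ![v 0, v 1, a * v 2 + b * v 3, c * v 2 + d * v 3]
            map_add' := fun v v' => ?_
            map_smul' := fun m v => ?_
            invFun := fun v => ![v 0, v 1, w * (d * v 2 - b * v 3), w * (a * v 3 - c * v 2)]
            left_inv := fun v => ?_
            right_inv := fun v => ?_ }, fun v => rfl⟩
  · ext i; fin_cases i <;> simp <;> ring
  · ext i; fin_cases i <;> simp <;> ring
  · ext i
    fin_cases i
    · simp
    · simp
    · simp only [Fin.reduceFinMk, Matrix.cons_val]; linear_combination v 2 * hw
    · simp only [Fin.reduceFinMk, Matrix.cons_val]; linear_combination v 3 * hw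
  · ext i
    fin_cases i
    · simp
    · simp
    · simp only [Fin.reduceFinMk, Matrix.cons_val]; linear_combination v 2 * hw
    · simp only [Fin.reduceFinMk, Matrix.cons_val]; linear_combination v 3 * hw

lemma PadicInt.toZMod_eq_zero_iff {x : ℤ_[p]} : PadicInt.toZMod x = 0 ↔ (p : ℤ_[p]) ∣ x := by
  rw [← RingHom.mem_ker, PadicInt.ker_toZMod, PadicInt.maximalIdeal_eq_span_p,
    Ideal.mem_span_singleton]

lemma PadicInt.isUnit_natCast {n : ℕ} (h : ¬ p ∣ n) : IsUnit (n : ℤ_[p]) := by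
  rw [PadicInt.isUnit_iff_not_dvd]
  intro h'
  have : (p : ℤ) ∣ (n : ℤ) := PadicInt.natCast_dvd_intCast.1 (by exact_mod_cast h')
  exact h (by exact_mod_cast this)

lemma isSquare_five_iff (h2 : p ≠ 2) : IsSquare (5 : ZMod p) ↔ IsSquare (p : ZMod 5) := by
  have : Fact (Nat.Prime 5) := ⟨by norm_num⟩
  exact_mod_cast (ZMod.exists_sq_eq_prime_iff_of_mod_four_eq_one (p := 5) (q := p) (by norm_num)
    h2).symm

lemma isSquare_natCast_five_of_pm_one {n : ℕ} (h : n ≡ 1 [MOD 5] ∨ n ≡ 4 [MOD 5]) :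
    IsSquare (n : ZMod 5) := by
  rcases h with h | h
  · rw [(ZMod.natCast_eq_natCast_iff _ _ _).2 h]; exact ⟨1, by decide⟩
  · rw [(ZMod.natCast_eq_natCast_iff _ _ _).2 h]; exact ⟨2, by decide⟩

lemma not_isSquare_natCast_five_of_pm_two {n : ℕ} (h : n ≡ 2 [MOD 5] ∨ n ≡ 3 [MOD 5]) :
    ¬ IsSquare (n : ZMod 5) := by
  rcases h with h | h
  · rw [(ZMod.natCast_eq_natCast_iff _ _ _).2 h]; decide
  · rw [(ZMod.natCast_eq_natCast_iff _ _ _).2 h]; decide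

/-- The form is the determinant of a matrix for the primes `p ≡ ±1 (mod 5)`. -/
lemma exists_det_splitting (h : p ≡ 1 [MOD 5] ∨ p ≡ 4 [MOD 5]) :
    ∃ P : (Fin 4 → ℤ_[p]) ≃ₗ[ℤ_[p]] (Fin 4 → ℤ_[p]),
      ∀ v, rootQ (P v) = v 0 * v 1 - v 2 * v 3 := by
  have hp2 : p ≠ 2 := by rintro rfl; revert h; decide
  have hp5 : p ≠ 5 := by rintro rfl; revert h; decide
  have hu2 : IsUnit (2 : ℤ_[p]) := by
    exact_mod_cast PadicInt.isUnit_natCast (p := p) (n := 2)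
      (fun h' => hp2 ((Nat.prime_dvd_prime_iff_eq hp.out Nat.prime_two).1 h'))
  have hu5 : IsUnit (5 : ℤ_[p]) := by
    exact_mod_cast PadicInt.isUnit_natCast (p := p) (n := 5)
      (fun h' => hp5 ((Nat.prime_dvd_prime_iff_eq hp.out Nat.prime_five).1 h'))
  obtain ⟨s, hs⟩ : ∃ s : ℤ_[p], s ^ 2 = 5 := by
    obtain ⟨t, ht⟩ := (isSquare_five_iff hp2).2 (isSquare_natCast_five_of_pm_one h)
    obtain ⟨t, rfl⟩ := ZMod.ringHom_surjective (PadicInt.toZMod (p := p)) t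
    have h1 : (p : ℤ_[p]) ∣ t ^ 2 - 5 := by
      rw [← PadicInt.toZMod_eq_zero_iff, map_sub, map_pow, map_ofNat, ht]; ring
    have h2 : IsUnit (2 * t) := by
      refine hu2.mul ?_
      rw [PadicInt.isUnit_iff_not_dvd] at hu5 ⊢
      intro h3
      exact hu5 ((dvd_sub_right (h3.trans (dvd_pow_self t two_ne_zero))).1 h1)
    obtain ⟨z, hz, -⟩ := PadicInt.exists_quadratic_root (A := 1) h1 h2
    exact ⟨t + z, by linear_combination hz⟩
  obtain ⟨P, α, β, γ, hP⟩ := exists_hyperbolic_splitting p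
  obtain ⟨u, hu, hd⟩ := discrim_splitting hP
  have hsu : IsUnit s := by
    rw [← isUnit_pow_iff two_ne_zero, hs]; exact hu5
  -- The two square roots of the discriminant differ by twice a unit, so for one of them `β - δ` is
  -- invertible.
  obtain ⟨δ, hδ, hδ2, hη⟩ : ∃ δ : ℤ_[p], IsUnit δ ∧ δ ^ 2 = β ^ 2 - 4 * α * γ ∧
      IsUnit (β - δ) := by
    by_cases h1 : IsUnit (β - s * u)
    · exact ⟨s * u, hsu.mul hu, by linear_combination u ^ 2 * hs - hd, h1⟩
    · refine ⟨-(s * u), (hsu.mul hu).neg, by linear_combination u ^ 2 * hs - hd, ?_⟩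
      have h2 : IsUnit (2 * (s * u)) := hu2.mul (hsu.mul hu)
      rw [PadicInt.isUnit_iff_not_dvd] at h1 h2 ⊢
      rw [not_not] at h1
      intro h3
      exact h2 (by convert dvd_sub h3 h1 using 1; ring)
  obtain ⟨w, hw⟩ := hη.exists_left_inv
  obtain ⟨k, hk⟩ := hu2.exists_left_inv
  have hE : 2 * α * -(γ * w) - (β - δ) * -k = -δ := by
    linear_combination (2 * α * γ * w - δ) * hk - k * w * hδ2 - k * (β + δ) * hw
  -- The binary form factors as `(2αc + (β-δ)d) (c/2 + γd/(β-δ))`, because `(β-δ)(β+δ) = 4αγ`.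
  -- Dividing by `β - δ` avoids any assumption on `α`.
  obtain ⟨T, hT⟩ := exists_plane_equiv (p := p) (a := 2 * α) (b := β - δ) (c := -k)
    (d := -(γ * w)) (hE ▸ hδ.neg)
  refine ⟨T.symm.trans P, fun v => ?_⟩
  obtain ⟨v, rfl⟩ := T.surjective v
  rw [LinearEquiv.trans_apply, LinearEquiv.symm_apply_apply, hP, hT]
  simp only [Matrix.cons_val]
  linear_combination (-α * v 2 ^ 2 - (β - δ) * v 2 * v 3) * hk + v 2 * v 3 * hE
    - γ * v 3 ^ 2 * hw

/-- A splitting whose second summand is anisotropic modulo `p`, up to a factor `p ^ ε` in the last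
coordinate. -/
structure IsAnisotropicSplitting (P : (Fin 4 → ℤ_[p]) ≃ₗ[ℤ_[p]] (Fin 4 → ℤ_[p]))
    (α β γ : ℤ_[p]) (ε : ℕ) : Prop where
  rootQ_eq : ∀ v, rootQ (P v) = v 0 * v 1 + (α * v 2 ^ 2 + β * v 2 * v 3 + γ * v 3 ^ 2)
  polar : ∀ (j : ℕ) (c d : ℤ_[p]), ((p : ℤ_[p]) ^ j ∣ 2 * α * c + β * d ∧
    (p : ℤ_[p]) ^ j ∣ β * c + 2 * γ * d) ↔ ((p : ℤ_[p]) ^ j ∣ c ∧ (p : ℤ_[p]) ^ j ∣ p ^ ε * d)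
  anisotropic : ∀ c d : ℤ_[p], (p : ℤ_[p]) ∣ α * c ^ 2 + β * c * d + γ * d ^ 2 →
    (p : ℤ_[p]) ∣ c ∧ (p : ℤ_[p]) ∣ p ^ ε * d

/-- A unit discriminant makes the polar form of the complement unimodular, so Cramer's rule recovers
both coordinates. -/
lemma isAnisotropicSplitting_of_isUnit {P : (Fin 4 → ℤ_[p]) ≃ₗ[ℤ_[p]] (Fin 4 → ℤ_[p])}
    {α β γ : ℤ_[p]}
    (hP : ∀ v, rootQ (P v) = v 0 * v 1 + (α * v 2 ^ 2 + β * v 2 * v 3 + γ * v 3 ^ 2))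
    (hu : IsUnit (β ^ 2 - 4 * α * γ))
    (han : ∀ c d : ℤ_[p], (p : ℤ_[p]) ∣ α * c ^ 2 + β * c * d + γ * d ^ 2 →
      (p : ℤ_[p]) ∣ c ∧ (p : ℤ_[p]) ∣ d) : IsAnisotropicSplitting P α β γ 0 := by
  refine ⟨hP, fun j c d => ⟨fun h => ?_, fun h => ?_⟩, by simpa using han⟩
  · constructor
    · rw [← hu.dvd_mul_left]
      convert dvd_sub (h.2.mul_left β) (h.1.mul_left (2 * γ)) using 1; ring
    · rw [pow_zero, one_mul, ← hu.dvd_mul_left]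
      convert dvd_sub (h.1.mul_left β) (h.2.mul_left (2 * α)) using 1; ring
  · rw [pow_zero, one_mul] at h
    exact ⟨dvd_add (h.1.mul_left _) (h.2.mul_left _), dvd_add (h.1.mul_left _) (h.2.mul_left _)⟩

/-- An anisotropic splitting for the primes `p ≡ ±2 (mod 5)`. -/
lemma exists_anisotropic_splitting_of_pm_two (h : p ≡ 2 [MOD 5] ∨ p ≡ 3 [MOD 5]) :
    ∃ P α β γ, IsAnisotropicSplitting (p := p) P α β γ 0 := by
  obtain ⟨P, α, β, γ, hP⟩ := exists_hyperbolic_splitting p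
  obtain ⟨u, hu, hd⟩ := discrim_splitting hP
  have hp5 : p ≠ 5 := by rintro rfl; revert h; decide
  have hu5 : IsUnit (5 : ℤ_[p]) := by
    exact_mod_cast PadicInt.isUnit_natCast (p := p) (n := 5)
      (fun h' => hp5 ((Nat.prime_dvd_prime_iff_eq hp.out Nat.prime_five).1 h'))
  refine ⟨P, α, β, γ, isAnisotropicSplitting_of_isUnit hP (hd ▸ hu5.mul (hu.pow 2)) ?_⟩
  by_cases hp2 : p = 2
  · subst hp2
    have key : ∀ {x : ℤ_[2]}, ((2 : ℕ) : ℤ_[2]) ∣ x ↔ PadicInt.toZMod x = 0 :=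
      PadicInt.toZMod_eq_zero_iff.symm
    have hodd : ∀ x : ℤ_[2], PadicInt.toZMod x ≠ 0 → ∃ k, x = 2 * k + 1 := by
      intro x hx
      have h1 : PadicInt.toZMod (x - 1) = 0 := by
        rw [map_sub, map_one]
        exact ZMod.two_sub_one_eq_zero _ hx
      obtain ⟨k, hk⟩ := key.2 h1
      exact ⟨k, by push_cast at hk; linear_combination hk⟩
    have hu' : PadicInt.toZMod u ≠ 0 := (hu.map PadicInt.toZMod).ne_zero
    have hβ : PadicInt.toZMod β ≠ 0 := by
      have := congrArg PadicInt.toZMod hd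
      simp only [map_sub, map_mul, map_pow, map_ofNat] at this
      exact ZMod.two_ne_zero_of_discrim
        _ _ _ _ hu' this
    obtain ⟨k, rfl⟩ := hodd u hu'
    obtain ⟨b, rfl⟩ := hodd β hβ
    -- Writing the odd numbers `β` and `u` as `2b + 1` and `2k + 1` allows the discriminant identity
    -- to be divided by four and then reduced modulo two.
    have h4 : b ^ 2 + b - α * γ = 5 * (k ^ 2 + k) + 1 := by
      have : (4 : ℤ_[2]) ≠ 0 := by norm_num
      refine mul_left_cancel₀ this ?_
      linear_combination hd
    have h5 : PadicInt.toZMod α = 1 ∧ PadicInt.toZMod γ = 1 := by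
      have := congrArg PadicInt.toZMod h4
      simp only [map_sub, map_mul, map_pow, map_ofNat, map_add, map_one] at this
      exact ZMod.two_eq_one_of_reduced_discrim _ _ _ _ this
    intro c d
    rw [key, key, key]
    simp only [map_mul, map_pow, map_ofNat, map_add, map_one, h5.1, h5.2]
    exact ZMod.two_anisotropic _ _ _
  · have hns : ¬ IsSquare (5 : ZMod p) := by
      rw [isSquare_five_iff hp2]; exact not_isSquare_natCast_five_of_pm_two h
    have key : ∀ x y : ℤ_[p], (p : ℤ_[p]) ∣ x ^ 2 - 5 * y ^ 2 → (p : ℤ_[p]) ∣ y := by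
      intro x y hxy
      rw [← PadicInt.toZMod_eq_zero_iff] at hxy ⊢
      by_contra hy
      refine hns ⟨PadicInt.toZMod x / PadicInt.toZMod y, ?_⟩
      simp only [map_sub, map_mul, map_pow, map_ofNat] at hxy
      field_simp
      linear_combination -hxy
    have hpp := PadicInt.prime_p (p := p)
    -- Otherwise `5 u ^ 2` would be the square `β ^ 2` modulo `p`.
    have hα : ¬ (p : ℤ_[p]) ∣ α := by
      intro hα
      refine (PadicInt.isUnit_iff_not_dvd.1 hu) (key β u ?_)
      rw [← hd]
      convert (hα.mul_left (4 * γ)) using 1; ring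
    intro c d hcd
    have hdd : (p : ℤ_[p]) ∣ d := by
      -- Completing the square: `4 α` times the form is `(2αc + βd)^2 - 5 (ud)^2`.
      have := key (2 * α * c + β * d) (u * d) (by
        convert hcd.mul_left (4 * α) using 1
        linear_combination d ^ 2 * hd)
      exact (hpp.dvd_mul.1 this).resolve_left (PadicInt.isUnit_iff_not_dvd.1 hu)
    refine ⟨?_, hdd⟩
    have : (p : ℤ_[p]) ∣ α * c ^ 2 := by
      have h6 : (p : ℤ_[p]) ∣ d * (β * c + γ * d) := hdd.mul_right _
      convert dvd_sub hcd h6 using 1; ring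
    exact hpp.dvd_of_dvd_pow ((hpp.dvd_mul.1 this).resolve_left hα)

/-- An anisotropic splitting for the ramified prime. -/
lemma exists_anisotropic_splitting_five [Fact (Nat.Prime 5)] :
    ∃ P α β γ, IsAnisotropicSplitting (p := 5) P α β γ 1 := by
  obtain ⟨P, α, β, γ, hP⟩ := exists_hyperbolic_splitting 5
  obtain ⟨u, hu, hd⟩ := discrim_splitting hP
  have hpp := PadicInt.prime_p (p := 5)
  push_cast at hpp
  have hdvd : ∀ {x : ℤ_[5]}, IsUnit x ↔ ¬ (5 : ℤ_[5]) ∣ x := fun {x} => by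
    simpa using PadicInt.isUnit_iff_not_dvd (p := 5) (x := x)
  have hu2 : IsUnit (2 : ℤ_[5]) := by
    exact_mod_cast PadicInt.isUnit_natCast (p := 5) (n := 2) (by decide)
  -- If `α` is not a unit, the two coordinates are exchanged. Were both outer coefficients divisible
  -- by five, `β` would be too, and the discriminant would be divisible by `25`.
  obtain ⟨P, α, β, γ, hP, hd, hα⟩ : ∃ (P : (Fin 4 → ℤ_[5]) ≃ₗ[ℤ_[5]] (Fin 4 → ℤ_[5]))
      (α β γ : ℤ_[5]), (∀ v, rootQ (P v) = v 0 * v 1 + (α * v 2 ^ 2 + β * v 2 * v 3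
        + γ * v 3 ^ 2)) ∧ β ^ 2 - 4 * α * γ = 5 * u ^ 2 ∧ IsUnit α := by
    by_cases hα : IsUnit α
    · exact ⟨P, α, β, γ, hP, hd, hα⟩
    · obtain ⟨T, hT⟩ := exists_plane_equiv (p := 5) (a := 0) (b := 1) (c := 1) (d := 0)
        (by simp)
      refine ⟨T.trans P, γ, β, α, fun v => ?_, by linear_combination hd, ?_⟩
      · simp only [LinearEquiv.trans_apply, hP, hT, Matrix.cons_val]; ring
      · rw [hdvd] at hα hu ⊢
        rw [not_not] at hα
        intro hγ
        obtain ⟨a, rfl⟩ := hα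
        obtain ⟨g, rfl⟩ := hγ
        have h1 : (5 : ℤ_[5]) ∣ β := hpp.dvd_of_dvd_pow (n := 2)
          ⟨u ^ 2 + 20 * a * g, by linear_combination hd⟩
        obtain ⟨b, rfl⟩ := h1
        refine hu (hpp.dvd_of_dvd_pow (n := 2) ⟨b ^ 2 - 4 * a * g, ?_⟩)
        refine mul_left_cancel₀ hpp.ne_zero ?_
        linear_combination -hd
  -- With `w = 1 / (2α)` the square is completed, and the new last coefficient is minus the
  -- discriminant over `4α`, a unit times five.
  obtain ⟨w, hw⟩ := (hu2.mul hα).exists_left_inv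
  obtain ⟨T, hT⟩ := exists_plane_equiv (p := 5) (a := 1) (b := w * β) (c := 0) (d := 1)
    (by simp)
  have hwu : IsUnit w := IsUnit.of_mul_eq_one _ hw
  have hα' := hdvd.1 hα
  have hg : IsUnit (2 * (-α * w ^ 2 * u ^ 2)) :=
    hu2.mul ((hα.neg.mul (hwu.pow 2)).mul (hu.pow 2))
  refine ⟨T.symm.trans P, α, 0, 5 * (-α * w ^ 2 * u ^ 2), fun v => ?_, fun j c d => ?_,
    fun c d h => ?_⟩
  · obtain ⟨v, rfl⟩ := T.surjective v
    rw [LinearEquiv.trans_apply, LinearEquiv.symm_apply_apply, hP, hT]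
    simp only [Matrix.cons_val]
    linear_combination (-β * v 2 * v 3 - γ * v 3 ^ 2 * (1 + 2 * α * w)) * hw
      - α * w ^ 2 * v 3 ^ 2 * hd
  · push_cast
    rw [show 2 * α * c + 0 * d = (2 * α) * c by ring,
      show 0 * c + 2 * (5 * (-α * w ^ 2 * u ^ 2)) * d = (2 * (-α * w ^ 2 * u ^ 2)) * (5 ^ 1 * d)
        by ring, (hu2.mul hα).dvd_mul_left, hg.dvd_mul_left]
  · push_cast at h ⊢
    refine ⟨?_, by simp⟩
    have : (5 : ℤ_[5]) ∣ α * c ^ 2 := by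
      have h6 : (5 : ℤ_[5]) ∣ 5 * ((-α * w ^ 2 * u ^ 2) * d ^ 2) := dvd_mul_right _ _
      convert dvd_sub h h6 using 1; ring
    exact hpp.dvd_of_dvd_pow ((hpp.dvd_mul.1 this).resolve_left hα')

end Padic

/-! ## Passage to the `p`-adic integers -/

section Local

variable {p : ℕ} [hp : Fact p.Prime]

/-- The embedding of the lattice in its `p`-adic completion, in the coordinates given by `P`. -/
noncomputable def toLocal (P : (Fin 4 → ℤ_[p]) ≃ₗ[ℤ_[p]] (Fin 4 → ℤ_[p])) :
    (Fin 4 → ℤ) →+ (Fin 4 → ℤ_[p]) :=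
  P.symm.toLinearMap.toAddMonoidHom.comp ((Int.castAddHom ℤ_[p]).compLeft (Fin 4))

/-- The sublattices of index `p ^ r` of the completion that satisfy the coincidence condition. -/
def localCoincident (P : (Fin 4 → ℤ_[p]) ≃ₗ[ℤ_[p]] (Fin 4 → ℤ_[p])) (r : ℕ) :
    Set (Submodule ℤ_[p] (Fin 4 → ℤ_[p])) :=
  {D | D.toAddSubgroup.index = p ^ r ∧ ∀ (x : Fin 4 → ℤ_[p]) (j : ℕ),
    (∀ y ∈ D, (p : ℤ_[p]) ^ j ∣ rootB (P x) (P y)) → (p : ℤ_[p]) ^ j ∣ rootQ (P x)}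

variable {P : (Fin 4 → ℤ_[p]) ≃ₗ[ℤ_[p]] (Fin 4 → ℤ_[p])}

lemma apply_toLocal (y : Fin 4 → ℤ) : P (toLocal P y) = fun i => (y i : ℤ_[p]) := by
  change P (P.symm _) = _
  rw [LinearEquiv.apply_symm_apply]
  rfl

lemma PadicInt.exists_nat_add (c : ℤ_[p]) (r : ℕ) :
    ∃ n : ℕ, n < p ^ r ∧ ∃ d : ℤ_[p], c = n + p ^ r * d := by
  obtain ⟨d, hd⟩ := Ideal.mem_span_singleton.1 (PadicInt.appr_spec r c)
  exact ⟨c.appr r, c.appr_lt r, d, by linear_combination hd⟩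

lemma exists_toLocal_add (P : (Fin 4 → ℤ_[p]) ≃ₗ[ℤ_[p]] (Fin 4 → ℤ_[p])) (v : Fin 4 → ℤ_[p])
    (r : ℕ) : ∃ y w, v = toLocal P y + (p : ℤ_[p]) ^ r • w := by
  choose n _ d hd using fun i => PadicInt.exists_nat_add (P v i) r
  refine ⟨fun i => n i, P.symm d, P.injective ?_⟩
  rw [map_add, apply_toLocal, map_smul, LinearEquiv.apply_symm_apply]
  ext i
  simp [hd i]

lemma exists_smul_of_toLocal {y : Fin 4 → ℤ} {r : ℕ} {w : Fin 4 → ℤ_[p]}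
    (h : toLocal P y = (p : ℤ_[p]) ^ r • w) : ∃ z, p ^ r • z = y := by
  have h1 := congrArg P h
  rw [apply_toLocal, map_smul] at h1
  have h2 : ∀ i, ((p ^ r : ℕ) : ℤ) ∣ y i := fun i => by
    have := congrFun h1 i
    rw [Pi.smul_apply, smul_eq_mul] at this
    exact_mod_cast (PadicInt.pow_p_dvd_int_iff r (y i)).1 ⟨_, this⟩
  choose z hz using h2
  exact ⟨z, funext fun i => by simp [hz i]⟩

lemma rootB_toLocal (x y : Fin 4 → ℤ) :
    rootB (P (toLocal P x)) (P (toLocal P y)) = ((rootB x y : ℤ) : ℤ_[p]) := by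
  rw [apply_toLocal, apply_toLocal]
  exact map_rootB (Int.castRingHom ℤ_[p]) x y

lemma rootQ_toLocal (x : Fin 4 → ℤ) :
    rootQ (P (toLocal P x)) = ((rootQ x : ℤ) : ℤ_[p]) := by
  rw [apply_toLocal]
  exact map_rootQ (Int.castRingHom ℤ_[p]) x

lemma pow_dvd_cast_iff {j : ℕ} {m : ℤ} :
    (p : ℤ_[p]) ^ j ∣ (m : ℤ_[p]) ↔ ((p ^ j : ℕ) : ℤ) ∣ m := by
  rw [PadicInt.pow_p_dvd_int_iff]; push_cast; rfl

lemma smul_mem_of_index {r : ℕ} {D : Submodule ℤ_[p] (Fin 4 → ℤ_[p])}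
    (h : D.toAddSubgroup.index = p ^ r) (w : Fin 4 → ℤ_[p]) : (p : ℤ_[p]) ^ r • w ∈ D := by
  have := AddSubgroup.nsmul_index_mem D.toAddSubgroup w
  rw [h, ← Nat.cast_smul_eq_nsmul ℤ_[p]] at this
  exact_mod_cast this

/-- Density: the integral points and `p ^ r ℤ_p⁴` together generate `ℤ_p⁴`, so the quotient by `D`
is unchanged. -/
lemma index_comap_toLocal {r : ℕ} {D : Submodule ℤ_[p] (Fin 4 → ℤ_[p])}
    (h : ∀ w, (p : ℤ_[p]) ^ r • w ∈ D) :
    (D.toAddSubgroup.comap (toLocal P)).index = D.toAddSubgroup.index := by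
  rw [AddSubgroup.index_comap, ← AddSubgroup.relIndex_sup_right, ← AddSubgroup.relIndex_top_right]
  congr 1
  rw [eq_top_iff]
  intro v _
  obtain ⟨y, w, rfl⟩ := exists_toLocal_add P v r
  exact add_mem (AddSubgroup.mem_sup_left ⟨y, rfl⟩) (AddSubgroup.mem_sup_right (h w))

/-- Local coincidence of the preimage of a coincident sublattice. -/
lemma dvd_rootQ_of_comap {D : Submodule ℤ_[p] (Fin 4 → ℤ_[p])}
    (hC : IsCoincident (D.toAddSubgroup.comap (toLocal P))) (x : Fin 4 → ℤ_[p]) (j : ℕ)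
    (hx : ∀ y ∈ D, (p : ℤ_[p]) ^ j ∣ rootB (P x) (P y)) : (p : ℤ_[p]) ^ j ∣ rootQ (P x) := by
  obtain ⟨x', w, rfl⟩ := exists_toLocal_add P x j
  have h1 : ((p ^ j : ℕ) : ℤ) ∣ rootQ x' := by
    refine hC x' _ (pow_pos hp.out.pos j) fun y hy => ?_
    have := hx (toLocal P y) hy
    rw [map_add, rootB_add_left, map_smul, rootB_smul_left, rootB_toLocal] at this
    exact pow_dvd_cast_iff.1 ((dvd_add_left (dvd_mul_right _ _)).1 this)
  rw [map_add, rootQ_add, map_smul, rootQ_smul, rootB_smul_right, rootQ_toLocal]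
  refine dvd_add (dvd_add (pow_dvd_cast_iff.2 h1) ?_) (dvd_mul_right _ _)
  rw [pow_two, mul_assoc]
  exact dvd_mul_right _ _

/-- At `p` the condition passes from integral points to `D` by density. At another prime the
preimage looks like the full lattice, since it contains `p ^ r ℤ⁴`. -/
lemma isCoincident_comap {r : ℕ} {D : Submodule ℤ_[p] (Fin 4 → ℤ_[p])}
    (hD : D ∈ localCoincident P r) : IsCoincident (D.toAddSubgroup.comap (toLocal P)) := by
  have hr := smul_mem_of_index hD.1
  have hr' : ∀ y ∈ (⊤ : AddSubgroup (Fin 4 → ℤ)),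
      p ^ r • y ∈ D.toAddSubgroup.comap (toLocal P) := by
    intro y _
    change toLocal P (p ^ r • y) ∈ D
    rw [map_nsmul, ← Nat.cast_smul_eq_nsmul ℤ_[p]]
    exact_mod_cast hr (toLocal P y)
  rw [isCoincident_iff_prime_pow]
  intro q j hq x hx
  by_cases hqp : q = p
  · subst hqp
    rw [← pow_dvd_cast_iff, ← rootQ_toLocal (P := P)]
    refine hD.2 _ j fun v hv => ?_
    obtain ⟨y, w, rfl⟩ := exists_toLocal_add P v (r + j)
    have hy : toLocal P y ∈ D := by
      have := D.sub_mem hv (hr ((q : ℤ_[q]) ^ j • w))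
      rwa [smul_smul, ← pow_add, add_sub_cancel_right] at this
    rw [map_add, rootB_add_right, map_smul, rootB_smul_right, rootB_toLocal, pow_add]
    exact dvd_add (pow_dvd_cast_iff.2 (hx y hy)) (((dvd_mul_left _ _).mul_right _))
  · refine isCoincident_top x _ (pow_pos hq.pos j) (dvd_rootB_of_coprime ?_ hr' hx)
    exact Nat.Coprime.pow _ _ ((Nat.coprime_primes hq hp.out).2 hqp)

/-- Counting coincidence site lattices of prime power index in the completion. -/
theorem ncard_coincidentOfIndex_prime_pow
    (P : (Fin 4 → ℤ_[p]) ≃ₗ[ℤ_[p]] (Fin 4 → ℤ_[p])) (r : ℕ) :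
    (coincidentOfIndex (p ^ r)).ncard = (localCoincident P r).ncard := by
  have himage : coincidentOfIndex (p ^ r) =
      (fun D : Submodule ℤ_[p] (Fin 4 → ℤ_[p]) => D.toAddSubgroup.comap (toLocal P)) ''
        localCoincident P r := by
    ext C
    constructor
    · rintro ⟨hi, hC⟩
      -- The set `C + p ^ r ℤ_p⁴`. It is stable under `ℤ_p`, since a scalar acts as a natural number
      -- modulo `p ^ r`.
      let D : Submodule ℤ_[p] (Fin 4 → ℤ_[p]) :=
        { carrier := {v | ∃ y ∈ C, ∃ w, v = toLocal P y + (p : ℤ_[p]) ^ r • w}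
          zero_mem' := ⟨0, zero_mem _, 0, by simp⟩
          add_mem' := by
            rintro _ _ ⟨y, hy, w, rfl⟩ ⟨y', hy', w', rfl⟩
            exact ⟨y + y', add_mem hy hy', w + w', by rw [map_add, smul_add]; abel⟩
          smul_mem' := by
            rintro c _ ⟨y, hy, w, rfl⟩
            obtain ⟨n, -, d, hd⟩ := PadicInt.exists_nat_add c r
            refine ⟨n • y, nsmul_mem hy n, d • toLocal P y + c • w, ?_⟩
            rw [map_nsmul, ← Nat.cast_smul_eq_nsmul ℤ_[p], smul_add, smul_add, smul_smul _ d,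
              ← add_assoc, ← add_smul, ← hd, smul_comm c] }
      have hD : D.toAddSubgroup.comap (toLocal P) = C := by
        ext y
        constructor
        · rintro ⟨y', hy', w, h⟩
          have h' : toLocal P (y - y') = (p : ℤ_[p]) ^ r • w := by rw [map_sub, h]; abel
          obtain ⟨z, hz⟩ := exists_smul_of_toLocal h'
          have h1 : y - y' ∈ C := scaledLattice_index_le hi (mem_scaledLattice.2 ⟨z, hz⟩)
          simpa using add_mem h1 hy'
        · intro hy
          exact ⟨y, hy, 0, by simp⟩
      have hr : ∀ w, (p : ℤ_[p]) ^ r • w ∈ D := fun w => ⟨0, zero_mem _, w, by simp⟩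
      refine ⟨D, ⟨?_, dvd_rootQ_of_comap (hD.symm ▸ hC)⟩, hD⟩
      rw [← index_comap_toLocal (P := P) hr, hD, hi]
    · rintro ⟨D, hD, rfl⟩
      refine ⟨?_, isCoincident_comap hD⟩
      change (D.toAddSubgroup.comap (toLocal P)).index = _
      rw [index_comap_toLocal (smul_mem_of_index hD.1), hD.1]
  rw [himage, Set.InjOn.ncard_image]
  have key : ∀ D ∈ localCoincident P r, ∀ D' ∈ localCoincident P r,
      D.toAddSubgroup.comap (toLocal P) = D'.toAddSubgroup.comap (toLocal P) → D ≤ D' := by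
    intro D hD D' hD' h v hv
    obtain ⟨y, w, rfl⟩ := exists_toLocal_add P v r
    have hy : y ∈ D.toAddSubgroup.comap (toLocal P) := by
      change toLocal P y ∈ D
      simpa using D.sub_mem hv (smul_mem_of_index hD.1 w)
    rw [h] at hy
    exact D'.add_mem hy (smul_mem_of_index hD'.1 w)
  exact fun D hD D' hD' h => le_antisymm (key D hD D' hD' h) (key D' hD' D hD h.symm)

/-- The whole lattice is locally coincident. -/
lemma dvd_rootQ_of_forall {x : Fin 4 → ℤ_[p]} {j : ℕ}
    (hx : ∀ y, (p : ℤ_[p]) ^ j ∣ rootB (P x) (P y)) : (p : ℤ_[p]) ^ j ∣ rootQ (P x) := by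
  refine dvd_rootQ_of_comap (D := ⊤) (P := P) ?_ x j fun y _ => hx y
  exact isCoincident_top

/-- Elementary divisors of a locally coincident sublattice. -/
lemma exists_local_divisors {r : ℕ} {D : Submodule ℤ_[p] (Fin 4 → ℤ_[p])}
    (hD : D ∈ localCoincident P r) :
    ∃ (e x : Fin 4 → Fin 4 → ℤ_[p]) (a : Fin 4 → ℕ),
      (∀ i j, (p : ℤ_[p]) ^ a i ∣ rootB (P (x i)) (P (e j)) - if i = j then 1 else 0) ∧
      (∀ y, y ∈ D ↔ ∀ i, (p : ℤ_[p]) ^ a i ∣ rootB (P (x i)) (P y)) ∧ ∑ i, a i = r := by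
  have hC := isCoincident_comap hD
  have hi : (D.toAddSubgroup.comap (toLocal P)).index = p ^ r := by
    rw [index_comap_toLocal (smul_mem_of_index hD.1), hD.1]
  obtain ⟨e, x, a, -, h1, h2, h3⟩ := hC.exists_root_divisors
    (by rw [hi]; exact pow_ne_zero _ hp.out.ne_zero)
  rw [hi] at h3
  have ha : ∀ i, ∃ k ≤ r, a i = p ^ k := fun i =>
    (Nat.dvd_prime_pow hp.out).1 (h3 ▸ Finset.dvd_prod_of_mem a (Finset.mem_univ i))
  choose k hk hak using ha
  refine ⟨fun i => toLocal P (e i), fun i => toLocal P (x i), k, fun i j => ?_, fun y => ?_, ?_⟩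
  · have := h1 i j
    rw [hak, ← pow_dvd_cast_iff (p := p)] at this
    rw [rootB_toLocal]
    convert this using 1
    split_ifs <;> simp
  · obtain ⟨y, w, rfl⟩ := exists_toLocal_add P y r
    rw [Submodule.add_mem_iff_left _ (smul_mem_of_index hD.1 w)]
    refine (h2 y).trans (forall_congr' fun i => ?_)
    rw [map_add, rootB_add_right, map_smul, rootB_smul_right, rootB_toLocal,
      dvd_add_left ((pow_dvd_pow _ (hk i)).mul_right _), hak, pow_dvd_cast_iff]
  · refine Nat.pow_right_injective hp.out.two_le ?_
    change p ^ (∑ i, k i) = p ^ r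
    rw [← h3, ← Finset.prod_pow_eq_pow_sum]
    exact Finset.prod_congr rfl fun i _ => (hak i).symm

end Local

/-! ## Counting for the primes where the form has Witt index one -/

section FunctionalLattice

variable {p : ℕ} [hp : Fact p.Prime]

/-- The lattice of all `y` with `B(x, y)` divisible by `p ^ r`. -/
def functionalLattice (P : (Fin 4 → ℤ_[p]) ≃ₗ[ℤ_[p]] (Fin 4 → ℤ_[p])) (x : Fin 4 → ℤ_[p])
    (r : ℕ) : Submodule ℤ_[p] (Fin 4 → ℤ_[p]) where
  carrier := {y | (p : ℤ_[p]) ^ r ∣ rootB (P x) (P y)}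
  zero_mem' := by simp [rootB_zero_right]
  add_mem' := by
    intro a b ha hb
    simp only [Set.mem_ofPred_eq] at ha hb ⊢
    rw [map_add, rootB_add_right]; exact dvd_add ha hb
  smul_mem' := by
    intro c a ha
    simp only [Set.mem_ofPred_eq] at ha ⊢
    rw [map_smul, rootB_smul_right]; exact ha.mul_left c

variable {P : (Fin 4 → ℤ_[p]) ≃ₗ[ℤ_[p]] (Fin 4 → ℤ_[p])}

lemma mem_functionalLattice {x y : Fin 4 → ℤ_[p]} {r : ℕ} :
    y ∈ functionalLattice P x r ↔ (p : ℤ_[p]) ^ r ∣ rootB (P x) (P y) := Iff.rfl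

lemma functionalLattice_congr {x x' : Fin 4 → ℤ_[p]} {r : ℕ}
    (h : ∀ w, (p : ℤ_[p]) ^ r ∣ rootB (P x) (P w) - rootB (P x') (P w)) :
    functionalLattice P x r = functionalLattice P x' r := by
  ext w
  rw [mem_functionalLattice, mem_functionalLattice, ← dvd_sub_right (h w), sub_sub_cancel_left,
    dvd_neg]

lemma functionalLattice_smul {x : Fin 4 → ℤ_[p]} {r : ℕ} {w : ℤ_[p]} (hw : IsUnit w) :
    functionalLattice P (w • x) r = functionalLattice P x r := by
  ext y
  rw [mem_functionalLattice, mem_functionalLattice, map_smul, rootB_smul_left, hw.dvd_mul_left]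

lemma PadicInt.toZModPow_eq_zero_iff {x : ℤ_[p]} {r : ℕ} :
    PadicInt.toZModPow r x = 0 ↔ (p : ℤ_[p]) ^ r ∣ x := by
  rw [← RingHom.mem_ker, PadicInt.ker_toZModPow, Ideal.mem_span_singleton]

lemma functionalLattice_index {x e : Fin 4 → ℤ_[p]} (r : ℕ) (he : rootB (P x) (P e) = 1) :
    (functionalLattice P x r).toAddSubgroup.index = p ^ r := by
  have : NeZero (p ^ r) := ⟨pow_ne_zero _ hp.out.ne_zero⟩
  let f : (Fin 4 → ℤ_[p]) →+ ZMod (p ^ r) :=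
    { toFun := fun y => PadicInt.toZModPow r (rootB (P x) (P y))
      map_zero' := by simp [rootB_zero_right]
      map_add' := fun a b => by rw [map_add, rootB_add_right, map_add] }
  have hf : Function.Surjective f := by
    intro z
    obtain ⟨t, rfl⟩ := ZMod.ringHom_surjective (PadicInt.toZModPow (p := p) r) z
    refine ⟨t • e, ?_⟩
    change PadicInt.toZModPow r (rootB (P x) (P (t • e))) = _
    rw [map_smul, rootB_smul_right, he, mul_one]
  have hk : (functionalLattice P x r).toAddSubgroup = f.ker := by
    ext y
    exact PadicInt.toZModPow_eq_zero_iff.symm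
  rw [hk, AddSubgroup.index_ker, AddMonoidHom.range_eq_top.2 hf]
  simp

/-- Each `w - B(x, w) e` lies in the lattice, so the hypothesis on `z` says that `z - B(z, e) x`
pairs into `p ^ j` with everything. Thus `z` agrees with a multiple of the isotropic vector `x` up
to a harmless error. -/
lemma functionalLattice_mem_localCoincident {x e : Fin 4 → ℤ_[p]} (r : ℕ)
    (he : rootB (P x) (P e) = 1) (hx : rootQ (P x) = 0) :
    functionalLattice P x r ∈ localCoincident P r := by
  refine ⟨functionalLattice_index r he, fun z j hz => ?_⟩
  have h1 : ∀ w, (p : ℤ_[p]) ^ j ∣ rootB (P (z + (-rootB (P z) (P e)) • x)) (P w) := by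
    intro w
    have := hz (w + (-rootB (P x) (P w)) • e) (by
      rw [mem_functionalLattice, map_add, rootB_add_right, map_smul, rootB_smul_right, he]
      simp)
    rw [map_add, rootB_add_right, map_smul, rootB_smul_right] at this
    rw [map_add, rootB_add_left, map_smul, rootB_smul_left]
    convert this using 1; ring
  have h2 := dvd_rootQ_of_forall h1
  have h3 := h1 x
  rw [map_add, map_smul] at h2 h3
  rw [rootB_add_left, rootB_smul_left, rootB_self, hx] at h3
  rw [rootQ_add, rootQ_smul, rootB_smul_right, hx] at h2
  have h4 := dvd_sub h2 (h3.mul_left (-rootB (P z) (P e)))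
  convert h4 using 1; ring

/-- A functional normalised to take the value one at `e` is determined modulo `p ^ r` by its kernel.
-/
lemma dvd_sub_of_functionalLattice_eq {x x' e : Fin 4 → ℤ_[p]} {r : ℕ}
    (he : rootB (P x) (P e) = 1) (he' : rootB (P x') (P e) = 1)
    (h : functionalLattice P x r = functionalLattice P x' r) (w : Fin 4 → ℤ_[p]) :
    (p : ℤ_[p]) ^ r ∣ rootB (P x) (P w) - rootB (P x') (P w) := by
  have h1 : w + (-rootB (P x') (P w)) • e ∈ functionalLattice P x r := by
    rw [h, mem_functionalLattice, map_add, rootB_add_right, map_smul, rootB_smul_right, he']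
    simp
  rw [mem_functionalLattice, map_add, rootB_add_right, map_smul, rootB_smul_right, he] at h1
  convert h1 using 1; ring

end FunctionalLattice

/-! ### One elementary divisor and two charts of the quadric -/

section Anisotropic

variable {p : ℕ} [hp : Fact p.Prime] {P : (Fin 4 → ℤ_[p]) ≃ₗ[ℤ_[p]] (Fin 4 → ℤ_[p])}
  {α β γ : ℤ_[p]} {ε : ℕ}

/-- The vector `(0, 0, c, d)` pairs into `p ^ j` with everything, so coincidence of the whole
lattice applies. This covers `p = 2` and `p = 5` without a separate argument. -/
lemma IsAnisotropicSplitting.dvd_form (hS : IsAnisotropicSplitting P α β γ ε) {j : ℕ}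
    {c d : ℤ_[p]} (hc : (p : ℤ_[p]) ^ j ∣ c) (hd : (p : ℤ_[p]) ^ j ∣ p ^ ε * d) :
    (p : ℤ_[p]) ^ j ∣ α * c ^ 2 + β * c * d + γ * d ^ 2 := by
  obtain ⟨h1, h2⟩ := (hS.polar j c d).2 ⟨hc, hd⟩
  have := dvd_rootQ_of_forall (P := P) (x := ![0, 0, c, d]) (j := j) fun y => by
    rw [rootB_splitting hS.rootQ_eq]
    simpa using dvd_add (h1.mul_right (y 2)) (h2.mul_right (y 3))
  rw [hS.rootQ_eq] at this
  simpa using this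

/-- Anisotropy kills the contribution of the last two coordinates modulo `p`, so only the second
hyperbolic coordinate of `z` is left. -/
lemma IsAnisotropicSplitting.dvd_rootB_sub (hS : IsAnisotropicSplitting P α β γ ε)
    {z : Fin 4 → ℤ_[p]} (h0 : (p : ℤ_[p]) ∣ z 0) (hz : (p : ℤ_[p]) ∣ rootQ (P z))
    (w : Fin 4 → ℤ_[p]) : (p : ℤ_[p]) ∣ rootB (P z) (P w) - z 1 * w 0 := by
  rw [hS.rootQ_eq, dvd_add_right (h0.mul_right _)] at hz
  obtain ⟨h1, h2⟩ := (hS.polar 1 (z 2) (z 3)).2 (by simpa using hS.anisotropic _ _ hz)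
  rw [pow_one] at h1 h2
  rw [rootB_splitting hS.rootQ_eq]
  convert dvd_add (dvd_add (h0.mul_right (w 1)) (h1.mul_right (w 2))) (h2.mul_right (w 3)) using 1
  ring

/-- The combination `x 0 • x' - x' 0 • x` is isotropic modulo `p` with vanishing first coordinate.
Pairing it with `x` kills its second coordinate as well, so the two functionals are proportional
modulo `p`. -/
lemma IsAnisotropicSplitting.dvd_minor_of_not_dvd (hS : IsAnisotropicSplitting P α β γ ε)
    {x x' : Fin 4 → ℤ_[p]} (h0 : ¬ (p : ℤ_[p]) ∣ x 0) (hx : (p : ℤ_[p]) ∣ rootQ (P x))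
    (hx' : (p : ℤ_[p]) ∣ rootQ (P x')) (hB : (p : ℤ_[p]) ∣ rootB (P x) (P x'))
    (y y' : Fin 4 → ℤ_[p]) :
    (p : ℤ_[p]) ∣ rootB (P x) (P y) * rootB (P x') (P y')
      - rootB (P x) (P y') * rootB (P x') (P y) := by
  have hpp := PadicInt.prime_p (p := p)
  let z := x 0 • x' + (-x' 0) • x
  have hPz : P z = x 0 • P x' + (-x' 0) • P x := by simp [z]
  have hz0 : z 0 = 0 := by simp [z]; ring
  have hQz : (p : ℤ_[p]) ∣ rootQ (P z) := by
    rw [hPz, rootQ_add, rootQ_smul, rootQ_smul, rootB_smul_left, rootB_smul_right, rootB_comm]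
    exact dvd_add (dvd_add (hx'.mul_left _) (hx.mul_left _)) ((hB.mul_left _).mul_left _)
  have hz := hS.dvd_rootB_sub (hz0 ▸ dvd_zero _) hQz
  have hz1 : (p : ℤ_[p]) ∣ z 1 := by
    have h1 := hz x
    rw [hPz, rootB_add_left, rootB_smul_left, rootB_smul_left, rootB_self, rootB_comm] at h1
    have h2 : (p : ℤ_[p]) ∣ x 0 * rootB (P x) (P x') + -x' 0 * (2 * rootQ (P x)) :=
      dvd_add (hB.mul_left _) ((hx.mul_left _).mul_left _)
    exact (hpp.dvd_mul.1 ((dvd_sub_right h2).1 h1)).resolve_right h0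
  have hzw : ∀ w, (p : ℤ_[p]) ∣ x 0 * rootB (P x') (P w) - x' 0 * rootB (P x) (P w) := by
    intro w
    have h1 := (dvd_sub_left (hz1.mul_right (w 0))).1 (hz w)
    rw [hPz, rootB_add_left, rootB_smul_left, rootB_smul_left] at h1
    convert h1 using 1; ring
  refine (hpp.dvd_mul.1 (?_ : (p : ℤ_[p]) ∣ x 0 * _)).resolve_left h0
  convert dvd_sub ((hzw y').mul_left (rootB (P x) (P y)))
    ((hzw y).mul_left (rootB (P x) (P y'))) using 1
  ring

/-- Modulo `p` there is no totally isotropic plane. -/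
lemma IsAnisotropicSplitting.dvd_minor (hS : IsAnisotropicSplitting P α β γ ε)
    {x x' : Fin 4 → ℤ_[p]} (hx : (p : ℤ_[p]) ∣ rootQ (P x))
    (hx' : (p : ℤ_[p]) ∣ rootQ (P x')) (hB : (p : ℤ_[p]) ∣ rootB (P x) (P x'))
    (y y' : Fin 4 → ℤ_[p]) :
    (p : ℤ_[p]) ∣ rootB (P x) (P y) * rootB (P x') (P y')
      - rootB (P x) (P y') * rootB (P x') (P y) := by
  by_cases h0 : (p : ℤ_[p]) ∣ x 0
  · by_cases h0' : (p : ℤ_[p]) ∣ x' 0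
    · obtain ⟨s, hs⟩ := hS.dvd_rootB_sub h0 hx y
      obtain ⟨t, ht⟩ := hS.dvd_rootB_sub h0' hx' y'
      obtain ⟨s', hs'⟩ := hS.dvd_rootB_sub h0 hx y'
      obtain ⟨t', ht'⟩ := hS.dvd_rootB_sub h0' hx' y
      rw [sub_eq_iff_eq_add] at hs ht hs' ht'
      rw [hs, ht, hs', ht']
      exact ⟨p * s * t + s * x' 1 * y' 0 + x 1 * y 0 * t - p * s' * t' - s' * x' 1 * y 0
        - x 1 * y' 0 * t', by ring⟩
    · have := hS.dvd_minor_of_not_dvd h0' hx' hx (by rwa [rootB_comm]) y' y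
      convert this using 1; ring
  · exact hS.dvd_minor_of_not_dvd h0 hx hx' hB y y'

lemma dvd_rootQ_divisor {r : ℕ} {D : Submodule ℤ_[p] (Fin 4 → ℤ_[p])}
    (hD : D ∈ localCoincident P r) {x : Fin 4 → Fin 4 → ℤ_[p]} {a : Fin 4 → ℕ}
    (hmem : ∀ y, y ∈ D ↔ ∀ i, (p : ℤ_[p]) ^ a i ∣ rootB (P (x i)) (P y)) (i : Fin 4) :
    (p : ℤ_[p]) ^ a i ∣ rootQ (P (x i)) := hD.2 _ _ fun y hy => (hmem y).1 hy i

/-- Coincidence applied to `x i + x k` gives the mixed term by polarisation. -/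
lemma dvd_rootB_divisors {r : ℕ} {D : Submodule ℤ_[p] (Fin 4 → ℤ_[p])}
    (hD : D ∈ localCoincident P r) {x : Fin 4 → Fin 4 → ℤ_[p]} {a : Fin 4 → ℕ}
    (hmem : ∀ y, y ∈ D ↔ ∀ i, (p : ℤ_[p]) ^ a i ∣ rootB (P (x i)) (P y)) {i k : Fin 4} {j : ℕ}
    (hi : j ≤ a i) (hk : j ≤ a k) : (p : ℤ_[p]) ^ j ∣ rootB (P (x i)) (P (x k)) := by
  have h1 := hD.2 (x i + x k) j fun y hy => by
    rw [map_add, rootB_add_left]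
    exact dvd_add ((pow_dvd_pow _ hi).trans ((hmem y).1 hy i))
      ((pow_dvd_pow _ hk).trans ((hmem y).1 hy k))
  rw [map_add, rootQ_add] at h1
  exact (dvd_add_right (dvd_add ((pow_dvd_pow _ hi).trans (dvd_rootQ_divisor hD hmem i))
    ((pow_dvd_pow _ hk).trans (dvd_rootQ_divisor hD hmem k)))).1 h1

/-- Two nontrivial divisors would span a totally isotropic plane modulo `p`. By `dvd_minor` their
minor at the dual vectors would be divisible by `p`, but it is congruent to one. -/
lemma IsAnisotropicSplitting.exists_eq_functionalLattice (hS : IsAnisotropicSplitting P α β γ ε)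
    {r : ℕ} (hr : r ≠ 0) {D : Submodule ℤ_[p] (Fin 4 → ℤ_[p])} (hD : D ∈ localCoincident P r) :
    ∃ x e, D = functionalLattice P x r ∧ (p : ℤ_[p]) ^ r ∣ rootB (P x) (P e) - 1 := by
  obtain ⟨e, x, a, h1, h2, h3⟩ := exists_local_divisors hD
  have hpp := PadicInt.prime_p (p := p)
  obtain ⟨i, hi⟩ : ∃ i, a i ≠ 0 := by
    by_contra! h
    exact hr (by rw [← h3]; simp [h])
  have hne : ∀ k, k ≠ i → a k = 0 := by
    intro k hk
    by_contra hk0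
    have hdi := dvd_rootQ_divisor hD h2 i
    have hdk := dvd_rootQ_divisor hD h2 k
    have e1 := h1 i i
    have e2 := h1 k k
    have e3 := h1 i k
    have e4 := h1 k i
    have q1 := dvd_pow_self (p : ℤ_[p]) hi
    have q2 := dvd_pow_self (p : ℤ_[p]) hk0
    rw [if_pos rfl] at e1 e2
    rw [if_neg hk.symm, sub_zero] at e3
    rw [if_neg hk, sub_zero] at e4
    obtain ⟨s1, e1⟩ := q1.trans e1
    obtain ⟨s2, e2⟩ := q2.trans e2
    have hB : (p : ℤ_[p]) ∣ rootB (P (x i)) (P (x k)) := by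
      simpa using dvd_rootB_divisors hD h2 (j := 1) (Nat.one_le_iff_ne_zero.2 hi)
        (Nat.one_le_iff_ne_zero.2 hk0)
    have := hS.dvd_minor (q1.trans hdi) (q2.trans hdk) hB (e i) (e k)
    rw [dvd_sub_left ((q1.trans e3).mul_right _)] at this
    rw [sub_eq_iff_eq_add] at e1 e2
    rw [e1, e2] at this
    have h6 : (p : ℤ_[p]) ∣ p * (s1 * (p * s2 + 1) + s2) := dvd_mul_right _ _
    have h7 := dvd_sub this h6
    exact hpp.not_isUnit (isUnit_of_dvd_one (by convert h7 using 1; ring))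
  have hai : a i = r := by
    rw [← h3, Finset.sum_eq_single i (fun k _ hk => hne k hk) (by simp)]
  refine ⟨x i, e i, ?_, ?_⟩
  · ext y
    rw [h2, mem_functionalLattice]
    refine ⟨fun h => hai ▸ h i, fun h k => ?_⟩
    by_cases hk : k = i
    · subst hk; rwa [hai]
    · rw [hne k hk, pow_zero]; exact one_dvd _
  · have := h1 i i
    rwa [if_pos rfl, hai] at this

lemma IsAnisotropicSplitting.functionalLattice_eq (hS : IsAnisotropicSplitting P α β γ ε) {r : ℕ}
    {a b c d a' b' c' d' : ℤ_[p]} (ha : (p : ℤ_[p]) ^ r ∣ a - a') (hb : (p : ℤ_[p]) ^ r ∣ b - b')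
    (hc : (p : ℤ_[p]) ^ r ∣ c - c') (hd : (p : ℤ_[p]) ^ r ∣ p ^ ε * (d - d')) :
    functionalLattice P ![a, b, c, d] r = functionalLattice P ![a', b', c', d'] r := by
  obtain ⟨h1, h2⟩ := (hS.polar r _ _).2 ⟨hc, hd⟩
  refine functionalLattice_congr fun w => ?_
  rw [rootB_splitting hS.rootQ_eq, rootB_splitting hS.rootQ_eq]
  simp only [Matrix.cons_val]
  convert dvd_add (dvd_add (ha.mul_right (w 1)) (hb.mul_right (w 0)))
    (dvd_add (h1.mul_right (w 2)) (h2.mul_right (w 3))) using 1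
  ring

/-- The lattice attached to a point of the chart where the first coordinate is a unit. -/
noncomputable def chartOne (P : (Fin 4 → ℤ_[p]) ≃ₗ[ℤ_[p]] (Fin 4 → ℤ_[p])) (α β γ : ℤ_[p]) (r : ℕ)
    (c d : ℤ_[p]) : Submodule ℤ_[p] (Fin 4 → ℤ_[p]) :=
  functionalLattice P ![1, -(α * c ^ 2 + β * c * d + γ * d ^ 2), c, d] r

/-- The lattice attached to a point of the chart where the second coordinate is a unit. -/
noncomputable def chartTwo (P : (Fin 4 → ℤ_[p]) ≃ₗ[ℤ_[p]] (Fin 4 → ℤ_[p])) (α β γ : ℤ_[p]) (r : ℕ)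
    (c d : ℤ_[p]) : Submodule ℤ_[p] (Fin 4 → ℤ_[p]) :=
  functionalLattice P ![-(α * c ^ 2 + β * c * d + γ * d ^ 2), 1, c, d] r

lemma IsAnisotropicSplitting.chartOne_mem (hS : IsAnisotropicSplitting P α β γ ε) (r : ℕ)
    (c d : ℤ_[p]) : chartOne P α β γ r c d ∈ localCoincident P r := by
  refine functionalLattice_mem_localCoincident (e := Pi.single 1 1) r ?_ ?_
  · rw [rootB_splitting hS.rootQ_eq]; simp
  · rw [hS.rootQ_eq]; simp only [Matrix.cons_val]; ring

lemma IsAnisotropicSplitting.chartTwo_mem (hS : IsAnisotropicSplitting P α β γ ε) (r : ℕ)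
    (c d : ℤ_[p]) : chartTwo P α β γ r c d ∈ localCoincident P r := by
  refine functionalLattice_mem_localCoincident (e := Pi.single 0 1) r ?_ ?_
  · rw [rootB_splitting hS.rootQ_eq]; simp
  · rw [hS.rootQ_eq]; simp only [Matrix.cons_val]; ring

lemma IsAnisotropicSplitting.dvd_of_polar_sub (hS : IsAnisotropicSplitting P α β γ ε) {r : ℕ}
    {c d c' d' : ℤ_[p]} {x x' : Fin 4 → ℤ_[p]} (hx : x 2 = c ∧ x 3 = d) (hx' : x' 2 = c' ∧ x' 3 = d')
    (h : ∀ w, (p : ℤ_[p]) ^ r ∣ rootB (P x) (P w) - rootB (P x') (P w)) :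
    (p : ℤ_[p]) ^ r ∣ c - c' ∧ (p : ℤ_[p]) ^ r ∣ p ^ ε * (d - d') := by
  refine (hS.polar r _ _).1 ⟨?_, ?_⟩
  · have := h (Pi.single 2 1)
    rw [rootB_splitting hS.rootQ_eq, rootB_splitting hS.rootQ_eq, hx.1, hx.2, hx'.1, hx'.2] at this
    simp only [Pi.single_eq_same, ne_eq, Fin.reduceEq, not_false_eq_true,
      Pi.single_eq_of_ne] at this
    convert this using 1; ring
  · have := h (Pi.single 3 1)
    rw [rootB_splitting hS.rootQ_eq, rootB_splitting hS.rootQ_eq, hx.1, hx.2, hx'.1, hx'.2] at this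
    simp only [Pi.single_eq_same, ne_eq, Fin.reduceEq, not_false_eq_true,
      Pi.single_eq_of_ne] at this
    convert this using 1; ring

lemma IsAnisotropicSplitting.dvd_of_chartOne_eq (hS : IsAnisotropicSplitting P α β γ ε) {r : ℕ}
    {c d c' d' : ℤ_[p]} (h : chartOne P α β γ r c d = chartOne P α β γ r c' d') :
    (p : ℤ_[p]) ^ r ∣ c - c' ∧ (p : ℤ_[p]) ^ r ∣ p ^ ε * (d - d') :=
  hS.dvd_of_polar_sub ⟨rfl, rfl⟩ ⟨rfl, rfl⟩ (dvd_sub_of_functionalLattice_eq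
    (e := Pi.single 1 1) (by rw [rootB_splitting hS.rootQ_eq]; simp)
    (by rw [rootB_splitting hS.rootQ_eq]; simp) h)

lemma IsAnisotropicSplitting.dvd_of_chartTwo_eq (hS : IsAnisotropicSplitting P α β γ ε) {r : ℕ}
    {c d c' d' : ℤ_[p]} (h : chartTwo P α β γ r c d = chartTwo P α β γ r c' d') :
    (p : ℤ_[p]) ^ r ∣ c - c' ∧ (p : ℤ_[p]) ^ r ∣ p ^ ε * (d - d') :=
  hS.dvd_of_polar_sub ⟨rfl, rfl⟩ ⟨rfl, rfl⟩ (dvd_sub_of_functionalLattice_eq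
    (e := Pi.single 0 1) (by rw [rootB_splitting hS.rootQ_eq]; simp)
    (by rw [rootB_splitting hS.rootQ_eq]; simp) h)

lemma IsAnisotropicSplitting.chartOne_ne_chartTwo (hS : IsAnisotropicSplitting P α β γ ε) {r : ℕ}
    (hr : r ≠ 0) {c d c' d' : ℤ_[p]} (hc : (p : ℤ_[p]) ∣ c') (hd : (p : ℤ_[p]) ∣ p ^ ε * d') :
    chartOne P α β γ r c d ≠ chartTwo P α β γ r c' d' := by
  intro h
  -- This vector pairs to zero with the defining vector of the first chart and to a unit with that
  -- of the second.
  have h1 : ![1, α * c ^ 2 + β * c * d + γ * d ^ 2, 0, 0] ∈ chartOne P α β γ r c d := by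
    rw [chartOne, mem_functionalLattice, rootB_splitting hS.rootQ_eq]; simp
  rw [h, chartTwo, mem_functionalLattice, rootB_splitting hS.rootQ_eq] at h1
  simp only [Matrix.cons_val] at h1
  have h2 := (dvd_pow_self (p : ℤ_[p]) hr).trans h1
  have h3 : (p : ℤ_[p]) ∣ α * c' ^ 2 + β * c' * d' + γ * d' ^ 2 := by
    simpa using hS.dvd_form (j := 1) (by simpa using hc) (by simpa using hd)
  have h4 := dvd_add h2 (h3.mul_right (α * c ^ 2 + β * c * d + γ * d ^ 2))
  exact PadicInt.prime_p.not_isUnit (isUnit_of_dvd_one (by convert h4 using 1; ring))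

/-- Coincidence applied to the defining vector makes it isotropic modulo `p ^ r`. Its first
coordinate being one, this fixes the second. -/
lemma IsAnisotropicSplitting.eq_chartOne (hS : IsAnisotropicSplitting P α β γ ε) {r : ℕ}
    {b c d c' d' : ℤ_[p]} (hD : functionalLattice P ![1, b, c, d] r ∈ localCoincident P r)
    (hc : (p : ℤ_[p]) ^ r ∣ c - c') (hd : (p : ℤ_[p]) ^ r ∣ p ^ ε * (d - d')) :
    functionalLattice P ![1, b, c, d] r = chartOne P α β γ r c' d' := by
  rw [hS.functionalLattice_eq (a' := 1) (b' := b) (by simp) (by simp) hc hd] at hD ⊢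
  have h1 := hD.2 ![1, b, c', d'] r fun y hy => hy
  rw [hS.rootQ_eq] at h1
  simp only [Matrix.cons_val] at h1
  refine hS.functionalLattice_eq (by simp) ?_ (by simp) (by simp)
  convert h1 using 1; ring

lemma IsAnisotropicSplitting.eq_chartTwo (hS : IsAnisotropicSplitting P α β γ ε) {r : ℕ}
    {a c d c' d' : ℤ_[p]} (hD : functionalLattice P ![a, 1, c, d] r ∈ localCoincident P r)
    (hc : (p : ℤ_[p]) ^ r ∣ c - c') (hd : (p : ℤ_[p]) ^ r ∣ p ^ ε * (d - d')) :
    functionalLattice P ![a, 1, c, d] r = chartTwo P α β γ r c' d' := by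
  rw [hS.functionalLattice_eq (a' := a) (b' := 1) (by simp) (by simp) hc hd] at hD ⊢
  have h1 := hD.2 ![a, 1, c', d'] r fun y hy => hy
  rw [hS.rootQ_eq] at h1
  simp only [Matrix.cons_val] at h1
  refine hS.functionalLattice_eq ?_ (by simp) (by simp) (by simp)
  convert h1 using 1; ring

lemma PadicInt.natCast_inj_of_dvd {m n k : ℕ} (hm : m < p ^ k) (hn : n < p ^ k)
    (h : (p : ℤ_[p]) ^ k ∣ (m : ℤ_[p]) - n) : m = n := by
  have h1 : ((p ^ k : ℕ) : ℤ) ∣ (m : ℤ) - n := pow_dvd_cast_iff.1 (by push_cast; exact h)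
  have h2 : (n : ℤ) ≡ m [ZMOD (p ^ k : ℕ)] := Int.modEq_iff_dvd.2 h1
  exact ((Nat.ModEq.eq_of_lt_of_lt (Int.natCast_modEq_iff.1 h2) hn hm)).symm

/-- The parametrisation of the locally coincident lattices by two charts. -/
noncomputable def anisotropicChart (P : (Fin 4 → ℤ_[p]) ≃ₗ[ℤ_[p]] (Fin 4 → ℤ_[p])) (α β γ : ℤ_[p]) (ε r : ℕ) :
    (Fin (p ^ r) × Fin (p ^ (r - ε))) ⊕ (Fin (p ^ (r - 1)) × Fin (p ^ (r - 1))) →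
      Submodule ℤ_[p] (Fin 4 → ℤ_[p])
  | .inl s => chartOne P α β γ r (s.1 : ℕ) (s.2 : ℕ)
  | .inr s => chartTwo P α β γ r (p * (s.1 : ℕ)) (p ^ (1 - ε) * (s.2 : ℕ))

lemma IsAnisotropicSplitting.chart_injective (hS : IsAnisotropicSplitting P α β γ ε) {r : ℕ}
    (hr : r ≠ 0) (hε : ε ≤ 1) : Function.Injective (anisotropicChart P α β γ ε r) := by
  have hp0 : (p : ℤ_[p]) ≠ 0 := PadicInt.prime_p.ne_zero
  have hpε : (p : ℤ_[p]) ^ ε * p ^ (1 - ε) = p := by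
    rw [← pow_add, Nat.add_sub_cancel' hε, pow_one]
  have hpr : (p : ℤ_[p]) ^ r = p * p ^ (r - 1) := by
    rw [← pow_succ', Nat.sub_add_cancel (Nat.one_le_iff_ne_zero.2 hr)]
  have hpr' : (p : ℤ_[p]) ^ r = p ^ ε * p ^ (r - ε) := by
    rw [← pow_add]; congr 1; omega
  have hne : ∀ (s : Fin (p ^ r) × Fin (p ^ (r - ε))) (t : Fin (p ^ (r - 1)) × Fin (p ^ (r - 1))),
      anisotropicChart P α β γ ε r (.inl s) ≠ anisotropicChart P α β γ ε r (.inr t) := by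
    intro s t
    refine hS.chartOne_ne_chartTwo hr (dvd_mul_right _ _) ?_
    rw [← mul_assoc, hpε]
    exact dvd_mul_right _ _
  rintro (⟨c, d⟩ | ⟨c, d⟩) (⟨c', d'⟩ | ⟨c', d'⟩) h
  · obtain ⟨h1, h2⟩ := hS.dvd_of_chartOne_eq h
    rw [hpr', mul_dvd_mul_iff_left (pow_ne_zero _ hp0)] at h2
    rw [Fin.ext (PadicInt.natCast_inj_of_dvd c.2 c'.2 h1),
      Fin.ext (PadicInt.natCast_inj_of_dvd d.2 d'.2 h2)]
  · exact (hne _ _ h).elim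
  · exact (hne _ _ h.symm).elim
  · obtain ⟨h1, h2⟩ := hS.dvd_of_chartTwo_eq h
    rw [hpr, ← mul_sub, mul_dvd_mul_iff_left hp0] at h1
    rw [hpr, ← mul_sub, ← mul_assoc, hpε, mul_dvd_mul_iff_left hp0] at h2
    rw [Fin.ext (PadicInt.natCast_inj_of_dvd c.2 c'.2 h1),
      Fin.ext (PadicInt.natCast_inj_of_dvd d.2 d'.2 h2)]

lemma IsAnisotropicSplitting.range_chart (hS : IsAnisotropicSplitting P α β γ ε) {r : ℕ}
    (hr : r ≠ 0) (hε : ε ≤ 1) :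
    Set.range (anisotropicChart P α β γ ε r) = localCoincident P r := by
  have hp0 : (p : ℤ_[p]) ≠ 0 := PadicInt.prime_p.ne_zero
  have hpε : (p : ℤ_[p]) ^ ε * p ^ (1 - ε) = p := by
    rw [← pow_add, Nat.add_sub_cancel' hε, pow_one]
  have hpr : (p : ℤ_[p]) ^ r = p * p ^ (r - 1) := by
    rw [← pow_succ', Nat.sub_add_cancel (Nat.one_le_iff_ne_zero.2 hr)]
  have hpr' : (p : ℤ_[p]) ^ r = p ^ ε * p ^ (r - ε) := by
    rw [← pow_add]; congr 1; omega
  refine Set.Subset.antisymm ?_ fun D hD => ?_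
  · rintro _ ⟨s | s, rfl⟩
    · exact hS.chartOne_mem r _ _
    · exact hS.chartTwo_mem r _ _
  obtain ⟨x, e, rfl, he⟩ := hS.exists_eq_functionalLattice hr hD
  have hvec : ∀ v : Fin 4 → ℤ_[p], v = ![v 0, v 1, v 2, v 3] := fun v => by
    ext i; fin_cases i <;> rfl
  have hx : (p : ℤ_[p]) ∣ rootQ (P x) :=
    (dvd_pow_self _ hr).trans (hD.2 x r fun y hy => hy)
  -- One of the two hyperbolic coordinates is a unit, since otherwise the functional would vanish
  -- modulo `p`, against its value one at `e`.
  by_cases h0 : (p : ℤ_[p]) ∣ x 0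
  · have hx1 : IsUnit (x 1) := by
      rw [PadicInt.isUnit_iff_not_dvd]
      intro h1
      have h2 := hS.dvd_rootB_sub h0 hx e
      rw [dvd_sub_left (h1.mul_right _)] at h2
      have h3 := dvd_sub h2 ((dvd_pow_self (p : ℤ_[p]) hr).trans he)
      exact PadicInt.prime_p.not_isUnit (isUnit_of_dvd_one (by convert h3 using 1; ring))
    obtain ⟨w, hw⟩ := hx1.exists_left_inv
    have hwu : IsUnit w := IsUnit.of_mul_eq_one _ hw
    rw [hS.rootQ_eq, dvd_add_right (h0.mul_right _)] at hx
    obtain ⟨⟨c, hc⟩, hd⟩ := hS.anisotropic _ _ hx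
    obtain ⟨d, hd⟩ : (p : ℤ_[p]) ^ (1 - ε) ∣ x 3 := by
      refine (mul_dvd_mul_iff_left (pow_ne_zero ε hp0)).1 ?_
      rwa [hpε]
    rw [← functionalLattice_smul hwu, hvec (w • x)] at hD ⊢
    have h1 : (w • x) 1 = 1 := hw
    rw [h1] at hD ⊢
    obtain ⟨m, hm, m', hm'⟩ := PadicInt.exists_nat_add (w * c) (r - 1)
    obtain ⟨n, hn, n', hn'⟩ := PadicInt.exists_nat_add (w * d) (r - 1)
    refine ⟨.inr (⟨m, hm⟩, ⟨n, hn⟩), (hS.eq_chartTwo hD ?_ ?_).symm⟩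
    · simp only [Pi.smul_apply, smul_eq_mul, hc]
      exact ⟨m', by rw [hpr]; linear_combination (p : ℤ_[p]) * hm'⟩
    · simp only [Pi.smul_apply, smul_eq_mul, hd]
      exact ⟨n', by
        rw [hpr]
        linear_combination (p : ℤ_[p]) * hn' + (w * d - n) * hpε⟩
  · obtain ⟨w, hw⟩ := (PadicInt.isUnit_iff_not_dvd.2 h0).exists_left_inv
    have hwu : IsUnit w := IsUnit.of_mul_eq_one _ hw
    rw [← functionalLattice_smul hwu, hvec (w • x)] at hD ⊢
    have h1 : (w • x) 0 = 1 := hw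
    rw [h1] at hD ⊢
    obtain ⟨m, hm, m', hm'⟩ := PadicInt.exists_nat_add ((w • x) 2) r
    obtain ⟨n, hn, n', hn'⟩ := PadicInt.exists_nat_add ((w • x) 3) (r - ε)
    refine ⟨.inl (⟨m, hm⟩, ⟨n, hn⟩), (hS.eq_chartOne hD ?_ ?_).symm⟩
    · exact ⟨m', by rw [hm']; ring⟩
    · exact ⟨n', by rw [hpr', hn']; ring⟩

/-- In the first chart the last coordinate matters modulo `p ^ (r - ε)` only. In the second,
isotropy modulo `p` makes the last two coordinates divisible by `p` and `p ^ (1 - ε)`, which leaves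
`p ^ (r - 1)` choices for each. -/
theorem IsAnisotropicSplitting.ncard_coincidentOfIndex (hS : IsAnisotropicSplitting P α β γ ε)
    {r : ℕ} (hr : r ≠ 0) (hε : ε ≤ 1) : (coincidentOfIndex (p ^ r)).ncard =
      p ^ r * p ^ (r - ε) + p ^ (r - 1) * p ^ (r - 1) := by
  rw [ncard_coincidentOfIndex_prime_pow P, ← hS.range_chart hr hε,
    ← Nat.card_coe_set_eq, Nat.card_range_of_injective (hS.chart_injective hr hε)]
  simp

theorem ncard_coincidentOfIndex_pm_two (h : p ≡ 2 [MOD 5] ∨ p ≡ 3 [MOD 5]) {r : ℕ} (hr : 1 ≤ r) :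
    (coincidentOfIndex (p ^ r)).ncard = (p ^ 2 + 1) * p ^ (2 * r - 2) := by
  obtain ⟨P, α, β, γ, hS⟩ := exists_anisotropic_splitting_of_pm_two h
  rw [hS.ncard_coincidentOfIndex (Nat.one_le_iff_ne_zero.1 hr) (by norm_num)]
  obtain ⟨k, rfl⟩ := Nat.exists_eq_add_of_le' hr
  rw [show 2 * (k + 1) - 2 = 2 * k by omega, Nat.add_sub_cancel, Nat.sub_zero]
  ring

theorem ncard_coincidentOfIndex_five {r : ℕ} (hr : 1 ≤ r) :
    (coincidentOfIndex (5 ^ r)).ncard = 6 * 5 ^ (2 * r - 2) := by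
  have : Fact (Nat.Prime 5) := ⟨Nat.prime_five⟩
  obtain ⟨P, α, β, γ, hS⟩ := exists_anisotropic_splitting_five
  rw [hS.ncard_coincidentOfIndex (Nat.one_le_iff_ne_zero.1 hr) le_rfl]
  obtain ⟨k, rfl⟩ := Nat.exists_eq_add_of_le' hr
  rw [show 2 * (k + 1) - 2 = 2 * k by omega, Nat.add_sub_cancel]
  ring

end Anisotropic

/-! ## Counting for the primes where the form is the determinant -/

section RowLattice

variable {p : ℕ} [hp : Fact p.Prime]

/-- The determinant of two vectors in the plane. -/
def planeDet {R : Type*} [CommRing R] (u v : R × R) : R := u.1 * v.2 - u.2 * v.1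

/-- A vector that can be completed to a unimodular matrix. -/
def IsPrimitivePair (u : ℤ_[p] × ℤ_[p]) : Prop := ∃ v, planeDet u v = 1

/-- The product of two vectors, an isotropic vector for the determinant form. -/
noncomputable def planeTensor (u t : ℤ_[p] × ℤ_[p]) : Fin 4 → ℤ_[p] :=
  ![u.1 * t.1, u.2 * t.2, u.1 * t.2, u.2 * t.1]

/-- The first entry of the product of a row vector with a matrix. -/
noncomputable def rowOne (u : ℤ_[p] × ℤ_[p]) (w : Fin 4 → ℤ_[p]) : ℤ_[p] := u.1 * w 1 - u.2 * w 2

/-- The second entry of the product of a row vector with a matrix. -/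
noncomputable def rowTwo (u : ℤ_[p] × ℤ_[p]) (w : Fin 4 → ℤ_[p]) : ℤ_[p] := u.2 * w 0 - u.1 * w 3

/-- The lattice of matrices subject to conditions on one combination of their rows. -/
def rowLattice (u t : ℤ_[p] × ℤ_[p]) (a b : ℕ) : Submodule ℤ_[p] (Fin 4 → ℤ_[p]) where
  carrier := {w | (p : ℤ_[p]) ^ b ∣ rowOne u w ∧ (p : ℤ_[p]) ^ b ∣ rowTwo u w ∧
    (p : ℤ_[p]) ^ a ∣ t.1 * rowOne u w + t.2 * rowTwo u w}
  zero_mem' := by simp [rowOne, rowTwo]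
  add_mem' := by
    rintro v w ⟨h1, h2, h3⟩ ⟨h1', h2', h3'⟩
    refine ⟨?_, ?_, ?_⟩
    · convert dvd_add h1 h1' using 1; simp only [rowOne, Pi.add_apply]; ring
    · convert dvd_add h2 h2' using 1; simp only [rowTwo, Pi.add_apply]; ring
    · convert dvd_add h3 h3' using 1; simp only [rowOne, rowTwo, Pi.add_apply]; ring
  smul_mem' := by
    rintro c v ⟨h1, h2, h3⟩
    refine ⟨?_, ?_, ?_⟩
    · convert h1.mul_left c using 1; simp only [rowOne, Pi.smul_apply, smul_eq_mul]; ring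
    · convert h2.mul_left c using 1; simp only [rowTwo, Pi.smul_apply, smul_eq_mul]; ring
    · convert h3.mul_left c using 1
      simp only [rowOne, rowTwo, Pi.smul_apply, smul_eq_mul]; ring

lemma mem_rowLattice {u t : ℤ_[p] × ℤ_[p]} {a b : ℕ} {w : Fin 4 → ℤ_[p]} :
    w ∈ rowLattice u t a b ↔ (p : ℤ_[p]) ^ b ∣ rowOne u w ∧ (p : ℤ_[p]) ^ b ∣ rowTwo u w ∧
      (p : ℤ_[p]) ^ a ∣ t.1 * rowOne u w + t.2 * rowTwo u w := Iff.rfl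

lemma exists_row_eq {u : ℤ_[p] × ℤ_[p]} (hu : IsPrimitivePair u) (m n : ℤ_[p]) :
    ∃ w, rowOne u w = m ∧ rowTwo u w = n := by
  obtain ⟨v, hv⟩ := hu
  rw [planeDet] at hv
  refine ⟨![-v.1 * n, v.2 * m, v.1 * m, -v.2 * n], ?_, ?_⟩
  · simp only [rowOne, Matrix.cons_val]; linear_combination m * hv
  · simp only [rowTwo, Matrix.cons_val]; linear_combination n * hv

/-- Passing to the unimodular basis `t, s` exhibits the elementary divisors `p ^ a` and `p ^ b`. -/
lemma mem_rowLattice_iff_of_planeDet {u t s : ℤ_[p] × ℤ_[p]} (hs : planeDet t s = 1) {a b : ℕ}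
    (hab : b ≤ a) {w : Fin 4 → ℤ_[p]} :
    w ∈ rowLattice u t a b ↔ (p : ℤ_[p]) ^ a ∣ t.1 * rowOne u w + t.2 * rowTwo u w ∧
      (p : ℤ_[p]) ^ b ∣ s.1 * rowOne u w + s.2 * rowTwo u w := by
  rw [planeDet] at hs
  rw [mem_rowLattice]
  constructor
  · rintro ⟨h1, h2, h3⟩
    exact ⟨h3, dvd_add (h1.mul_left _) (h2.mul_left _)⟩
  · rintro ⟨h1, h2⟩
    have h3 := (pow_dvd_pow (p : ℤ_[p]) hab).trans h1
    refine ⟨?_, ?_, h1⟩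
    · convert dvd_sub (h3.mul_left s.2) (h2.mul_left t.2) using 1
      linear_combination -rowOne u w * hs
    · convert dvd_sub (h2.mul_left t.1) (h3.mul_left s.1) using 1
      linear_combination -rowTwo u w * hs

lemma rowLattice_index {u t : ℤ_[p] × ℤ_[p]} (hu : IsPrimitivePair u) (ht : IsPrimitivePair t)
    {a b : ℕ} (hab : b ≤ a) : (rowLattice u t a b).toAddSubgroup.index = p ^ (a + b) := by
  obtain ⟨s, hs⟩ := ht
  have : NeZero (p ^ a) := ⟨pow_ne_zero _ hp.out.ne_zero⟩
  have : NeZero (p ^ b) := ⟨pow_ne_zero _ hp.out.ne_zero⟩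
  let f : (Fin 4 → ℤ_[p]) →+ ZMod (p ^ a) × ZMod (p ^ b) :=
    { toFun := fun w => (PadicInt.toZModPow a (t.1 * rowOne u w + t.2 * rowTwo u w),
        PadicInt.toZModPow b (s.1 * rowOne u w + s.2 * rowTwo u w))
      map_zero' := by simp [rowOne, rowTwo]
      map_add' := fun v w => by
        rw [Prod.mk_add_mk, ← map_add, ← map_add]
        simp only [rowOne, rowTwo, Pi.add_apply]
        congr 2 <;> ring }
  have hf : Function.Surjective f := by
    rintro ⟨m, n⟩
    obtain ⟨m, rfl⟩ := ZMod.ringHom_surjective (PadicInt.toZModPow (p := p) a) m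
    obtain ⟨n, rfl⟩ := ZMod.ringHom_surjective (PadicInt.toZModPow (p := p) b) n
    obtain ⟨w, h1, h2⟩ := exists_row_eq hu (s.2 * m - t.2 * n) (t.1 * n - s.1 * m)
    refine ⟨w, ?_⟩
    rw [planeDet] at hs
    change (_, _) = _
    rw [h1, h2]
    congr 2
    · linear_combination m * hs
    · linear_combination n * hs
  have hk : (rowLattice u t a b).toAddSubgroup = f.ker := by
    ext w
    rw [AddMonoidHom.mem_ker]
    change w ∈ rowLattice u t a b ↔ (_, _) = ((0 : ZMod (p ^ a)), (0 : ZMod (p ^ b)))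
    rw [Prod.mk.injEq, PadicInt.toZModPow_eq_zero_iff, PadicInt.toZModPow_eq_zero_iff,
      mem_rowLattice_iff_of_planeDet hs hab]
  rw [hk, AddSubgroup.index_ker, AddMonoidHom.range_eq_top.2 hf]
  simp [pow_add]

lemma IsPrimitivePair.dvd_of_mul {u : ℤ_[p] × ℤ_[p]} (hu : IsPrimitivePair u) {m x : ℤ_[p]}
    (h1 : m ∣ u.1 * x) (h2 : m ∣ u.2 * x) : m ∣ x := by
  obtain ⟨v, hv⟩ := hu
  rw [planeDet] at hv
  convert dvd_sub (h1.mul_left v.2) (h2.mul_left v.1) using 1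
  linear_combination -x * hv

lemma IsPrimitivePair.eq_add {u v : ℤ_[p] × ℤ_[p]} (hv : planeDet u v = 1) (w : ℤ_[p] × ℤ_[p]) :
    w = (planeDet w v * u.1 + planeDet u w * v.1, planeDet w v * u.2 + planeDet u w * v.2) := by
  rw [planeDet] at hv
  ext
  · simp only [planeDet]; linear_combination -w.1 * hv
  · simp only [planeDet]; linear_combination -w.2 * hv

/-- Modulo `p ^ a` the vector `u'` is a multiple of `u`, and `t'` is a multiple of `t` modulo `p ^
(a - b)`. The missing factor `p ^ b` is supplied by the lattice. -/
lemma rowLattice_le {u t u' t' : ℤ_[p] × ℤ_[p]} (hu : IsPrimitivePair u) (ht : IsPrimitivePair t)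
    {a b : ℕ} (hab : b ≤ a) (h : (p : ℤ_[p]) ^ a ∣ planeDet u u')
    (h' : (p : ℤ_[p]) ^ (a - b) ∣ planeDet t t') :
    rowLattice u t a b ≤ rowLattice u' t' a b := by
  obtain ⟨v, hv⟩ := hu
  obtain ⟨s, hs⟩ := ht
  intro w hw
  have h0 := (pow_dvd_pow (p : ℤ_[p]) hab).trans h
  obtain ⟨h3, h4⟩ := (mem_rowLattice_iff_of_planeDet hs hab).1 hw
  obtain ⟨h1, h2, -⟩ := hw
  have e1 : rowOne u' w = planeDet u' v * rowOne u w + planeDet u u' * rowOne v w := by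
    conv_lhs => rw [IsPrimitivePair.eq_add hv u']
    simp only [rowOne]; ring
  have e2 : rowTwo u' w = planeDet u' v * rowTwo u w + planeDet u u' * rowTwo v w := by
    conv_lhs => rw [IsPrimitivePair.eq_add hv u']
    simp only [rowTwo]; ring
  refine ⟨?_, ?_, ?_⟩
  · rw [e1]; exact dvd_add (h1.mul_left _) (h0.mul_right _)
  · rw [e2]; exact dvd_add (h2.mul_left _) (h0.mul_right _)
  · have h5 := mul_dvd_mul h' h4
    rw [← pow_add, Nat.sub_add_cancel hab] at h5
    have h6 := dvd_add (dvd_add (h3.mul_left (planeDet u' v * planeDet t' s))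
      (h5.mul_left (planeDet u' v)))
      (h.mul_right (t'.1 * rowOne v w + t'.2 * rowTwo v w))
    convert h6 using 1
    rw [e1, e2]
    have e3 : t'.1 = _ := congrArg Prod.fst (IsPrimitivePair.eq_add hs t')
    have e4 : t'.2 = _ := congrArg Prod.snd (IsPrimitivePair.eq_add hs t')
    simp only at e3 e4
    linear_combination (planeDet u' v * rowOne u w) * e3 + (planeDet u' v * rowTwo u w) * e4

lemma planeDet_swap {R : Type*} [CommRing R] (u v : R × R) : planeDet u v = -planeDet v u := by
  simp only [planeDet]; ring

lemma rowLattice_congr {u t u' t' : ℤ_[p] × ℤ_[p]} (hu : IsPrimitivePair u)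
    (ht : IsPrimitivePair t) (hu' : IsPrimitivePair u') (ht' : IsPrimitivePair t')
    {a b : ℕ} (hab : b ≤ a) (h : (p : ℤ_[p]) ^ a ∣ planeDet u u')
    (h' : (p : ℤ_[p]) ^ (a - b) ∣ planeDet t t') :
    rowLattice u t a b = rowLattice u' t' a b :=
  le_antisymm (rowLattice_le hu ht hab h h') (rowLattice_le hu' ht' hab
    (by rwa [planeDet_swap, dvd_neg]) (by rwa [planeDet_swap, dvd_neg]))

end RowLattice

/-! ### Row and column lattices of the determinant form -/

section DetForm

variable {p : ℕ} [hp : Fact p.Prime] {P : (Fin 4 → ℤ_[p]) ≃ₗ[ℤ_[p]] (Fin 4 → ℤ_[p])}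

lemma rootB_det (hP : ∀ v, rootQ (P v) = v 0 * v 1 - v 2 * v 3) (v w : Fin 4 → ℤ_[p]) :
    rootB (P v) (P w) = v 0 * w 1 + v 1 * w 0 - v 2 * w 3 - v 3 * w 2 := by
  rw [rootB_eq_of_rootQ, ← map_add, hP, hP, hP]
  simp only [Pi.add_apply]
  ring

/-- Pairing with a product `u ⊗ t` takes the `u`-combination of the rows and evaluates it on `t`;
this is why the row lattices are the ones cut out by isotropic vectors with left factor `u`. -/
lemma rootB_planeTensor (hP : ∀ v, rootQ (P v) = v 0 * v 1 - v 2 * v 3) (u t : ℤ_[p] × ℤ_[p])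
    (w : Fin 4 → ℤ_[p]) :
    rootB (P (planeTensor u t)) (P w) = t.1 * rowOne u w + t.2 * rowTwo u w := by
  rw [rootB_det hP]
  simp only [planeTensor, rowOne, rowTwo, Matrix.cons_val]
  ring

lemma planeTensor_mem_rowLattice (u t s : ℤ_[p] × ℤ_[p]) (a b : ℕ) :
    planeTensor u s ∈ rowLattice u t a b := by
  have h1 : rowOne u (planeTensor u s) = 0 := by
    simp only [planeTensor, rowOne, Matrix.cons_val]; ring
  have h2 : rowTwo u (planeTensor u s) = 0 := by
    simp only [planeTensor, rowTwo, Matrix.cons_val]; ring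
  rw [mem_rowLattice, h1, h2]
  simp

lemma smul_planeTensor_mem_rowLattice (u t v : ℤ_[p] × ℤ_[p]) (a b : ℕ) :
    (p : ℤ_[p]) ^ b • planeTensor v t ∈ rowLattice u t a b := by
  rw [mem_rowLattice]
  simp only [planeTensor, rowOne, rowTwo, Matrix.cons_val, Pi.smul_apply, smul_eq_mul]
  exact ⟨⟨planeDet u v * t.2, by rw [planeDet]; ring⟩,
    ⟨-planeDet u v * t.1, by rw [planeDet]; ring⟩, ⟨0, by ring⟩⟩

/-- The products `u ⊗ s` lie in every row lattice for `u`, and two products pair to the product of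
their plane determinants. -/
lemma dvd_planeDet_left (hP : ∀ v, rootQ (P v) = v 0 * v 1 - v 2 * v 3)
    {u t u' t' : ℤ_[p] × ℤ_[p]} {a b j : ℕ} (ht' : IsPrimitivePair t')
    (h : ∀ w ∈ rowLattice u t a b, (p : ℤ_[p]) ^ j ∣ rootB (P (planeTensor u' t')) (P w)) :
    (p : ℤ_[p]) ^ j ∣ planeDet u u' := by
  refine ht'.dvd_of_mul ?_ ?_
  · have := h _ (planeTensor_mem_rowLattice u t (0, 1) a b)
    rw [rootB_det hP] at this
    simp only [planeTensor, Matrix.cons_val] at this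
    rw [← dvd_neg]
    convert this using 1; rw [planeDet]; ring
  · have := h _ (planeTensor_mem_rowLattice u t (1, 0) a b)
    rw [rootB_det hP] at this
    simp only [planeTensor, Matrix.cons_val] at this
    convert this using 1; rw [planeDet]; ring

lemma dvd_planeDet_right (hP : ∀ v, rootQ (P v) = v 0 * v 1 - v 2 * v 3)
    {u t u' t' : ℤ_[p] × ℤ_[p]} {a b j : ℕ} (hu' : IsPrimitivePair u')
    (h : ∀ w ∈ rowLattice u t a b, (p : ℤ_[p]) ^ j ∣ rootB (P (planeTensor u' t')) (P w)) :
    (p : ℤ_[p]) ^ j ∣ p ^ b * planeDet t t' := by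
  obtain ⟨v, hv⟩ := hu'
  have := h _ (smul_planeTensor_mem_rowLattice u t v a b)
  rw [rootB_det hP] at this
  simp only [planeTensor, Matrix.cons_val, Pi.smul_apply, smul_eq_mul] at this
  rw [planeDet] at hv
  rw [← dvd_neg]
  convert this using 1
  rw [planeDet]
  linear_combination (p ^ b * (t.1 * t'.2 - t.2 * t'.1)) * hv

/-- Testing `x` on all `u ⊗ s` shows that the `u`-combination of its rows vanishes modulo `p ^ j`.
Multiplying by the adjugate gives `det(x) u ≡ 0`, and `u` is primitive. -/
lemma rowLattice_mem_localCoincident (hP : ∀ v, rootQ (P v) = v 0 * v 1 - v 2 * v 3)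
    {u t : ℤ_[p] × ℤ_[p]} (hu : IsPrimitivePair u) (ht : IsPrimitivePair t)
    {a b : ℕ} (hab : b ≤ a) : rowLattice u t a b ∈ localCoincident P (a + b) := by
  refine ⟨rowLattice_index hu ht hab, fun x j hx => ?_⟩
  have h1 := hx _ (planeTensor_mem_rowLattice u t (1, 0) a b)
  have h2 := hx _ (planeTensor_mem_rowLattice u t (0, 1) a b)
  rw [rootB_comm, rootB_planeTensor hP] at h1 h2
  simp only [rowOne, rowTwo] at h1 h2
  rw [hP]
  refine hu.dvd_of_mul ?_ ?_
  · convert dvd_add (h1.mul_left (x 0)) (h2.mul_left (x 2)) using 1; ring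
  · convert dvd_add (h1.mul_left (x 3)) (h2.mul_left (x 1)) using 1; ring

/-- The larger exponent is seen in the quotient group: `p ^ a` annihilates the quotient by the first
lattice, and some class modulo the second has order divisible by `p ^ a'`. -/
lemma le_of_rowLattice_le {u t u' t' : ℤ_[p] × ℤ_[p]} (hu' : IsPrimitivePair u')
    (ht' : IsPrimitivePair t') {a b a' b' : ℕ} (hab : b ≤ a)
    (h : rowLattice u t a b ≤ rowLattice u' t' a' b') : a' ≤ a := by
  obtain ⟨s, hs⟩ := ht'
  obtain ⟨w, h1, h2⟩ := exists_row_eq hu' s.2 (-s.1)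
  have hw : (p : ℤ_[p]) ^ a • w ∈ rowLattice u t a b := by
    have e1 : rowOne u ((p : ℤ_[p]) ^ a • w) = p ^ a * rowOne u w := by
      simp only [rowOne, Pi.smul_apply, smul_eq_mul]; ring
    have e2 : rowTwo u ((p : ℤ_[p]) ^ a • w) = p ^ a * rowTwo u w := by
      simp only [rowTwo, Pi.smul_apply, smul_eq_mul]; ring
    rw [mem_rowLattice, e1, e2]
    exact ⟨(pow_dvd_pow _ hab).mul_right _, (pow_dvd_pow _ hab).mul_right _,
      ⟨t.1 * rowOne u w + t.2 * rowTwo u w, by ring⟩⟩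
  have h3 := (h hw).2.2
  have h4 : t'.1 * rowOne u' ((p : ℤ_[p]) ^ a • w) + t'.2 * rowTwo u' ((p : ℤ_[p]) ^ a • w)
      = p ^ a := by
    simp only [rowOne, rowTwo] at h1 h2
    rw [planeDet] at hs
    simp only [rowOne, rowTwo, Pi.smul_apply, smul_eq_mul]
    linear_combination p ^ a * t'.1 * h1 + p ^ a * t'.2 * h2 + p ^ a * hs
  rw [h4] at h3
  exact (pow_dvd_pow_iff PadicInt.prime_p.ne_zero PadicInt.prime_p.not_isUnit).1 h3

/-- Transposition of matrices. -/
def planeSwap (p : ℕ) [Fact p.Prime] : (Fin 4 → ℤ_[p]) ≃ₗ[ℤ_[p]] (Fin 4 → ℤ_[p]) where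
  toFun v := ![v 0, v 1, v 3, v 2]
  map_add' v w := by ext i; fin_cases i <;> rfl
  map_smul' c w := by ext i; fin_cases i <;> rfl
  invFun v := ![v 0, v 1, v 3, v 2]
  left_inv v := by ext i; fin_cases i <;> rfl
  right_inv v := by ext i; fin_cases i <;> rfl

/-- The lattice of matrices subject to conditions on one combination of their columns. -/
noncomputable def colLattice (u t : ℤ_[p] × ℤ_[p]) (a b : ℕ) : Submodule ℤ_[p] (Fin 4 → ℤ_[p]) :=
  (rowLattice u t a b).comap (planeSwap p).toLinearMap

lemma mem_colLattice {u t : ℤ_[p] × ℤ_[p]} {a b : ℕ} {w : Fin 4 → ℤ_[p]} :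
    w ∈ colLattice u t a b ↔ planeSwap p w ∈ rowLattice u t a b := Iff.rfl

lemma planeSwap_planeSwap (v : Fin 4 → ℤ_[p]) : planeSwap p (planeSwap p v) = v :=
  (planeSwap p).left_inv v

lemma rootB_planeSwap (hP : ∀ v, rootQ (P v) = v 0 * v 1 - v 2 * v 3) (v w : Fin 4 → ℤ_[p]) :
    rootB (P (planeSwap p v)) (P w) = rootB (P v) (P (planeSwap p w)) := by
  rw [rootB_det hP, rootB_det hP]
  simp only [planeSwap, LinearEquiv.coe_mk, LinearMap.coe_mk, AddHom.coe_mk, Matrix.cons_val]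
  ring

lemma colLattice_mem_localCoincident (hP : ∀ v, rootQ (P v) = v 0 * v 1 - v 2 * v 3)
    {u t : ℤ_[p] × ℤ_[p]} (hu : IsPrimitivePair u) (ht : IsPrimitivePair t)
    {a b : ℕ} (hab : b ≤ a) : colLattice u t a b ∈ localCoincident P (a + b) := by
  obtain ⟨h1, h2⟩ := rowLattice_mem_localCoincident hP hu ht hab
  refine ⟨?_, fun x j hx => ?_⟩
  · rw [← h1]
    exact AddSubgroup.index_comap_of_surjective (rowLattice u t a b).toAddSubgroup
      (f := (planeSwap p).toLinearMap.toAddMonoidHom) (planeSwap p).surjective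
  · have h3 := h2 (planeSwap p x) j fun y hy => by
      rw [rootB_planeSwap hP]
      exact hx _ (by rwa [mem_colLattice, planeSwap_planeSwap])
    rw [hP] at h3 ⊢
    convert h3 using 1
    simp only [planeSwap, LinearEquiv.coe_mk, LinearMap.coe_mk, AddHom.coe_mk, Matrix.cons_val]
    ring

lemma colLattice_inj {u t u' t' : ℤ_[p] × ℤ_[p]} {a b a' b' : ℕ}
    (h : colLattice u t a b = colLattice u' t' a' b') :
    rowLattice u t a b = rowLattice u' t' a' b' := by
  ext w
  have := SetLike.ext_iff.1 h (planeSwap p w)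
  rwa [mem_colLattice, mem_colLattice, planeSwap_planeSwap] at this

/-- With `b' ≠ 0` the column lattice is orthogonal modulo `p` to all products with right factor
`u'`, while a row lattice is orthogonal only to products whose left factor is proportional to `u`.
For `b' = 0` the two families coincide. -/
lemma rowLattice_ne_colLattice (hP : ∀ v, rootQ (P v) = v 0 * v 1 - v 2 * v 3)
    {u t u' t' : ℤ_[p] × ℤ_[p]} (hu : IsPrimitivePair u) (hu' : IsPrimitivePair u')
    {a b a' b' : ℕ} (hb : b' ≠ 0) : rowLattice u t a b ≠ colLattice u' t' a' b' := by
  intro h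
  have key : ∀ s : ℤ_[p] × ℤ_[p], (p : ℤ_[p]) ^ 1 ∣ planeDet u s := by
    intro s
    refine dvd_planeDet_left (t' := u') (a := a) (b := b) (t := t) hP hu' fun w hw => ?_
    have h1 : planeTensor s u' = planeSwap p (planeTensor u' s) := by
      ext i; fin_cases i <;> simp [planeTensor, planeSwap, mul_comm]
    rw [h1, rootB_planeSwap hP, rootB_planeTensor hP, pow_one]
    rw [h, mem_colLattice, mem_rowLattice] at hw
    exact dvd_add (((dvd_pow_self _ hb).trans hw.1).mul_left _)
      (((dvd_pow_self _ hb).trans hw.2.1).mul_left _)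
  obtain ⟨v, hv⟩ := hu
  have := key v
  rw [hv, pow_one] at this
  exact PadicInt.prime_p.not_isUnit (isUnit_of_dvd_one this)

/-- Rigidity of the parameters of a row lattice. -/
lemma eq_of_rowLattice_eq (hP : ∀ v, rootQ (P v) = v 0 * v 1 - v 2 * v 3)
    {u t u' t' : ℤ_[p] × ℤ_[p]} (hu' : IsPrimitivePair u') (ht' : IsPrimitivePair t')
    {a b : ℕ} (hab : b ≤ a) (h : rowLattice u t a b = rowLattice u' t' a b) :
    (p : ℤ_[p]) ^ a ∣ planeDet u u' ∧ (p : ℤ_[p]) ^ (a - b) ∣ planeDet t t' := by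
  have h1 : ∀ w ∈ rowLattice u t a b,
      (p : ℤ_[p]) ^ a ∣ rootB (P (planeTensor u' t')) (P w) := by
    intro w hw
    rw [h] at hw
    rw [rootB_planeTensor hP]
    exact hw.2.2
  refine ⟨dvd_planeDet_left hP ht' h1, ?_⟩
  have h2 := dvd_planeDet_right hP hu' h1
  rwa [show (p : ℤ_[p]) ^ a = p ^ b * p ^ (a - b) by rw [← pow_add, Nat.add_sub_cancel' hab],
    mul_dvd_mul_iff_left (pow_ne_zero _ PadicInt.prime_p.ne_zero)] at h2

end DetForm

/-! ### Classification for split primes -/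

section Classification

variable {p : ℕ} [hp : Fact p.Prime] {P : (Fin 4 → ℤ_[p]) ≃ₗ[ℤ_[p]] (Fin 4 → ℤ_[p])}

/-- The polar form of the determinant. -/
def detPolar {R : Type*} [CommRing R] (v w : Fin 4 → R) : R :=
  v 0 * w 1 + v 1 * w 0 - v 2 * w 3 - v 3 * w 2

/-- Isometric coordinates adapted to a pair of primitive vectors. -/
lemma exists_frame (hP : ∀ v, rootQ (P v) = v 0 * v 1 - v 2 * v 3) {u t : ℤ_[p] × ℤ_[p]}
    (hu : IsPrimitivePair u) (ht : IsPrimitivePair t) :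
    ∃ g : (Fin 4 → ℤ_[p]) → (Fin 4 → ℤ_[p]),
      (∀ v w, rootB (P v) (P w) = detPolar (g v) (g w)) ∧
      (∀ v, rootQ (P v) = g v 0 * g v 1 - g v 2 * g v 3) ∧
      (∀ w, rootB (P (planeTensor u t)) (P w) = g w 1) ∧
      (∀ a b w, b ≤ a → (w ∈ rowLattice u t a b ↔
        (p : ℤ_[p]) ^ a ∣ g w 1 ∧ (p : ℤ_[p]) ^ b ∣ g w 3)) ∧
      (∀ a b w, b ≤ a → (w ∈ colLattice t u a b ↔
        (p : ℤ_[p]) ^ a ∣ g w 1 ∧ (p : ℤ_[p]) ^ b ∣ g w 2)) := by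
  obtain ⟨v, hv⟩ := hu
  obtain ⟨s, hs⟩ := ht
  have hv' := hv
  have hs' := hs
  rw [planeDet] at hv' hs'
  -- Matrix coordinates in the bases `u, v` and `t, s`. Both have determinant one, so the form keeps
  -- its shape.
  refine ⟨fun w => ![s.1 * rowOne v w + s.2 * rowTwo v w, t.1 * rowOne u w + t.2 * rowTwo u w,
    -(t.1 * rowOne v w + t.2 * rowTwo v w), -(s.1 * rowOne u w + s.2 * rowTwo u w)],
    fun x y => ?_, fun x => ?_, fun w => ?_, fun a b w hab => ?_, fun a b w hab => ?_⟩
  · rw [rootB_det hP]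
    have : planeDet u v * planeDet t s * (x 0 * y 1 + x 1 * y 0 - x 2 * y 3 - x 3 * y 2) =
      x 0 * y 1 + x 1 * y 0 - x 2 * y 3 - x 3 * y 2 := by rw [hv, hs]; ring
    rw [← this]
    simp only [detPolar, planeDet, rowOne, rowTwo, Matrix.cons_val]
    ring
  · rw [hP]
    have : planeDet u v * planeDet t s * (x 0 * x 1 - x 2 * x 3) = x 0 * x 1 - x 2 * x 3 := by
      rw [hv, hs]; ring
    rw [← this]
    simp only [planeDet, rowOne, rowTwo, Matrix.cons_val]
    ring
  · rw [rootB_planeTensor hP]; rfl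
  · rw [mem_rowLattice_iff_of_planeDet hs hab]
    simp only [Matrix.cons_val, dvd_neg]
  · rw [mem_colLattice, mem_rowLattice_iff_of_planeDet hv hab]
    simp only [Matrix.cons_val, dvd_neg]
    have e : ∀ u' t' : ℤ_[p] × ℤ_[p], u'.1 * rowOne t' (planeSwap p w) +
        u'.2 * rowTwo t' (planeSwap p w) = t'.1 * rowOne u' w + t'.2 * rowTwo u' w := by
      intro u' t'
      simp only [rowOne, rowTwo, planeSwap, LinearEquiv.coe_mk, LinearMap.coe_mk, AddHom.coe_mk,
        Matrix.cons_val]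
      ring
    rw [e, e]

lemma isPrimitivePair_one_left (s : ℤ_[p]) : IsPrimitivePair ((1, s) : ℤ_[p] × ℤ_[p]) :=
  ⟨(0, 1), by simp [planeDet]⟩

lemma isPrimitivePair_one_right (s : ℤ_[p]) : IsPrimitivePair ((s, 1) : ℤ_[p] × ℤ_[p]) :=
  ⟨(-1, 0), by simp [planeDet]⟩

/-- A primitive vector that is isotropic modulo `p ^ a` is a product modulo `p ^ a`. -/
lemma exists_planeTensor {x : Fin 4 → ℤ_[p]} {a : ℕ}
    (hQ : (p : ℤ_[p]) ^ a ∣ x 0 * x 1 - x 2 * x 3) (hx : ∃ i, IsUnit (x i)) :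
    ∃ u t l, IsPrimitivePair u ∧ IsPrimitivePair t ∧ IsUnit l ∧
      ∀ i, (p : ℤ_[p]) ^ a ∣ x i - l * planeTensor u t i := by
  obtain ⟨i, hi⟩ := hx
  obtain ⟨w, hw⟩ := hi.exists_left_inv
  have z : ∀ y : ℤ_[p], y = 0 → (p : ℤ_[p]) ^ a ∣ y := fun y hy => hy ▸ dvd_zero _
  -- After division by the unit entry, three coordinates of the product agree exactly and isotropy
  -- gives the fourth modulo `p ^ a`.
  fin_cases i
  · change w * x 0 = 1 at hw
    refine ⟨(1, w * x 3), (1, w * x 2), x 0, isPrimitivePair_one_left _,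
      isPrimitivePair_one_left _, hi, fun i => ?_⟩
    fin_cases i <;> simp only [planeTensor, Fin.reduceFinMk, Matrix.cons_val]
    · exact z _ (by simp)
    · convert hQ.mul_left w using 1
      linear_combination (w * x 2 * x 3 * -1) * hw - x 1 * hw
    · exact z _ (by linear_combination -x 2 * hw)
    · exact z _ (by linear_combination -x 3 * hw)
  · change w * x 1 = 1 at hw
    refine ⟨(w * x 2, 1), (w * x 3, 1), x 1, isPrimitivePair_one_right _,
      isPrimitivePair_one_right _, hi, fun i => ?_⟩
    fin_cases i <;> simp only [planeTensor, Fin.reduceFinMk, Matrix.cons_val]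
    · convert hQ.mul_left w using 1
      linear_combination (w * x 2 * x 3 * -1) * hw - x 0 * hw
    · exact z _ (by simp)
    · exact z _ (by linear_combination -x 2 * hw)
    · exact z _ (by linear_combination -x 3 * hw)
  · change w * x 2 = 1 at hw
    refine ⟨(1, w * x 1), (w * x 0, 1), x 2, isPrimitivePair_one_left _,
      isPrimitivePair_one_right _, hi, fun i => ?_⟩
    fin_cases i <;> simp only [planeTensor, Fin.reduceFinMk, Matrix.cons_val]
    · exact z _ (by linear_combination -x 0 * hw)
    · exact z _ (by linear_combination -x 1 * hw)
    · exact z _ (by simp)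
    · convert hQ.mul_left (-w) using 1
      linear_combination (w * x 0 * x 1 * -1) * hw - x 3 * hw
  · change w * x 3 = 1 at hw
    refine ⟨(w * x 0, 1), (1, w * x 1), x 3, isPrimitivePair_one_right _,
      isPrimitivePair_one_left _, hi, fun i => ?_⟩
    fin_cases i <;> simp only [planeTensor, Fin.reduceFinMk, Matrix.cons_val]
    · exact z _ (by linear_combination -x 0 * hw)
    · exact z _ (by linear_combination -x 1 * hw)
    · convert hQ.mul_left (-w) using 1
      linear_combination (w * x 0 * x 1 * -1) * hw - x 2 * hw
    · exact z _ (by simp)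

/-- The description of a locally coincident lattice with two nontrivial divisors in an adapted
frame. -/
lemma frame_classification {r : ℕ} {D : Submodule ℤ_[p] (Fin 4 → ℤ_[p])}
    (hD : D ∈ localCoincident P r) {e x : Fin 4 → Fin 4 → ℤ_[p]} {a : Fin 4 → ℕ}
    (h1 : ∀ i j, (p : ℤ_[p]) ^ a i ∣ rootB (P (x i)) (P (e j)) - if i = j then 1 else 0)
    (h2 : ∀ y, y ∈ D ↔ ∀ i, (p : ℤ_[p]) ^ a i ∣ rootB (P (x i)) (P y)) (h3 : ∑ i, a i = r)
    {g : (Fin 4 → ℤ_[p]) → (Fin 4 → ℤ_[p])}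
    (hg : ∀ v w, rootB (P v) (P w) = detPolar (g v) (g w))
    (hgQ : ∀ v, rootQ (P v) = g v 0 * g v 1 - g v 2 * g v 3)
    {i k : Fin 4} (hik : i ≠ k) (hk0 : a k ≠ 0) (hki : a k ≤ a i)
    (hgi : ∀ w (j : ℕ), j ≤ a i →
      ((p : ℤ_[p]) ^ j ∣ rootB (P (x i)) (P w) ↔ (p : ℤ_[p]) ^ j ∣ g w 1))
    (hX : ¬ (p : ℤ_[p]) ∣ g (x k) 2) :
    a i + a k = r ∧ ∀ w, w ∈ D ↔ (p : ℤ_[p]) ^ a i ∣ g w 1 ∧ (p : ℤ_[p]) ^ a k ∣ g w 3 := by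
  have hpp := PadicInt.prime_p (p := p)
  have hu : IsUnit (g (x k) 2) := PadicInt.isUnit_iff_not_dvd.2 hX
  have hX1 : (p : ℤ_[p]) ^ a k ∣ g (x k) 1 :=
    (hgi _ _ hki).1 (dvd_rootB_divisors hD h2 hki le_rfl)
  have hX3 : (p : ℤ_[p]) ^ a k ∣ g (x k) 3 := by
    have := dvd_rootQ_divisor hD h2 k
    rw [hgQ, dvd_sub_right (hX1.mul_left _), hu.dvd_mul_left] at this
    exact this
  have key : ∀ w (j : ℕ), j ≤ a k → (p : ℤ_[p]) ^ j ∣ g w 1 →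
      ((p : ℤ_[p]) ^ j ∣ rootB (P (x k)) (P w) ↔ (p : ℤ_[p]) ^ j ∣ g w 3) := by
    intro w j hj hw
    have hj' := pow_dvd_pow (p : ℤ_[p]) hj
    rw [hg, detPolar, dvd_sub_left ((hj'.trans hX3).mul_right _),
      dvd_sub_right (dvd_add (hw.mul_left _) ((hj'.trans hX1).mul_right _)), hu.dvd_mul_left]
  -- A third nontrivial divisor is impossible: in this frame both `x l` and its dual vector `e l`
  -- would have the coordinates `1` and `3` divisible by `p`, so their pairing would not be one.
  have ha : ∀ l, l ≠ i → l ≠ k → a l = 0 := by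
    intro l hli hlk
    by_contra hl0
    have hl1 : 1 ≤ a l := Nat.one_le_iff_ne_zero.2 hl0
    have hk1 : 1 ≤ a k := Nat.one_le_iff_ne_zero.2 hk0
    have y1 : (p : ℤ_[p]) ^ 1 ∣ g (x l) 1 :=
      (hgi _ _ (hk1.trans hki)).1 (dvd_rootB_divisors hD h2 (hk1.trans hki) hl1)
    have y3 : (p : ℤ_[p]) ^ 1 ∣ g (x l) 3 :=
      (key _ _ hk1 y1).1 (dvd_rootB_divisors hD h2 hk1 hl1)
    have k1 : (p : ℤ_[p]) ^ 1 ∣ g (e l) 1 := by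
      refine (hgi _ _ (hk1.trans hki)).1 ((pow_dvd_pow _ (hk1.trans hki)).trans ?_)
      simpa [hli.symm] using h1 i l
    have k3 : (p : ℤ_[p]) ^ 1 ∣ g (e l) 3 := by
      refine (key _ _ hk1 k1).1 ((pow_dvd_pow _ hk1).trans ?_)
      simpa [hlk.symm] using h1 k l
    have h5 := (pow_dvd_pow (p : ℤ_[p]) hl1).trans (h1 l l)
    rw [if_pos rfl, hg, detPolar] at h5
    have h6 := dvd_sub (dvd_sub (dvd_add (k1.mul_left (g (x l) 0)) (y1.mul_right (g (e l) 0)))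
      (k3.mul_left (g (x l) 2))) (y3.mul_right (g (e l) 2))
    have h7 := dvd_sub h6 h5
    rw [pow_one] at h7
    exact hpp.not_isUnit (isUnit_of_dvd_one (by convert h7 using 1; ring))
  refine ⟨?_, fun w => ?_⟩
  · rw [← h3, ← Finset.sum_subset (Finset.subset_univ {i, k}), Finset.sum_pair hik]
    intro l _ hl
    simp only [Finset.mem_insert, Finset.mem_singleton, not_or] at hl
    exact ha l hl.1 hl.2
  · rw [h2]
    constructor
    · intro h
      have h4 := (hgi w _ le_rfl).1 (h i)
      exact ⟨h4, (key w _ le_rfl ((pow_dvd_pow _ hki).trans h4)).1 (h k)⟩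
    · rintro ⟨h4, h5⟩ l
      by_cases hli : l = i
      · subst hli; exact (hgi w _ le_rfl).2 h4
      · by_cases hlk : l = k
        · subst hlk; exact (key w _ le_rfl ((pow_dvd_pow _ hki).trans h4)).2 h5
        · rw [ha l hli hlk, pow_zero]; exact one_dvd _

/-- The largest divisor gives an isotropic vector `u ⊗ t`. Modulo `p` exactly two maximal isotropic
planes contain it, the products with left factor `u` and those with right factor `t`. The second
divisor selects one of them, that is, rows or columns. -/
lemma eq_row_or_col (hP : ∀ v, rootQ (P v) = v 0 * v 1 - v 2 * v 3) {r : ℕ}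
    {D : Submodule ℤ_[p] (Fin 4 → ℤ_[p])} (hD : D ∈ localCoincident P r) :
    ∃ u t b, IsPrimitivePair u ∧ IsPrimitivePair t ∧ 2 * b ≤ r ∧
      (D = rowLattice u t (r - b) b ∨ b ≠ 0 ∧ D = colLattice u t (r - b) b) := by
  have hpp := PadicInt.prime_p (p := p)
  obtain ⟨e, x, a, h1, h2, h3⟩ := exists_local_divisors hD
  obtain ⟨i, -, hi⟩ := Finset.exists_max_image Finset.univ a ⟨0, Finset.mem_univ _⟩
  obtain ⟨k, hk, hkmax⟩ := Finset.exists_max_image (Finset.univ.erase i) a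
    ⟨i + 1, by simp⟩
  have hki : k ≠ i := (Finset.mem_erase.1 hk).1
  have hle : a k ≤ a i := hi k (Finset.mem_univ _)
  by_cases hi0 : a i = 0
  · have ha : ∀ l, a l = 0 := fun l => Nat.le_zero.1 (hi0 ▸ hi l (Finset.mem_univ _))
    obtain rfl : r = 0 := by rw [← h3]; simp [ha]
    refine ⟨(1, 0), (1, 0), 0, isPrimitivePair_one_left _, isPrimitivePair_one_left _, by simp,
      Or.inl ?_⟩
    ext w
    simp [h2, ha, mem_rowLattice]
  have hprim : ∃ l, IsUnit (x i l) := by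
    by_contra! h
    simp only [PadicInt.isUnit_iff_not_dvd, not_not] at h
    have h4 := (dvd_pow_self (p : ℤ_[p]) hi0).trans (h1 i i)
    rw [if_pos rfl, rootB_det hP] at h4
    have h5 := dvd_sub (dvd_sub (dvd_sub (dvd_add ((h 0).mul_right (e i 1))
      ((h 1).mul_right (e i 0))) ((h 2).mul_right (e i 3))) ((h 3).mul_right (e i 2))) h4
    exact hpp.not_isUnit (isUnit_of_dvd_one (by convert h5 using 1; ring))
  have hQ := dvd_rootQ_divisor hD h2 i
  rw [hP] at hQ
  obtain ⟨u, t, l, hu, ht, hl, hx⟩ := exists_planeTensor hQ hprim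
  obtain ⟨g, hg, hgQ, hg1, hrow, hcol⟩ := exists_frame hP hu ht
  have hgi : ∀ w (j : ℕ), j ≤ a i →
      ((p : ℤ_[p]) ^ j ∣ rootB (P (x i)) (P w) ↔ (p : ℤ_[p]) ^ j ∣ g w 1) := by
    intro w j hj
    have h4 : (p : ℤ_[p]) ^ j ∣ rootB (P (x i)) (P w) - l * g w 1 := by
      refine (pow_dvd_pow _ hj).trans ?_
      rw [← hg1, rootB_det hP, rootB_det hP]
      convert dvd_sub (dvd_sub (dvd_add ((hx 0).mul_right (w 1)) ((hx 1).mul_right (w 0)))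
        ((hx 2).mul_right (w 3))) ((hx 3).mul_right (w 2)) using 1
      ring
    rw [← hl.dvd_mul_left (a := (p : ℤ_[p]) ^ j) (b := g w 1)]
    exact dvd_iff_dvd_of_dvd_sub h4
  by_cases hk0 : a k = 0
  · have ha : ∀ m, m ≠ i → a m = 0 := fun m hm =>
      Nat.le_zero.1 (hk0 ▸ hkmax m (Finset.mem_erase.2 ⟨hm, Finset.mem_univ _⟩))
    have hai : a i = r := by
      rw [← h3, Finset.sum_eq_single i (fun m _ hm => ha m hm) (by simp)]
    refine ⟨u, t, 0, hu, ht, by simp, Or.inl ?_⟩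
    ext w
    rw [h2, hrow _ _ _ (Nat.zero_le _), Nat.sub_zero, ← hai, ← hgi w _ le_rfl]
    refine ⟨fun h => ⟨h i, by simp⟩, fun h m => ?_⟩
    by_cases hm : m = i
    · subst hm; exact h.1
    · rw [ha m hm, pow_zero]; exact one_dvd _
  by_cases hX : (p : ℤ_[p]) ∣ g (x k) 2
  · have hX' : ¬ (p : ℤ_[p]) ∣ g (x k) 3 := by
      intro hX'
      have hk1 : 1 ≤ a k := Nat.one_le_iff_ne_zero.2 hk0
      have m1 : (p : ℤ_[p]) ^ 1 ∣ g (x k) 1 :=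
        (hgi _ _ (hk1.trans hle)).1 (dvd_rootB_divisors hD h2 (hk1.trans hle) hk1)
      have m2 : (p : ℤ_[p]) ^ 1 ∣ g (e k) 1 := by
        refine (hgi _ _ (hk1.trans hle)).1 ((pow_dvd_pow _ (hk1.trans hle)).trans ?_)
        simpa [hki.symm] using h1 i k
      have h5 := (pow_dvd_pow (p : ℤ_[p]) hk1).trans (h1 k k)
      rw [if_pos rfl, hg, detPolar] at h5
      rw [pow_one] at m1 m2 h5
      have h6 := dvd_sub (dvd_sub (dvd_add (m2.mul_left (g (x k) 0)) (m1.mul_right (g (e k) 0)))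
        (hX.mul_right (g (e k) 3))) (hX'.mul_right (g (e k) 2))
      have h7 := dvd_sub h6 h5
      exact hpp.not_isUnit (isUnit_of_dvd_one (by convert h7 using 1; ring))
    obtain ⟨hr, hmem⟩ := frame_classification hD h1 h2 h3
      (g := fun v => planeSwap p (g v)) (fun v w => by
        rw [hg]; simp only [detPolar, planeSwap, LinearEquiv.coe_mk, LinearMap.coe_mk,
          AddHom.coe_mk, Matrix.cons_val]; ring)
      (fun v => by
        rw [hgQ]; simp only [planeSwap, LinearEquiv.coe_mk, LinearMap.coe_mk,
          AddHom.coe_mk, Matrix.cons_val]; ring) hki.symm hk0 hle hgi hX'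
    refine ⟨t, u, a k, ht, hu, by omega, Or.inr ⟨hk0, ?_⟩⟩
    rw [show r - a k = a i by omega]
    ext w
    rw [hmem, hcol _ _ _ hle]
    rfl
  · obtain ⟨hr, hmem⟩ := frame_classification hD h1 h2 h3 hg hgQ hki.symm hk0 hle hgi hX
    refine ⟨u, t, a k, hu, ht, by omega, Or.inl ?_⟩
    rw [show r - a k = a i by omega]
    ext w
    rw [hmem, hrow _ _ _ hle]

end Classification

/-! ### Counting parameters on projective lines -/

section SplitCount

variable {p : ℕ} [hp : Fact p.Prime]

/-- The number of points of the projective line over `ℤ / p ^ k`. -/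
def projCount (p k : ℕ) : ℕ := p ^ k + if k = 0 then 0 else p ^ (k - 1)

/-- The points of the projective line over `ℤ / p ^ k`. -/
abbrev ProjPoint (p k : ℕ) : Type := Fin (p ^ k) ⊕ Fin (if k = 0 then 0 else p ^ (k - 1))

/-- Primitive representatives of the points of the projective line. -/
noncomputable def ProjPoint.rep {k : ℕ} : ProjPoint p k → ℤ_[p] × ℤ_[p]
  | .inl s => (1, (s : ℕ))
  | .inr s => (p * (s : ℕ), 1)

lemma ProjPoint.isPrimitivePair_rep {k : ℕ} (s : ProjPoint p k) :
    IsPrimitivePair (ProjPoint.rep s) := by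
  rcases s with s | s
  · exact isPrimitivePair_one_left _
  · exact isPrimitivePair_one_right _

lemma ProjPoint.rep_inj {k : ℕ} {s s' : ProjPoint p k}
    (h : (p : ℤ_[p]) ^ k ∣ planeDet (ProjPoint.rep s) (ProjPoint.rep s')) : s = s' := by
  have hpp := PadicInt.prime_p (p := p)
  have hk : ∀ s : Fin (if k = 0 then 0 else p ^ (k - 1)), k ≠ 0 ∧ (s : ℕ) < p ^ (k - 1) := by
    intro s
    have hs := s.2
    split_ifs at hs with hk
    · exact absurd hs (Nat.not_lt_zero _)
    · exact ⟨hk, hs⟩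
  rcases s with s | s <;> rcases s' with s' | s' <;>
    simp only [ProjPoint.rep, planeDet] at h
  · rw [Fin.ext (PadicInt.natCast_inj_of_dvd s'.2 s.2 (by convert h using 1; ring))]
  · have h1 := (dvd_pow_self (p : ℤ_[p]) (hk s').1).trans h
    have h2 := dvd_add h1 (dvd_mul_right (p : ℤ_[p]) (s * s'))
    exact (hpp.not_isUnit (isUnit_of_dvd_one (by convert h2 using 1; ring))).elim
  · have h1 := (dvd_pow_self (p : ℤ_[p]) (hk s).1).trans h
    have h2 := dvd_sub (dvd_mul_right (p : ℤ_[p]) (s * s')) h1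
    exact (hpp.not_isUnit (isUnit_of_dvd_one (by convert h2 using 1; ring))).elim
  · obtain ⟨hk0, hs⟩ := hk s
    have h1 : (p : ℤ_[p]) ^ k = p * p ^ (k - 1) := by
      rw [← pow_succ', Nat.sub_add_cancel (Nat.one_le_iff_ne_zero.2 hk0)]
    have h2 : (p : ℤ_[p]) * p ^ (k - 1) ∣ p * ((s : ℕ) - (s' : ℕ)) := by
      rw [← h1]; convert h using 1; ring
    rw [Fin.ext (PadicInt.natCast_inj_of_dvd hs (hk s').2
      ((mul_dvd_mul_iff_left hpp.ne_zero).1 h2))]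

lemma ProjPoint.exists_rep {u : ℤ_[p] × ℤ_[p]} (hu : IsPrimitivePair u) (k : ℕ) :
    ∃ s : ProjPoint p k, (p : ℤ_[p]) ^ k ∣ planeDet u (ProjPoint.rep s) := by
  have hpp := PadicInt.prime_p (p := p)
  rcases eq_or_ne k 0 with rfl | hk
  · exact ⟨.inl 0, by simp⟩
  by_cases h1 : (p : ℤ_[p]) ∣ u.1
  · have h2 : IsUnit u.2 := by
      rw [PadicInt.isUnit_iff_not_dvd]
      intro h2
      obtain ⟨v, hv⟩ := hu
      rw [planeDet] at hv
      exact hpp.not_isUnit (isUnit_of_dvd_one (hv ▸ dvd_sub (h1.mul_right _) (h2.mul_right _)))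
    obtain ⟨w, hw⟩ := h2.exists_left_inv
    obtain ⟨c, hc⟩ := h1
    obtain ⟨n, hn, d, hd⟩ := PadicInt.exists_nat_add (w * c) (k - 1)
    refine ⟨.inr ⟨n, by rwa [if_neg hk]⟩, u.2 * d, ?_⟩
    have h3 : (p : ℤ_[p]) ^ k = p * p ^ (k - 1) := by
      rw [← pow_succ', Nat.sub_add_cancel (Nat.one_le_iff_ne_zero.2 hk)]
    simp only [ProjPoint.rep, planeDet, h3]
    linear_combination hc + p * u.2 * hd - p * c * hw
  · obtain ⟨w, hw⟩ := (PadicInt.isUnit_iff_not_dvd.2 h1).exists_left_inv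
    obtain ⟨n, hn, d, hd⟩ := PadicInt.exists_nat_add (w * u.2) k
    refine ⟨.inl ⟨n, hn⟩, -u.1 * d, ?_⟩
    simp only [ProjPoint.rep, planeDet]
    linear_combination u.2 * hw - u.1 * hd

/-- The parameters of the locally coincident lattices for the determinant form. -/
abbrev SplitIndex (p r : ℕ) : Type :=
  (Σ b : Fin (r / 2 + 1), ProjPoint p (r - b) × ProjPoint p (r - b - b)) ⊕
    (Σ b : Fin (r / 2), ProjPoint p (r - (b + 1)) × ProjPoint p (r - (b + 1) - (b + 1)))

/-- The parametrisation of the locally coincident lattices for the determinant form. -/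
noncomputable def splitChart (p r : ℕ) [Fact p.Prime] :
    SplitIndex p r → Submodule ℤ_[p] (Fin 4 → ℤ_[p])
  | .inl s => rowLattice s.2.1.rep s.2.2.rep (r - s.1) s.1
  | .inr s => colLattice s.2.1.rep s.2.2.rep (r - (s.1 + 1)) (s.1 + 1)

variable {P : (Fin 4 → ℤ_[p]) ≃ₗ[ℤ_[p]] (Fin 4 → ℤ_[p])}

/-- The exponent `r - b` is an invariant of the lattice by `le_of_rowLattice_le`, applied in both
directions. -/
lemma exponent_eq_of_rowLattice_eq {u t u' t' : ℤ_[p] × ℤ_[p]} (hu : IsPrimitivePair u)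
    (ht : IsPrimitivePair t) (hu' : IsPrimitivePair u') (ht' : IsPrimitivePair t') {r b b' : ℕ}
    (hb : 2 * b ≤ r) (hb' : 2 * b' ≤ r)
    (h : rowLattice u t (r - b) b = rowLattice u' t' (r - b') b') : b = b' := by
  have h1 := le_of_rowLattice_le hu' ht' (by omega) h.le
  have h2 := le_of_rowLattice_le hu ht (by omega) h.ge
  omega

lemma splitChart_injective (hP : ∀ v, rootQ (P v) = v 0 * v 1 - v 2 * v 3) (r : ℕ) :
    Function.Injective (splitChart p r) := by
  rintro (⟨b, s, t⟩ | ⟨b, s, t⟩) (⟨b', s', t'⟩ | ⟨b', s', t'⟩) h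
  · change rowLattice _ _ _ _ = rowLattice _ _ _ _ at h
    obtain rfl : b = b' := Fin.ext (exponent_eq_of_rowLattice_eq s.isPrimitivePair_rep
      t.isPrimitivePair_rep s'.isPrimitivePair_rep t'.isPrimitivePair_rep (by omega) (by omega) h)
    obtain ⟨h1, h2⟩ := eq_of_rowLattice_eq hP s'.isPrimitivePair_rep t'.isPrimitivePair_rep
      (by omega) h
    obtain rfl : s = s' := ProjPoint.rep_inj h1
    obtain rfl : t = t' := ProjPoint.rep_inj h2
    rfl
  · exact (rowLattice_ne_colLattice hP s.isPrimitivePair_rep s'.isPrimitivePair_rep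
      (Nat.succ_ne_zero _) h).elim
  · exact (rowLattice_ne_colLattice hP s'.isPrimitivePair_rep s.isPrimitivePair_rep
      (Nat.succ_ne_zero _) h.symm).elim
  · change colLattice _ _ _ _ = colLattice _ _ _ _ at h
    replace h := colLattice_inj h
    have hb := exponent_eq_of_rowLattice_eq s.isPrimitivePair_rep
      t.isPrimitivePair_rep s'.isPrimitivePair_rep t'.isPrimitivePair_rep (by omega) (by omega) h
    obtain rfl : b = b' := Fin.ext (by simpa using hb)
    obtain ⟨h1, h2⟩ := eq_of_rowLattice_eq hP s'.isPrimitivePair_rep t'.isPrimitivePair_rep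
      (by omega) h
    obtain rfl : s = s' := ProjPoint.rep_inj h1
    obtain rfl : t = t' := ProjPoint.rep_inj h2
    rfl

lemma range_splitChart (hP : ∀ v, rootQ (P v) = v 0 * v 1 - v 2 * v 3) (r : ℕ) :
    Set.range (splitChart p r) = localCoincident P r := by
  refine Set.Subset.antisymm ?_ fun D hD => ?_
  · rintro _ ⟨⟨b, s, t⟩ | ⟨b, s, t⟩, rfl⟩
    · have := rowLattice_mem_localCoincident hP s.isPrimitivePair_rep t.isPrimitivePair_rep
        (a := r - b) (b := b) (by omega)
      rwa [Nat.sub_add_cancel (by omega)] at this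
    · have := colLattice_mem_localCoincident hP s.isPrimitivePair_rep t.isPrimitivePair_rep
        (a := r - (b + 1)) (b := b + 1) (by omega)
      rwa [Nat.sub_add_cancel (by omega)] at this
  · obtain ⟨u, t, b, hu, ht, hb, h⟩ := eq_row_or_col hP hD
    obtain ⟨s, hs⟩ := ProjPoint.exists_rep hu (r - b)
    obtain ⟨s', hs'⟩ := ProjPoint.exists_rep ht (r - b - b)
    have e := rowLattice_congr hu ht s.isPrimitivePair_rep s'.isPrimitivePair_rep
      (by omega) hs hs'
    rcases h with rfl | ⟨hb0, rfl⟩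
    · exact ⟨.inl ⟨⟨b, by omega⟩, s, s'⟩, e.symm⟩
    · obtain ⟨b, rfl⟩ := Nat.exists_eq_succ_of_ne_zero hb0
      refine ⟨.inr ⟨⟨b, by omega⟩, s, s'⟩, ?_⟩
      change colLattice _ _ _ _ = _
      rw [colLattice, colLattice, ← e]

/-- The contribution of the noncyclic lattices to the count for a split prime. -/
def splitSum (p r : ℕ) : ℕ :=
  ∑ b ∈ Finset.range (r / 2), projCount p (r - (b + 1)) * projCount p (r - (b + 1) - (b + 1))

/-- The term `b = 0` occurs once and is a square; for `b ≥ 1` rows and columns contribute equally,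
which explains the factor two. -/
lemma ncard_coincidentOfIndex_split (h : p ≡ 1 [MOD 5] ∨ p ≡ 4 [MOD 5]) (r : ℕ) :
    (coincidentOfIndex (p ^ r)).ncard = projCount p r ^ 2 + 2 * splitSum p r := by
  obtain ⟨P, hP⟩ := exists_det_splitting h
  rw [ncard_coincidentOfIndex_prime_pow P, ← range_splitChart hP r,
    ← Nat.card_coe_set_eq, Nat.card_range_of_injective (splitChart_injective hP r),
    Nat.card_eq_fintype_card, Fintype.card_sum, Fintype.card_sigma, Fintype.card_sigma]
  simp only [Fintype.card_prod, Fintype.card_sum, Fintype.card_fin]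
  change ∑ b : Fin (r / 2 + 1), projCount p (r - b) * projCount p (r - b - b) +
    ∑ b : Fin (r / 2), projCount p (r - (b + 1)) * projCount p (r - (b + 1) - (b + 1)) = _
  rw [Fin.sum_univ_eq_sum_range (fun b => projCount p (r - b) * projCount p (r - b - b)),
    Fin.sum_univ_eq_sum_range
      (fun b => projCount p (r - (b + 1)) * projCount p (r - (b + 1) - (b + 1))),
    Finset.sum_range_succ']
  simp only [splitSum, Nat.sub_zero]
  ring

lemma projCount_succ_succ (p k : ℕ) : projCount p (k + 2) = p * projCount p (k + 1) := by
  simp [projCount]; ring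

/-- The first term is split off. In each of the others the first factor is `p` times its counterpart
for `r` and the second is unchanged. -/
lemma splitSum_add_two (p r : ℕ) :
    splitSum p (r + 2) = projCount p (r + 1) * projCount p r + p * splitSum p r := by
  rw [splitSum, splitSum, show (r + 2) / 2 = r / 2 + 1 by omega, Finset.sum_range_succ',
    Finset.mul_sum, add_comm]
  congr 1
  refine Finset.sum_congr rfl fun b hb => ?_
  rw [Finset.mem_range] at hb
  obtain ⟨m, hm⟩ : ∃ m, r - (b + 1) = m + 1 := ⟨r - (b + 1) - 1, by omega⟩
  rw [show r + 2 - (b + 1 + 1) = m + 2 by omega, show m + 2 - (b + 1 + 1) = m + 1 - (b + 1) by omega,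
    hm, projCount_succ_succ, mul_assoc]

/-- Solution of the recursion `splitSum_add_two` with the denominator `p ^ 3 - 1` cleared. -/
lemma splitSum_odd (p m : ℕ) : (splitSum p (2 * m + 1) : ℚ) * ((p : ℚ) ^ 3 - 1) =
    ((p : ℚ) + 1) ^ 2 * (p : ℚ) ^ m * ((p : ℚ) ^ (3 * m) - 1) := by
  induction m with
  | zero => simp [splitSum]
  | succ m ih =>
    rw [show 2 * (m + 1) + 1 = 2 * m + 1 + 2 by ring, splitSum_add_two]
    simp only [projCount, Nat.add_eq_zero_iff, one_ne_zero, and_false, if_false,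
      Nat.add_sub_cancel]
    push_cast
    linear_combination (p : ℚ) * ih

lemma splitSum_even (p m : ℕ) : (splitSum p (2 * m + 2) : ℚ) * ((p : ℚ) ^ 3 - 1) =
    ((p : ℚ) + 1) ^ 2 * (p : ℚ) ^ (4 * m + 2)
      - ((p : ℚ) + 1) * ((p : ℚ) ^ 2 + 1) * (p : ℚ) ^ m := by
  induction m with
  | zero => simp [splitSum, projCount]; ring
  | succ m ih =>
    rw [show 2 * (m + 1) + 2 = 2 * m + 2 + 2 by ring, splitSum_add_two]
    rw [show 2 * m + 2 = 2 * m + 1 + 1 by ring] at ih ⊢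
    simp only [projCount, Nat.add_eq_zero_iff, one_ne_zero, and_false, if_false,
      Nat.add_sub_cancel]
    push_cast
    linear_combination (p : ℚ) * ih

theorem ncard_coincidentOfIndex_pm_one_odd (h : p ≡ 1 [MOD 5] ∨ p ≡ 4 [MOD 5]) {r : ℕ}
    (hr : Odd r) :
    ((coincidentOfIndex (p ^ r)).ncard : ℚ) = ((p : ℚ) + 1) ^ 2 / ((p : ℚ) ^ 3 - 1) *
        ((p : ℚ) ^ (2 * r + 1) + (p : ℚ) ^ (2 * r - 2) - 2 * (p : ℚ) ^ ((r - 1) / 2)) := by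
  obtain ⟨m, rfl⟩ := hr
  have hp1 : (1 : ℚ) < p := by exact_mod_cast hp.out.one_lt
  have hp3 : (p : ℚ) ^ 3 - 1 ≠ 0 := (sub_pos.2 (one_lt_pow₀ hp1 (by norm_num))).ne'
  rw [ncard_coincidentOfIndex_split h, show (2 * m + 1 - 1) / 2 = m by omega,
    show 2 * (2 * m + 1) - 2 = 4 * m by omega]
  push_cast
  have hs : (splitSum p (2 * m + 1) : ℚ) = _ := eq_div_of_mul_eq hp3 (splitSum_odd p m)
  rw [hs]
  simp only [projCount, Nat.add_eq_zero_iff, one_ne_zero, and_false, if_false,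
      Nat.add_sub_cancel]
  push_cast
  field_simp
  ring

theorem ncard_coincidentOfIndex_pm_one_even (h : p ≡ 1 [MOD 5] ∨ p ≡ 4 [MOD 5]) {r : ℕ}
    (hr0 : 1 ≤ r) (hr : Even r) :
    ((coincidentOfIndex (p ^ r)).ncard : ℚ) = ((p : ℚ) + 1) ^ 2 / ((p : ℚ) ^ 3 - 1) *
        ((p : ℚ) ^ (2 * r + 1) + (p : ℚ) ^ (2 * r - 2)
          - 2 * (((p : ℚ) ^ 2 + 1) / ((p : ℚ) + 1)) * (p : ℚ) ^ ((r - 2) / 2)) := by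
  obtain ⟨m, rfl⟩ := hr
  obtain ⟨m, rfl⟩ : ∃ n, m = n + 1 := ⟨m - 1, by omega⟩
  have hp1 : (1 : ℚ) < p := by exact_mod_cast hp.out.one_lt
  have hp3 : (p : ℚ) ^ 3 - 1 ≠ 0 := (sub_pos.2 (one_lt_pow₀ hp1 (by norm_num))).ne'
  have hp2 : (p : ℚ) + 1 ≠ 0 := by positivity
  rw [ncard_coincidentOfIndex_split h, show (m + 1 + (m + 1) - 2) / 2 = m by omega,
    show 2 * (m + 1 + (m + 1)) - 2 = 4 * m + 2 by omega,
    show m + 1 + (m + 1) = 2 * m + 2 by ring]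
  push_cast
  have hs : (splitSum p (2 * m + 2) : ℚ) = _ := eq_div_of_mul_eq hp3 (splitSum_even p m)
  rw [hs, show 2 * m + 2 = 2 * m + 1 + 1 by ring]
  simp only [projCount, Nat.add_eq_zero_iff, one_ne_zero, and_false, if_false,
      Nat.add_sub_cancel]
  push_cast
  field_simp
  ring

end SplitCount

/-! ## The Dirichlet series -/

section Dirichlet

/-- The number of coincidence site lattices of index `n`. -/
noncomputable def coincidentCount (n : ℕ) : ℕ := (coincidentOfIndex n).ncard

lemma coincidentCount_one : coincidentCount 1 = 1 := by
  rw [coincidentCount, coincidentOfIndex_one, Set.ncard_singleton]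

lemma coincidentCount_mul {m n : ℕ} (hm : m ≠ 0) (hn : n ≠ 0) (h : m.Coprime n) :
    coincidentCount (m * n) = coincidentCount m * coincidentCount n :=
  ncard_coincidentOfIndex_mul hm hn h

lemma coincidentCount_five_pow_succ (k : ℕ) : coincidentCount (5 ^ (k + 1)) = 6 * 25 ^ k := by
  rw [coincidentCount, ncard_coincidentOfIndex_five (by omega),
    show 2 * (k + 1) - 2 = 2 * k by omega, pow_mul]
  norm_num

lemma coincidentCount_pm_two_pow_succ {p : ℕ} (hp : p.Prime) (h : p ≡ 2 [MOD 5] ∨ p ≡ 3 [MOD 5])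
    (k : ℕ) : coincidentCount (p ^ (k + 1)) = (p ^ 2 + 1) * (p ^ 2) ^ k := by
  have : Fact p.Prime := ⟨hp⟩
  rw [coincidentCount, ncard_coincidentOfIndex_pm_two h (by omega),
    show 2 * (k + 1) - 2 = 2 * k by omega, pow_mul]

lemma coincidentCount_pm_one_pow {p : ℕ} (hp : p.Prime) (h : p ≡ 1 [MOD 5] ∨ p ≡ 4 [MOD 5])
    (r : ℕ) : coincidentCount (p ^ r) = projCount p r ^ 2 + 2 * splitSum p r := by
  have : Fact p.Prime := ⟨hp⟩
  exact ncard_coincidentOfIndex_split h r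

lemma Nat.Prime.mod_five_cases {p : ℕ} (hp : p.Prime) :
    p = 5 ∨ (p ≡ 1 [MOD 5] ∨ p ≡ 4 [MOD 5]) ∨ (p ≡ 2 [MOD 5] ∨ p ≡ 3 [MOD 5]) := by
  by_cases h : p % 5 = 0
  · exact Or.inl ((Nat.prime_dvd_prime_iff_eq Nat.prime_five hp).1 (Nat.dvd_of_mod_eq_zero h)).symm
  · right
    simp only [Nat.ModEq]
    omega

lemma projCount_le (p k : ℕ) (hp : 0 < p) : projCount p k ≤ 2 * p ^ k := by
  have : (if k = 0 then 0 else p ^ (k - 1)) ≤ p ^ k := by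
    split_ifs
    · exact Nat.zero_le _
    · exact Nat.pow_le_pow_right hp (Nat.sub_le _ _)
  rw [projCount]
  omega

lemma splitSum_le {p : ℕ} (hp : 2 ≤ p) : ∀ r, splitSum p r ≤ p ^ (2 * r)
  | 0 => by simp [splitSum]
  | 1 => by simp [splitSum]
  | r + 2 => by
    have ih := splitSum_le hp r
    have h1 := projCount_le p (r + 1) (by omega)
    have h2 := projCount_le p r (by omega)
    rw [splitSum_add_two]
    calc projCount p (r + 1) * projCount p r + p * splitSum p r
        ≤ (2 * p ^ (r + 1)) * (2 * p ^ r) + p * p ^ (2 * r) := by gcongr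
      _ = 5 * p * p ^ (2 * r) := by ring
      _ ≤ p ^ 4 * p ^ (2 * r) := by
          gcongr
          have : 2 ^ 3 ≤ p ^ 3 := Nat.pow_le_pow_left hp 3
          nlinarith
      _ = p ^ (2 * (r + 2)) := by ring

/-- The constant comes from split primes: `(p + 1) ^ 2 ≤ 2 p ^ 2` for `p ≥ 3`, plus twice the bound
`splitSum_le`. -/
lemma coincidentCount_prime_pow_le {p : ℕ} (hp : p.Prime) (k : ℕ) :
    coincidentCount (p ^ (k + 1)) ≤ 4 * (p ^ (k + 1)) ^ 2 := by
  rcases hp.mod_five_cases with rfl | h | h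
  · rw [coincidentCount_five_pow_succ, ← pow_mul, show (k + 1) * 2 = 2 * k + 2 by ring, pow_add,
      pow_mul]
    norm_num
    omega
  · rw [coincidentCount_pm_one_pow hp h]
    have h3 : 3 ≤ p := by
      have := hp.two_le
      rcases h with h | h <;> simp only [Nat.ModEq] at h <;> omega
    have h1 := splitSum_le hp.two_le (k + 1)
    have h2 : projCount p (k + 1) ^ 2 ≤ 2 * (p ^ (k + 1)) ^ 2 := by
      have : projCount p (k + 1) = p ^ k * (p + 1) := by simp [projCount]; ring
      rw [this, mul_pow, pow_succ p k, mul_pow (p ^ k) p]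
      have : (p + 1) ^ 2 ≤ 2 * p ^ 2 := by nlinarith
      nlinarith [Nat.zero_le ((p ^ k) ^ 2)]
    rw [mul_comm, pow_mul] at h1
    omega
  · rw [coincidentCount_pm_two_pow_succ hp h, ← pow_mul, ← pow_mul,
      show (k + 1) * 2 = 2 * k + 2 by ring, pow_add]
    have : 1 ≤ p ^ 2 := Nat.one_le_pow _ _ hp.pos
    nlinarith [Nat.zero_le (p ^ (2 * k))]

/-- Only the factorisations `1 * n` and `n * 1` are kept. -/
lemma ArithmeticFunction.two_mul_le_mul_self (g : ArithmeticFunction ℕ) {n : ℕ} (hn : 1 < n) :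
    2 * (g 1 * g n) ≤ (g * g) n := by
  rw [ArithmeticFunction.mul_apply]
  have h1 : ({(1, n), (n, 1)} : Finset (ℕ × ℕ)) ⊆ n.divisorsAntidiagonal := by
    intro x hx
    simp only [Finset.mem_insert, Finset.mem_singleton] at hx
    rw [Nat.mem_divisorsAntidiagonal]
    rcases hx with rfl | rfl <;> simp <;> omega
  refine le_trans (le_of_eq ?_) (Finset.sum_le_sum_of_subset h1)
  rw [Finset.sum_pair (by simp; omega)]
  ring

/-- A multiplicative majorant of the number of coincidence site lattices. -/
noncomputable def countMajorant : ArithmeticFunction ℕ :=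
  (ArithmeticFunction.pow 2 * ArithmeticFunction.pow 2) *
    (ArithmeticFunction.pow 2 * ArithmeticFunction.pow 2)

lemma isMultiplicative_countMajorant : countMajorant.IsMultiplicative :=
  (ArithmeticFunction.isMultiplicative_pow.mul ArithmeticFunction.isMultiplicative_pow).mul
    (ArithmeticFunction.isMultiplicative_pow.mul ArithmeticFunction.isMultiplicative_pow)

/-- The constant `4` accumulates with the number of prime factors, so it must be absorbed into a
multiplicative function; each of the two squarings under convolution gains a factor two. -/
lemma four_mul_sq_le_countMajorant {n : ℕ} (hn : 1 < n) : 4 * n ^ 2 ≤ countMajorant n := by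
  have h1 := ArithmeticFunction.two_mul_le_mul_self (ArithmeticFunction.pow 2) hn
  have h2 := ArithmeticFunction.two_mul_le_mul_self
    (ArithmeticFunction.pow 2 * ArithmeticFunction.pow 2) hn
  rw [ArithmeticFunction.mul_apply_one] at h2
  simp only [ArithmeticFunction.pow_apply, OfNat.ofNat_ne_zero, false_and, if_false] at h1 h2
  rw [countMajorant]
  linarith

lemma coincidentCount_le {n : ℕ} (hn : n ≠ 0) : coincidentCount n ≤ countMajorant n := by
  induction n using Nat.recOnPosPrimePosCoprime with
  | zero => exact absurd rfl hn
  | one => rw [coincidentCount_one, isMultiplicative_countMajorant.1]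
  | prime_pow p k hp hk =>
    obtain ⟨k, rfl⟩ := Nat.exists_eq_add_of_le' hk
    exact (coincidentCount_prime_pow_le hp k).trans
      (four_mul_sq_le_countMajorant (Nat.one_lt_pow (Nat.succ_ne_zero k) hp.one_lt))
  | coprime a b ha hb hab iha ihb =>
    rw [coincidentCount_mul (by omega) (by omega) hab,
      isMultiplicative_countMajorant.map_mul_of_coprime hab]
    exact Nat.mul_le_mul (iha (by omega)) (ihb (by omega))

/-- The series of `n ^ 2` converges absolutely for `Re s > 3`, and so do its Dirichlet convolutions.
-/
lemma LSeriesSummable_coincidentCount {s : ℂ} (hs : 3 < s.re) :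
    LSeriesSummable (fun n => (coincidentCount n : ℂ)) s := by
  have h1 : LSeriesSummable
      (fun n => ((ArithmeticFunction.pow 2 : ArithmeticFunction ℕ) : ArithmeticFunction ℂ) n) s := by
    refine LSeriesSummable_of_le_const_mul_rpow hs ⟨1, fun n _ => ?_⟩
    norm_num [ArithmeticFunction.natCoe_apply]
  have h2 := ArithmeticFunction.LSeriesSummable_mul h1 h1
  have h3 := ArithmeticFunction.LSeriesSummable_mul h2 h2
  refine Summable.of_norm_bounded h3.norm fun n => ?_
  rcases eq_or_ne n 0 with rfl | hn
  · simp
  refine LSeries.norm_term_le s ?_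
  rw [← ArithmeticFunction.natCoe_mul, ← ArithmeticFunction.natCoe_mul,
    ArithmeticFunction.natCoe_apply, Complex.norm_natCast, Complex.norm_natCast]
  exact_mod_cast coincidentCount_le hn

end Dirichlet

/-! ### Local factors and the Euler product -/

section EulerProduct

lemma natCast_pow_cpow (p e : ℕ) (s : ℂ) : ((p ^ e : ℕ) : ℂ) ^ s = ((p : ℂ) ^ s) ^ e := by
  induction e with
  | zero => simp
  | succ e ih =>
    rw [pow_succ, Nat.cast_mul, Complex.natCast_mul_natCast_cpow, ih, pow_succ]

lemma term_prime_pow {p : ℕ} (hp : p.Prime) (s : ℂ) (f : ℕ → ℂ) (e : ℕ) :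
    LSeries.term f s (p ^ e) = f (p ^ e) * ((p : ℂ) ^ (-s)) ^ e := by
  rw [LSeries.term_of_ne_zero (pow_ne_zero _ hp.ne_zero), natCast_pow_cpow, Complex.cpow_neg,
    inv_pow, div_eq_mul_inv]

lemma HasSum.of_succ {f : ℕ → ℂ} {a : ℂ} (h : HasSum (fun n => f (n + 1)) a) :
    HasSum f (f 0 + a) := by
  have := (hasSum_nat_add_iff 1).1 h
  simpa [add_comm] using this

lemma hasSum_geometric_shift {q x : ℂ} (h : ‖q * x‖ < 1) (k : ℂ) :
    HasSum (fun e : ℕ => k * q ^ e * x ^ (e + 1)) (k * x / (1 - q * x)) := by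
  have := (hasSum_geometric_of_norm_lt_one h).mul_left (k * x)
  rw [← div_eq_mul_inv] at this
  refine this.congr_fun fun e => ?_
  rw [mul_pow]; ring

lemma one_sub_ne_zero_of_norm_lt_one {z : ℂ} (h : ‖z‖ < 1) : 1 - z ≠ 0 := by
  intro h0
  rw [← sub_eq_zero.1 h0] at h
  simp at h

section Factor

variable {p : ℕ} {s : ℂ}

lemma cpow_two_sub (hp : p.Prime) : (p : ℂ) ^ (2 - s) = p ^ 2 * (p : ℂ) ^ (-s) := by
  rw [sub_eq_add_neg, Complex.cpow_add _ _ (by exact_mod_cast hp.ne_zero), Complex.cpow_ofNat]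

lemma cpow_one_sub_nat_mul (hp : p.Prime) (k : ℕ) :
    (p : ℂ) ^ (1 - (k : ℂ) * s) = p * ((p : ℂ) ^ (-s)) ^ k := by
  rw [sub_eq_add_neg, Complex.cpow_add _ _ (by exact_mod_cast hp.ne_zero), Complex.cpow_one,
    ← Complex.cpow_nat_mul, mul_neg]

lemma norm_sq_mul_cpow_lt_one (hp : p.Prime) (hs : 3 < s.re) :
    ‖(p : ℂ) ^ 2 * (p : ℂ) ^ (-s)‖ < 1 := by
  rw [← cpow_two_sub hp, Complex.norm_natCast_cpow_of_pos hp.pos]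
  refine Real.rpow_lt_one_of_one_lt_of_neg (by exact_mod_cast hp.one_lt) ?_
  simp only [Complex.sub_re, Complex.re_ofNat]
  linarith

lemma norm_mul_cpow_sq_lt_one (hp : p.Prime) (hs : 3 < s.re) :
    ‖(p : ℂ) * ((p : ℂ) ^ (-s)) ^ 2‖ < 1 := by
  rw [← cpow_one_sub_nat_mul hp, Complex.norm_natCast_cpow_of_pos hp.pos]
  refine Real.rpow_lt_one_of_one_lt_of_neg (by exact_mod_cast hp.one_lt) ?_
  simp
  linarith

/-- The sum over the powers of one prime. -/
noncomputable def localFactor (s : ℂ) (p : ℕ) : ℂ :=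
  ∑' e, LSeries.term (fun n => (coincidentCount n : ℂ)) s (p ^ e)

lemma localFactor_five (hs : 3 < s.re) : localFactor s 5 = eulerFactorFive s := by
  have hp := Nat.prime_five
  have h1 := hasSum_geometric_shift (q := 25) (x := (5 : ℂ) ^ (-s))
    (by have := norm_sq_mul_cpow_lt_one hp hs; norm_num at this ⊢; exact this) 6
  have h2 := HasSum.of_succ (f := fun e =>
    LSeries.term (fun n => (coincidentCount n : ℂ)) s (5 ^ e)) (a := _) (by
      convert h1 using 2 with e
      rw [term_prime_pow hp, coincidentCount_five_pow_succ]
      push_cast; rfl)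
  rw [localFactor, h2.tsum_eq, eulerFactorFive]
  have h3 := cpow_two_sub (s := s) hp
  norm_num at h3
  rw [h3, pow_zero, LSeries.term_of_ne_zero one_ne_zero, coincidentCount_one]
  simp
  ring

lemma localFactor_pmTwo (hp : p.Prime) (h : p ≡ 2 [MOD 5] ∨ p ≡ 3 [MOD 5]) (hs : 3 < s.re) :
    localFactor s p = eulerFactorPmTwo p s := by
  have hq := norm_sq_mul_cpow_lt_one hp hs
  have h1 := hasSum_geometric_shift hq ((p : ℂ) ^ 2 + 1)
  have h2 := HasSum.of_succ (f := fun e =>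
    LSeries.term (fun n => (coincidentCount n : ℂ)) s (p ^ e)) (a := _) (by
      convert h1 using 2 with e
      rw [term_prime_pow hp, coincidentCount_pm_two_pow_succ hp h]
      push_cast; rfl)
  rw [localFactor, h2.tsum_eq, eulerFactorPmTwo, cpow_two_sub hp, pow_zero,
    LSeries.term_of_ne_zero one_ne_zero, coincidentCount_one]
  have := one_sub_ne_zero_of_norm_lt_one hq
  simp only [Nat.cast_one, Complex.one_cpow]
  field_simp
  ring

/-- The factor is summed from the recursion for `splitSum` and not from the closed formulas, so no
distinction by the parity of the exponent is needed. -/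
lemma localFactor_pmOne (hp : p.Prime) (h : p ≡ 1 [MOD 5] ∨ p ≡ 4 [MOD 5]) (hs : 3 < s.re) :
    localFactor s p = eulerFactorPmOne p s := by
  have hq := norm_sq_mul_cpow_lt_one hp hs
  have hq' := norm_mul_cpow_sq_lt_one hp hs
  have e1 : (p : ℂ) ^ (1 - s) = p * (p : ℂ) ^ (-s) := by
    simpa using cpow_one_sub_nat_mul (s := s) hp 1
  have e2 : (p : ℂ) ^ (1 - 2 * s) = p * ((p : ℂ) ^ (-s)) ^ 2 := by
    simpa using cpow_one_sub_nat_mul (s := s) hp 2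
  have e3 : (p : ℂ) ^ (1 - 3 * s) = p * ((p : ℂ) ^ (-s)) ^ 3 := by
    simpa using cpow_one_sub_nat_mul (s := s) hp 3
  have e4 : (p : ℂ) ^ (-2 * s) = ((p : ℂ) ^ (-s)) ^ 2 := by
    rw [← Complex.cpow_nat_mul]; congr 1; push_cast; ring
  have hsum : Summable fun e => (coincidentCount (p ^ e) : ℂ) * ((p : ℂ) ^ (-s)) ^ e := by
    have := (LSeriesSummable_coincidentCount hs).comp_injective
      (Nat.pow_right_injective hp.two_le)
    refine this.congr fun e => ?_
    exact term_prime_pow hp s _ e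
  have hloc : localFactor s p = ∑' e, (coincidentCount (p ^ e) : ℂ) * ((p : ℂ) ^ (-s)) ^ e :=
    tsum_congr fun e => term_prime_pow hp s _ e
  rw [hloc, eulerFactorPmOne, cpow_two_sub hp, e1, e2, e3, e4]
  generalize (p : ℂ) ^ (-s) = x at *
  have hn : ∀ k, (projCount p (k + 1) : ℂ) = (p + 1) * (p : ℂ) ^ k := by
    intro k
    simp [projCount]; ring
  have h0 : projCount p 0 = 1 := by simp [projCount]
  have hN : HasSum (fun e => (projCount p e : ℂ) ^ 2 * x ^ e)
      (1 + ((p : ℂ) + 1) ^ 2 * x / (1 - p ^ 2 * x)) := by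
    have := HasSum.of_succ (f := fun e => (projCount p e : ℂ) ^ 2 * x ^ e) (a := _) (by
      convert hasSum_geometric_shift hq (((p : ℂ) + 1) ^ 2) using 2 with e
      rw [hn]; ring)
    simpa [h0] using this
  have hM : HasSum (fun e => (projCount p (e + 1) : ℂ) * projCount p e * x ^ e)
      ((p : ℂ) + 1 + ((p : ℂ) + 1) ^ 2 * p * x / (1 - p ^ 2 * x)) := by
    have := HasSum.of_succ (f := fun e => (projCount p (e + 1) : ℂ) * projCount p e * x ^ e)
      (a := _) (by
        convert hasSum_geometric_shift hq (((p : ℂ) + 1) ^ 2 * p) using 2 with e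
        rw [hn, hn]; ring)
    rw [hn, h0] at this
    simpa using this
  have hG : Summable fun e => (splitSum p e : ℂ) * x ^ e := by
    refine Summable.of_norm_bounded hsum.norm fun e => ?_
    rw [norm_mul, norm_mul, Complex.norm_natCast, Complex.norm_natCast]
    refine mul_le_mul_of_nonneg_right ?_ (norm_nonneg _)
    rw [coincidentCount_pm_one_pow hp h]
    exact_mod_cast (by omega : splitSum p e ≤ projCount p e ^ 2 + 2 * splitSum p e)
  -- The recursion as a linear equation for the generating function; the terms of exponent `0` and
  -- `1` vanish.
  have hGeq : ∑' e, (splitSum p e : ℂ) * x ^ e =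
      x ^ 2 * ((p : ℂ) + 1 + ((p : ℂ) + 1) ^ 2 * p * x / (1 - p ^ 2 * x))
        + p * x ^ 2 * ∑' e, (splitSum p e : ℂ) * x ^ e := by
    have h2 : HasSum (fun e => (splitSum p (e + 2) : ℂ) * x ^ (e + 2)) _ :=
      ((hM.mul_left (x ^ 2)).add (hG.hasSum.mul_left (p * x ^ 2))).congr_fun fun e => by
        rw [splitSum_add_two]; push_cast; ring
    conv_lhs => rw [← hG.sum_add_tsum_nat_add 2, h2.tsum_eq]
    simp [Finset.sum_range_succ, splitSum]
  have h1 := one_sub_ne_zero_of_norm_lt_one hq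
  have h2 := one_sub_ne_zero_of_norm_lt_one hq'
  have hG' : ∑' e, (splitSum p e : ℂ) * x ^ e =
      x ^ 2 * ((p : ℂ) + 1 + ((p : ℂ) + 1) ^ 2 * p * x / (1 - p ^ 2 * x)) / (1 - p * x ^ 2) := by
    rw [eq_div_iff h2]
    linear_combination hGeq
  have hS := hN.add (hG.hasSum.mul_left 2)
  rw [hG'] at hS
  have hS' : HasSum (fun e => (coincidentCount (p ^ e) : ℂ) * x ^ e) _ :=
    hS.congr_fun fun e => by
      rw [coincidentCount_pm_one_pow hp h]; push_cast; ring
  rw [hS'.tsum_eq]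
  field_simp
  ring

end Factor

/-- Powers of distinct primes are distinct, so these are sums over disjoint parts of an absolutely
convergent series. -/
lemma summable_localFactor_sub_one {s : ℂ} (hs : 3 < s.re) :
    Summable fun p : Nat.Primes => localFactor s p - 1 := by
  set T := LSeries.term (fun n => (coincidentCount n : ℂ)) s with hT
  have h1 : Summable T := LSeriesSummable_coincidentCount hs
  have h2 : Summable fun pk : Nat.Primes × ℕ => T (pk.1 ^ (pk.2 + 1)) :=
    h1.comp_injective (i := fun pk : Nat.Primes × ℕ => (pk.1 : ℕ) ^ (pk.2 + 1))
      (Subtype.val_injective.comp Nat.Primes.prodNatEquiv.injective)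
  refine h2.prod.congr fun p => ?_
  have h3 : Summable fun e => T ((p : ℕ) ^ e) :=
    h1.comp_injective (Nat.pow_right_injective p.2.two_le)
  rw [localFactor, h3.tsum_eq_zero_add, pow_zero]
  have : T 1 = 1 := by
    rw [hT, LSeries.term_of_ne_zero one_ne_zero, coincidentCount_one]; simp
  rw [this]; ring

theorem euler_product_coincidentCount {s : ℂ} (hs : 3 < s.re) :
    Multipliable (fun p : PrimesPmOne => eulerFactorPmOne p s) ∧
    Multipliable (fun p : PrimesPmTwo => eulerFactorPmTwo p s) ∧
    LSeries (fun n => (coincidentCount n : ℂ)) s =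
      eulerFactorFive s * (∏' p : PrimesPmOne, eulerFactorPmOne p s) *
        ∏' p : PrimesPmTwo, eulerFactorPmTwo p s := by
  set T := LSeries.term (fun n => (coincidentCount n : ℂ)) s
  have hsum : Summable T := LSeriesSummable_coincidentCount hs
  have hsub := summable_localFactor_sub_one hs
  have hone : Multipliable (fun p : PrimesPmOne => eulerFactorPmOne p s) := by
    have := Complex.multipliable_one_add_of_summable (hsub.comp_injective
      (i := fun p : PrimesPmOne => (⟨p.1, p.2.1⟩ : Nat.Primes))
      (fun p q h => Subtype.ext (congrArg (fun r : Nat.Primes => (r : ℕ)) h)))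
    refine this.congr fun p => ?_
    simp only [Function.comp]
    rw [← localFactor_pmOne p.2.1 p.2.2 hs]; ring
  have htwo : Multipliable (fun p : PrimesPmTwo => eulerFactorPmTwo p s) := by
    have := Complex.multipliable_one_add_of_summable (hsub.comp_injective
      (i := fun p : PrimesPmTwo => (⟨p.1, p.2.1⟩ : Nat.Primes))
      (fun p q h => Subtype.ext (congrArg (fun r : Nat.Primes => (r : ℕ)) h)))
    refine this.congr fun p => ?_
    simp only [Function.comp]
    rw [← localFactor_pmTwo p.2.1 p.2.2 hs]; ring
  refine ⟨hone, htwo, ?_⟩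
  have hE : HasProd (fun p : Nat.Primes => localFactor s p) (∑' n, T n) := by
    refine EulerProduct.eulerProduct_hasProd ?_ ?_ hsum.norm ?_
    · rw [LSeries.term_of_ne_zero one_ne_zero, coincidentCount_one]; simp
    · intro m n hmn
      rcases eq_or_ne m 0 with rfl | hm
      · simp
      rcases eq_or_ne n 0 with rfl | hn
      · simp
      rw [LSeries.term_of_ne_zero (mul_ne_zero hm hn), LSeries.term_of_ne_zero hm,
        LSeries.term_of_ne_zero hn, coincidentCount_mul hm hn hmn, Nat.cast_mul m n,
        Complex.natCast_mul_natCast_cpow]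
      push_cast
      rw [mul_div_mul_comm]
    · simp
  -- Each partial product is extended by one to all of `ℕ`. Every prime lies in exactly one of the
  -- three classes, so the extended families multiply to the one over all primes.
  have h1 : HasProd (({p : ℕ | p.Prime ∧ (p ≡ 1 [MOD 5] ∨ p ≡ 4 [MOD 5])}).mulIndicator
      (localFactor s)) (∏' p : PrimesPmOne, eulerFactorPmOne p s) := by
    rw [← hasProd_subtype_iff_mulIndicator]
    refine hone.hasProd.congr_fun fun p => ?_
    exact localFactor_pmOne p.2.1 p.2.2 hs
  have h2 : HasProd (({p : ℕ | p.Prime ∧ (p ≡ 2 [MOD 5] ∨ p ≡ 3 [MOD 5])}).mulIndicator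
      (localFactor s)) (∏' p : PrimesPmTwo, eulerFactorPmTwo p s) := by
    rw [← hasProd_subtype_iff_mulIndicator]
    refine htwo.hasProd.congr_fun fun p => ?_
    exact localFactor_pmTwo p.2.1 p.2.2 hs
  have h3 : HasProd (({5} : Set ℕ).mulIndicator (localFactor s)) (eulerFactorFive s) := by
    rw [← localFactor_five hs]
    have := hasProd_single (f := ({5} : Set ℕ).mulIndicator (localFactor s)) 5
      (fun p hp => Set.mulIndicator_of_notMem (by simpa using hp) _)
    rwa [Set.mulIndicator_of_mem (Set.mem_singleton 5)] at this
  have h4 : HasProd (({p : ℕ | p.Prime}).mulIndicator (localFactor s)) (∑' n, T n) := by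
    rw [← hasProd_subtype_iff_mulIndicator]; exact hE
  refine h4.unique (((h3.mul h1).mul h2).congr_fun fun p => ?_)
  by_cases hp : p.Prime
  · rw [Set.mulIndicator_of_mem (show p ∈ {p : ℕ | p.Prime} from hp)]
    rcases hp.mod_five_cases with rfl | h | h
    · simp [Set.mulIndicator, Nat.ModEq]
    · have h5 : p ≠ 5 := by rintro rfl; simp [Nat.ModEq] at h
      have h6 : ¬ (p ≡ 2 [MOD 5] ∨ p ≡ 3 [MOD 5]) := by simp only [Nat.ModEq] at h ⊢; omega
      simp [Set.mulIndicator, h, hp, h5, h6]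
    · have h5 : p ≠ 5 := by rintro rfl; simp [Nat.ModEq] at h
      have h6 : ¬ (p ≡ 1 [MOD 5] ∨ p ≡ 4 [MOD 5]) := by simp only [Nat.ModEq] at h ⊢; omega
      simp [Set.mulIndicator, h, hp, h5, h6]
  · have h5 : p ≠ 5 := by rintro rfl; exact hp Nat.prime_five
    simp [Set.mulIndicator, hp, h5]

end EulerProduct

/-! ## The dual lattice -/

section Dual

variable {E : Type*} [NormedAddCommGroup E] [InnerProductSpace ℝ E] {b : Basis (Fin 4) ℝ E}

/-- The coordinate change from the fundamental weights, doubled, to the simple roots. -/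
noncomputable def weightEquiv : (Fin 4 → ℝ) ≃ₗ[ℝ] (Fin 4 → ℝ) where
  toFun w := (2 / 5 : ℝ) • cartanAdj w
  map_add' v w := by ext i; fin_cases i <;> simp [cartanAdj] <;> ring
  map_smul' c w := by ext i; fin_cases i <;> simp [cartanAdj] <;> ring
  invFun w := (1 / 2 : ℝ) • cartan w
  left_inv w := by ext i; fin_cases i <;> simp [cartanAdj, cartan] <;> ring
  right_inv w := by ext i; fin_cases i <;> simp [cartanAdj, cartan] <;> ring

/-- The basis of the dual lattice. -/
noncomputable def weightBasis (b : Basis (Fin 4) ℝ E) : Basis (Fin 4) ℝ E :=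
  Basis.ofEquivFun (b.equivFun.trans weightEquiv.symm)

lemma latticeHom_weightBasis (m : Fin 4 → ℤ) :
    latticeHom (weightBasis b) m = b.equivFun.symm (weightEquiv fun i => (m i : ℝ)) := by
  rw [latticeHom_apply, weightBasis]
  simp

lemma dualLattice_range (hb : IsRootBasis b (1 / 2)) :
    dualLattice (latticeHom b).range = (latticeHom (weightBasis b)).range := by
  have key : ∀ (w : Fin 4 → ℝ) (y : Fin 4 → ℤ),
      inner ℝ (b.equivFun.symm (weightEquiv w)) (latticeHom b y) = w ⬝ᵥ fun i => (y i : ℝ) := by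
    intro w y
    rw [latticeHom_apply, hb.inner_equivFun_symm]
    change 1 / 2 * rootB ((2 / 5 : ℝ) • cartanAdj w) _ = _
    rw [rootB_smul_left, rootB_cartanAdj]
    ring
  ext x
  constructor
  · intro hx
    obtain ⟨w, rfl⟩ : ∃ w, b.equivFun.symm (weightEquiv w) = x :=
      ⟨weightEquiv.symm (b.equivFun x), by simp⟩
    have h1 : ∀ i, ∃ m : ℤ, w i = m := by
      intro i
      obtain ⟨m, hm⟩ := hx _ ⟨Pi.single i 1, rfl⟩
      refine ⟨m, ?_⟩
      rw [key] at hm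
      rw [← hm]
      have : (fun j => (((Pi.single i 1 : Fin 4 → ℤ) j : ℤ) : ℝ)) = Pi.single i 1 := by
        ext j
        by_cases h : j = i
        · subst h; simp
        · simp [h]
      rw [this, dotProduct_single_one]
    choose m hm using h1
    exact ⟨m, by rw [latticeHom_weightBasis, ← funext hm]⟩
  · rintro ⟨m, rfl⟩ _ ⟨y, rfl⟩
    rw [latticeHom_weightBasis, key]
    exact ⟨m ⬝ᵥ y, by simp [dotProduct]⟩

/-- Doubling. -/
def doubling (E : Type*) [AddCommGroup E] : E →+ E := nsmulAddMonoidHom 2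

lemma doubling_apply {E : Type*} [AddCommGroup E] (x : E) : doubling E x = (2 : ℕ) • x := rfl

lemma doubling_injective : Function.Injective (doubling E) := by
  intro x y h
  rw [doubling_apply, doubling_apply, ← Nat.cast_smul_eq_nsmul ℝ, ← Nat.cast_smul_eq_nsmul ℝ] at h
  exact smul_right_injective E (by norm_num) h

lemma inner_latticeHom (hb : IsRootBasis b (1 / 2)) (x y : Fin 4 → ℤ) :
    2 * inner ℝ (latticeHom b x) (latticeHom b y) = ((rootB x y : ℤ) : ℝ) := by
  rw [latticeHom_apply, latticeHom_apply, hb.inner_equivFun_symm,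
    show rootB (fun i => (x i : ℝ)) (fun i => (y i : ℝ)) = ((rootB x y : ℤ) : ℝ) from
      map_rootB (Int.castRingHom ℝ) x y]
  ring

lemma norm_sq_latticeHom (hb : IsRootBasis b (1 / 2)) (x : Fin 4 → ℤ) :
    inner ℝ (latticeHom b x) (latticeHom b x) = ((rootQ x : ℤ) : ℝ) := by
  have := inner_latticeHom hb x x
  rw [rootB_self] at this
  push_cast at this
  linarith

lemma doubling_mem_dualLattice (hb : IsRootBasis b (1 / 2)) {x : E}
    (hx : x ∈ (latticeHom b).range) : (2 : ℕ) • x ∈ dualLattice (latticeHom b).range := by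
  obtain ⟨x, rfl⟩ := hx
  rintro _ ⟨y, rfl⟩
  refine ⟨rootB x y, ?_⟩
  rw [← inner_latticeHom hb, ← Nat.cast_smul_eq_nsmul ℝ, real_inner_smul_left]
  norm_num

/-- The quotient of `L^*` by `2L` is a copy of `A₄^* / A₄`, of order five. -/
lemma five_smul_mem (hb : IsRootBasis b (1 / 2)) {x : E}
    (hx : x ∈ dualLattice (latticeHom b).range) :
    (5 : ℕ) • x ∈ (latticeHom b).range.map (doubling E) := by
  rw [dualLattice_range hb] at hx
  obtain ⟨m, rfl⟩ := hx
  refine ⟨_, ⟨cartanAdj m, rfl⟩, ?_⟩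
  rw [doubling_apply, latticeHom_weightBasis, latticeHom_apply, ← Nat.cast_smul_eq_nsmul ℝ,
    ← Nat.cast_smul_eq_nsmul ℝ, ← map_smul, ← map_smul]
  congr 1
  ext i
  fin_cases i <;> simp [weightEquiv, cartanAdj] <;> ring

/-- On `L^*` the norm is `4/5` of `weightQ`, so a norm in `4ℤ` makes the class modulo `2L` trivial.
This description of `2L` is invariant under isometries. -/
lemma mem_doubling_of_norm (hb : IsRootBasis b (1 / 2)) {x : E}
    (hx : x ∈ dualLattice (latticeHom b).range) {k : ℤ} (hk : inner ℝ x x = 4 * (k : ℝ)) :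
    x ∈ (latticeHom b).range.map (doubling E) := by
  rw [dualLattice_range hb] at hx
  obtain ⟨m, rfl⟩ := hx
  rw [latticeHom_weightBasis, hb.inner_equivFun_symm] at hk
  have h1 : weightQ m = 5 * k := by
    have h2 : 1 / 2 * rootB (weightEquiv fun i => (m i : ℝ)) (weightEquiv fun i => (m i : ℝ)) =
        4 / 5 * ((weightQ m : ℤ) : ℝ) := by
      simp only [weightEquiv, LinearEquiv.coe_mk, LinearMap.coe_mk, AddHom.coe_mk, rootB_apply,
        Pi.smul_apply, smul_eq_mul, cartanAdj, Matrix.cons_val, weightQ]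
      push_cast
      ring
    rw [h2] at hk
    have h3 : ((weightQ m : ℤ) : ℝ) = ((5 * k : ℤ) : ℝ) := by push_cast; linarith
    exact_mod_cast h3
  obtain ⟨y, rfl⟩ := exists_cartan_eq_of_dvd_weightQ (φ := m) ⟨k, h1⟩
  refine ⟨_, ⟨y, rfl⟩, ?_⟩
  rw [doubling_apply, latticeHom_weightBasis, latticeHom_apply, ← Nat.cast_smul_eq_nsmul ℝ,
    ← map_smul]
  congr 1
  ext i
  fin_cases i <;> simp [weightEquiv, cartanAdj, cartan] <;> ring

lemma inner_self_doubling (hb : IsRootBasis b (1 / 2)) {x : E}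
    (hx : x ∈ (latticeHom b).range) :
    ∃ k : ℤ, inner ℝ ((2 : ℕ) • x) ((2 : ℕ) • x) = 4 * (k : ℝ) := by
  obtain ⟨x, rfl⟩ := hx
  refine ⟨rootQ x, ?_⟩
  rw [← norm_sq_latticeHom hb, ← Nat.cast_smul_eq_nsmul ℝ, real_inner_smul_left,
    real_inner_smul_right]
  push_cast
  ring

/-- The lattice `2 (L ∩ R L)` inside the coincidence site lattice of the dual. -/
lemma inf_map_doubling (hb : IsRootBasis b (1 / 2)) (R : E ≃ₗᵢ[ℝ] E) :
    dualLattice (latticeHom b).range ⊓ isometryImage R (dualLattice (latticeHom b).range) ⊓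
        (latticeHom b).range.map (doubling E) =
      ((latticeHom b).range ⊓ isometryImage R (latticeHom b).range).map (doubling E) := by
  ext x
  constructor
  · rintro ⟨⟨-, z, hz, hzx⟩, y, hy, rfl⟩
    refine ⟨y, ⟨hy, ?_⟩, rfl⟩
    obtain ⟨k, hk⟩ := inner_self_doubling hb hy
    change R z = (2 : ℕ) • y at hzx
    obtain ⟨u, hu, huz⟩ := mem_doubling_of_norm hb hz (k := k) (by
      rw [← hk, ← hzx, LinearIsometryEquiv.inner_map_map])
    refine ⟨u, hu, doubling_injective ?_⟩
    change doubling E (R u) = doubling E y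
    rw [doubling_apply, doubling_apply, ← hzx, ← huz, doubling_apply, map_nsmul]
  · rintro ⟨y, ⟨hy, u, hu, huy⟩, rfl⟩
    change R u = y at huy
    refine ⟨⟨doubling_mem_dualLattice hb hy, ?_⟩, y, hy, rfl⟩
    refine ⟨_, doubling_mem_dualLattice hb hu, ?_⟩
    change R ((2 : ℕ) • u) = doubling E y
    rw [map_nsmul, huy]; rfl

lemma smul_mem_of_coincidenceIndex {Γ : AddSubgroup E} {R : E ≃ₗᵢ[ℝ] E} {n : ℕ}
    (h : coincidenceIndex Γ R = n) {x : E} (hx : x ∈ Γ) : n • x ∈ Γ ⊓ isometryImage R Γ := by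
  have := AddSubgroup.nsmul_index_mem ((Γ ⊓ isometryImage R Γ).addSubgroupOf Γ) ⟨x, hx⟩
  rw [show ((Γ ⊓ isometryImage R Γ).addSubgroupOf Γ).index = n from h] at this
  exact this

/-- From `nL ⊆ RL` duality gives `2nRL ⊆ L^*`; the norms lie in `4ℤ`, hence `nRL ⊆ L`. Dualising
once more gives `nL^* ⊆ RL^*`. -/
lemma smul_mem_dual_of_coincidenceIndex (hb : IsRootBasis b (1 / 2)) {R : E ≃ₗᵢ[ℝ] E} {n : ℕ}
    (h : coincidenceIndex (latticeHom b).range R = n) {x : E}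
    (hx : x ∈ dualLattice (latticeHom b).range) :
    n • x ∈ dualLattice (latticeHom b).range ⊓
      isometryImage R (dualLattice (latticeHom b).range) := by
  -- `n` times the rotated lattice lies in the lattice
  have h1 : ∀ y ∈ (latticeHom b).range, n • R y ∈ (latticeHom b).range := by
    intro y hy
    have h2 : (2 : ℕ) • (n • R y) ∈ dualLattice (latticeHom b).range := by
      intro z hz
      obtain ⟨-, w, hw, hwz⟩ := smul_mem_of_coincidenceIndex h hz
      change R w = n • z at hwz
      obtain ⟨m, hm⟩ := doubling_mem_dualLattice hb hy w hw
      refine ⟨m, ?_⟩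
      rw [← hm, ← LinearIsometryEquiv.inner_map_map R ((2 : ℕ) • y) w, hwz, map_nsmul]
      simp only [← Nat.cast_smul_eq_nsmul ℝ, real_inner_smul_left, real_inner_smul_right]
      ring
    obtain ⟨k, hk⟩ := inner_self_doubling hb hy
    obtain ⟨u, hu, huy⟩ := mem_doubling_of_norm hb h2 (k := n ^ 2 * k) (by
      simp only [← Nat.cast_smul_eq_nsmul ℝ, real_inner_smul_left, real_inner_smul_right,
        LinearIsometryEquiv.inner_map_map] at hk ⊢
      push_cast at hk ⊢
      linear_combination (n : ℝ) ^ 2 * hk)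
    rwa [← doubling_injective (a₁ := u) (a₂ := n • R y) huy]
  refine ⟨nsmul_mem hx n, R.symm (n • x), ?_, by simp⟩
  intro y hy
  obtain ⟨m, hm⟩ := hx _ (h1 y hy)
  refine ⟨m, ?_⟩
  rw [← hm, ← LinearIsometryEquiv.inner_map_map R, LinearIsometryEquiv.apply_symm_apply]
  simp only [← Nat.cast_smul_eq_nsmul ℝ, real_inner_smul_left, real_inner_smul_right]

/-- The quotient `L^* / 2L` is killed by five and the coincidence quotient by `n`. By coprimality
`2L` and the coincidence site lattice generate `L^*`, and the second isomorphism theorem reduces the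
index to `2L`. -/
lemma coincidenceIndex_dual_eq (hb : IsRootBasis b (1 / 2)) {R : E ≃ₗᵢ[ℝ] E} {n : ℕ}
    (hn : n.Coprime 5) (h : ∀ x ∈ dualLattice (latticeHom b).range,
      n • x ∈ dualLattice (latticeHom b).range ⊓
        isometryImage R (dualLattice (latticeHom b).range)) :
    coincidenceIndex (dualLattice (latticeHom b).range) R =
      coincidenceIndex (latticeHom b).range R := by
  have hsup : (latticeHom b).range.map (doubling E) ⊔ (dualLattice (latticeHom b).range ⊓
      isometryImage R (dualLattice (latticeHom b).range)) = dualLattice (latticeHom b).range := by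
    refine le_antisymm (sup_le ?_ inf_le_left) fun x hx => ?_
    · rintro _ ⟨x, hx, rfl⟩
      exact doubling_mem_dualLattice hb hx
    · obtain ⟨u, v, huv⟩ := Nat.isCoprime_iff_coprime.2 hn
      have : x = v • ((5 : ℕ) • x) + u • (n • x) := by
        rw [← Nat.cast_smul_eq_nsmul ℤ, ← Nat.cast_smul_eq_nsmul ℤ, smul_smul, smul_smul,
          ← add_smul, add_comm, huv, one_smul]
      rw [this]
      exact add_mem (AddSubgroup.mem_sup_left (zsmul_mem (five_smul_mem hb hx) v))
        (AddSubgroup.mem_sup_right (zsmul_mem (h x hx) u))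
  have hrel : ∀ A B X : AddSubgroup E, B ⊔ X = A → X.relIndex A = X.relIndex B := by
    rintro _ B X rfl
    exact AddSubgroup.relIndex_sup_right B X
  rw [coincidenceIndex, hrel _ _ _ hsup, ← AddSubgroup.inf_relIndex_right,
    inf_map_doubling hb, AddSubgroup.relIndex_map_map_of_injective _ _ doubling_injective]
  rfl

lemma coincidenceIndex_dual_eq_iff (hb : IsRootBasis b (1 / 2)) (R : E ≃ₗᵢ[ℝ] E) {n : ℕ}
    (hn : n.Coprime 5) : coincidenceIndex (dualLattice (latticeHom b).range) R = n ↔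
      coincidenceIndex (latticeHom b).range R = n := by
  constructor <;> intro h
  · rw [← coincidenceIndex_dual_eq hb hn fun x hx => smul_mem_of_coincidenceIndex h hx, h]
  · rw [coincidenceIndex_dual_eq hb hn fun x hx => smul_mem_dual_of_coincidenceIndex hb h hx, h]

/-- The bijection sends `X` to half of `X ∩ 2L`. -/
theorem cslCount_dual (hb : IsRootBasis b (1 / 2)) {n : ℕ} (hn : n.Coprime 5) :
    cslCount (dualLattice (latticeHom b).range) n = cslCount (latticeHom b).range n := by
  have hcomap : ∀ R : E ≃ₗᵢ[ℝ] E, (dualLattice (latticeHom b).range ⊓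
      isometryImage R (dualLattice (latticeHom b).range) ⊓
        (latticeHom b).range.map (doubling E)).comap (doubling E) =
      (latticeHom b).range ⊓ isometryImage R (latticeHom b).range := fun R => by
    rw [inf_map_doubling hb, AddSubgroup.comap_map_eq_self_of_injective doubling_injective]
  have himage : cslsOfIndex (latticeHom b).range n =
      (fun X => (X ⊓ (latticeHom b).range.map (doubling E)).comap (doubling E)) ''
        cslsOfIndex (dualLattice (latticeHom b).range) n := by
    ext C
    constructor
    · rintro ⟨R, h1, h2, rfl⟩
      have h3 := (coincidenceIndex_dual_eq_iff hb R hn).2 h2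
      refine ⟨_, ⟨R, ?_, h3, rfl⟩, hcomap R⟩
      rwa [IsCoincidenceIsometry, h3, ← h2]
    · rintro ⟨_, ⟨R, h1, h2, rfl⟩, rfl⟩
      have h3 := (coincidenceIndex_dual_eq_iff hb R hn).1 h2
      refine ⟨R, ?_, h3, hcomap R⟩
      rwa [IsCoincidenceIsometry, h3, ← h2]
  rw [cslCount, cslCount, himage, Set.InjOn.ncard_image]
  -- Injectivity: `X` is recovered from `X ∩ 2L`, because `5t` and `nt` in `X` imply `t` in `X`.
  have key : ∀ X ∈ cslsOfIndex (dualLattice (latticeHom b).range) n,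
      ∀ t, t ∈ X ↔ t ∈ dualLattice (latticeHom b).range ∧
        (5 : ℕ) • t ∈ X ⊓ (latticeHom b).range.map (doubling E) := by
    rintro _ ⟨R, -, h2, rfl⟩ t
    constructor
    · intro ht
      exact ⟨ht.1, nsmul_mem ht 5, five_smul_mem hb ht.1⟩
    · rintro ⟨ht, h5⟩
      replace h5 := (AddSubgroup.mem_inf.1 h5).1
      have hnt := smul_mem_of_coincidenceIndex h2 ht
      obtain ⟨u, v, huv⟩ := Nat.isCoprime_iff_coprime.2 hn
      have : t = v • ((5 : ℕ) • t) + u • (n • t) := by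
        rw [← Nat.cast_smul_eq_nsmul ℤ, ← Nat.cast_smul_eq_nsmul ℤ, smul_smul, smul_smul,
          ← add_smul, add_comm, huv, one_smul]
      rw [this]
      exact add_mem (zsmul_mem h5 v) (zsmul_mem hnt u)
  intro X hX Y hY hXY
  have hXY' : X ⊓ (latticeHom b).range.map (doubling E) =
      Y ⊓ (latticeHom b).range.map (doubling E) := by
    have hle : ∀ Z : AddSubgroup E, Z ⊓ (latticeHom b).range.map (doubling E) ≤
        (doubling E).range := fun Z =>
      inf_le_right.trans (AddSubgroup.map_le_range _ _)
    have := congrArg (AddSubgroup.map (doubling E)) hXY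
    simp only at this
    rwa [AddSubgroup.map_comap_eq_self (hle X), AddSubgroup.map_comap_eq_self (hle Y)] at this
  ext t
  rw [key X hX, key Y hY, hXY']

end Dual

/-! ## The two realisations of the root lattice -/

section Realisations

/-- A linear relation is annihilated by the Cartan matrix, which `cartanAdj` inverts up to the
factor five. -/
lemma linearIndependent_of_gram {E : Type*} [NormedAddCommGroup E] [InnerProductSpace ℝ E]
    {v : Fin 4 → E} {c : ℝ} (hc : 0 < c)
    (h : ∀ i j, inner ℝ (v i) (v j) = c * cartanMatrix i j) : LinearIndependent ℝ v := by
  rw [Fintype.linearIndependent_iff]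
  intro g hg
  have h1 : cartan g = 0 := by
    ext i
    have h2 := congrArg (inner ℝ (v i)) hg
    simp only [Fin.sum_univ_four, inner_add_right, real_inner_smul_right, h, inner_zero_right] at h2
    refine (mul_eq_zero.1 (?_ : c * cartan g i = 0)).resolve_left hc.ne'
    rw [← h2]
    fin_cases i <;> simp [cartan, cartanMatrix, symmGram] <;> ring
  have h3 := cartanAdj_cartan g
  rw [h1] at h3
  intro i
  have h4 := congrFun h3 i
  simp only [Pi.smul_apply, smul_eq_mul] at h4
  have h5 : cartanAdj (0 : Fin 4 → ℝ) i = 0 := by fin_cases i <;> simp [cartanAdj]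
  rw [h5] at h4
  linarith

lemma inner_eq_sum {n : ℕ} (x y : EuclideanSpace ℝ (Fin n)) : inner ℝ x y = ∑ i, x i * y i := by
  simp [PiLp.inner_apply, mul_comm]

/-- The spanning vectors of `latticeL`. -/
noncomputable def latticeLVec : Fin 4 → EuclideanSpace ℝ (Fin 4) :=
  ![!₂[1, 0, 0, 0], !₂[-1 / 2, 1 / 2, 1 / 2, 1 / 2], !₂[0, -1, 0, 0],
      !₂[0, 1 / 2, (Real.goldenRatio - 1) / 2, -Real.goldenRatio / 2]]

lemma latticeLVec_gram (i j : Fin 4) :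
    inner ℝ (latticeLVec i) (latticeLVec j) = (1 / 2 : ℝ) * cartanMatrix i j := by
  have hτ := Real.goldenRatio_sq
  rw [inner_eq_sum, Fin.sum_univ_four]
  fin_cases i <;> fin_cases j <;>
    simp only [latticeLVec, cartanMatrix, symmGram, Fin.reduceFinMk, Matrix.cons_val,
      Matrix.of_apply, Fin.zero_eta, Fin.mk_one] <;>
    push_cast <;>
    first
      | ring1
      -- Only the norm of the last vector needs the equation of the golden ratio.
      | linear_combination (1 / 2 : ℝ) * hτ

/-- The basis of simple roots of `latticeL`. -/
noncomputable def latticeLBasis : Basis (Fin 4) ℝ (EuclideanSpace ℝ (Fin 4)) :=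
  basisOfLinearIndependentOfCardEqFinrank
    (linearIndependent_of_gram (by norm_num) latticeLVec_gram) (by simp)

lemma isRootBasis_latticeLBasis : IsRootBasis latticeLBasis (1 / 2) :=
  ⟨by norm_num, fun i j => by
    rw [latticeLBasis, coe_basisOfLinearIndependentOfCardEqFinrank, latticeLVec_gram]⟩

lemma range_latticeLBasis : (latticeHom latticeLBasis).range = latticeL := by
  rw [range_latticeHom, latticeLBasis, coe_basisOfLinearIndependentOfCardEqFinrank, latticeL]
  congr 1
  ext x
  simp only [latticeLVec, Matrix.range_cons, Matrix.range_empty, Set.union_empty, Set.mem_union,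
    Set.mem_insert_iff, Set.mem_singleton_iff]

/-- The simple roots of `A₄`. -/
noncomputable def simpleRoot (i : Fin 4) : sumZeroHyperplane :=
  ⟨EuclideanSpace.single i.castSucc 1 - EuclideanSpace.single i.succ 1, by
    change ∑ j, _ = _
    fin_cases i <;> simp⟩

lemma simpleRoot_gram (i j : Fin 4) :
    inner ℝ (simpleRoot i) (simpleRoot j) = (1 : ℝ) * cartanMatrix i j := by
  rw [Submodule.coe_inner, inner_eq_sum, Fin.sum_univ_five]
  fin_cases i <;> fin_cases j <;>
    simp [simpleRoot, cartanMatrix, symmGram] <;> norm_num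

/-- The coordinates in simple roots are the partial sums; the last one closes up because the
coordinate sum is zero. -/
lemma eq_sum_simpleRoot (x : sumZeroHyperplane) (s : Fin 4 → ℝ)
    (h0 : s 0 = x.1 0) (h1 : s 1 = s 0 + x.1 1) (h2 : s 2 = s 1 + x.1 2)
    (h3 : s 3 = s 2 + x.1 3) : ∑ i, s i • simpleRoot i = x := by
  have hx : ∑ j, x.1 j = 0 := x.2
  rw [Fin.sum_univ_five] at hx
  refine Subtype.ext ?_
  ext j
  fin_cases j <;> simp [simpleRoot, Fin.sum_univ_four] <;> linarith

/-- The basis of simple roots of `A₄`. -/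
noncomputable def rootBasisA4 : Basis (Fin 4) ℝ sumZeroHyperplane :=
  Basis.mk (linearIndependent_of_gram one_pos simpleRoot_gram) (by
    intro x _
    rw [← eq_sum_simpleRoot x ![x.1 0, x.1 0 + x.1 1, x.1 0 + x.1 1 + x.1 2,
      x.1 0 + x.1 1 + x.1 2 + x.1 3] rfl rfl rfl rfl]
    exact sum_mem fun i _ => Submodule.smul_mem _ _ (Submodule.subset_span ⟨i, rfl⟩))

lemma isRootBasis_rootBasisA4 : IsRootBasis rootBasisA4 1 :=
  ⟨one_pos, fun i j => by rw [rootBasisA4, Basis.coe_mk, simpleRoot_gram]⟩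

lemma range_rootBasisA4 : (latticeHom rootBasisA4).range = rootLatticeA4 := by
  apply le_antisymm
  · rw [range_latticeHom, rootBasisA4, Basis.coe_mk, AddSubgroup.closure_le]
    rintro _ ⟨i, rfl⟩ j
    refine ⟨(if j = i.castSucc then 1 else 0) - (if j = i.succ then 1 else 0), ?_⟩
    simp only [simpleRoot, PiLp.sub_apply, PiLp.single_apply]
    push_cast
    rfl
  · intro x hx
    choose m hm using hx
    refine ⟨![m 0, m 0 + m 1, m 0 + m 1 + m 2, m 0 + m 1 + m 2 + m 3], ?_⟩
    rw [latticeHom_apply, Basis.equivFun_symm_apply, rootBasisA4, Basis.coe_mk]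
    refine eq_sum_simpleRoot x _ ?_ ?_ ?_ ?_ <;> simp [hm]

end Realisations

/-! ### Transfer to the given lattices and assembly -/

lemma cslCount_latticeL {n : ℕ} (hn : n ≠ 0) : cslCount latticeL n = coincidentCount n := by
  rw [← range_latticeLBasis]
  exact isRootBasis_latticeLBasis.cslCount_eq hn

lemma cslCount_rootLatticeA4 {n : ℕ} (hn : n ≠ 0) :
    cslCount rootLatticeA4 n = coincidentCount n := by
  rw [← range_rootBasisA4]
  exact isRootBasis_rootBasisA4.cslCount_eq hn

lemma cslCount_zero {E : Type*} [NormedAddCommGroup E] [InnerProductSpace ℝ E]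
    (Γ : AddSubgroup E) : cslCount Γ 0 = 0 := by
  rw [cslCount, cslsOfIndex_zero, Set.ncard_empty]

lemma cslCount_latticeL_one : cslCount latticeL 1 = 1 := by
  rw [cslCount_latticeL one_ne_zero, coincidentCount_one]

lemma cslCount_latticeL_mul {m n : ℕ} (h : m.Coprime n) :
    cslCount latticeL (m * n) = cslCount latticeL m * cslCount latticeL n := by
  rcases eq_or_ne m 0 with rfl | hm
  · rw [zero_mul, cslCount_zero, zero_mul]
  rcases eq_or_ne n 0 with rfl | hn
  · rw [mul_zero, cslCount_zero, mul_zero]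
  rw [cslCount_latticeL hm, cslCount_latticeL hn, cslCount_latticeL (mul_ne_zero hm hn),
    coincidentCount_mul hm hn h]

lemma cslCount_latticeL_five_pow {r : ℕ} (hr : 1 ≤ r) :
    cslCount latticeL (5 ^ r) = 6 * 5 ^ (2 * r - 2) := by
  rw [cslCount_latticeL (by positivity)]
  exact ncard_coincidentOfIndex_five hr

lemma cslCount_latticeL_pmTwo {p r : ℕ} (hp : p.Prime) (h : p ≡ 2 [MOD 5] ∨ p ≡ 3 [MOD 5])
    (hr : 1 ≤ r) : cslCount latticeL (p ^ r) = (p ^ 2 + 1) * p ^ (2 * r - 2) := by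
  have : Fact p.Prime := ⟨hp⟩
  rw [cslCount_latticeL (pow_ne_zero _ hp.ne_zero)]
  exact ncard_coincidentOfIndex_pm_two h hr

lemma cslCount_latticeL_eleven : cslCount latticeL 11 = 144 := by
  have := coincidentCount_pm_one_pow (p := 11) (by norm_num) (by decide) 1
  rw [pow_one] at this
  rw [cslCount_latticeL (by norm_num), this]
  simp [projCount, splitSum]

lemma cslCount_latticeL_first_terms :
    (List.range 11).map (fun i => cslCount latticeL (i + 1)) =
      [1, 5, 10, 20, 6, 50, 50, 80, 90, 30, 144] := by
  have h2 : ∀ r, 1 ≤ r → cslCount latticeL (2 ^ r) = (2 ^ 2 + 1) * 2 ^ (2 * r - 2) := fun r hr =>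
    cslCount_latticeL_pmTwo Nat.prime_two (by decide) hr
  have h3 : ∀ r, 1 ≤ r → cslCount latticeL (3 ^ r) = (3 ^ 2 + 1) * 3 ^ (2 * r - 2) := fun r hr =>
    cslCount_latticeL_pmTwo Nat.prime_three (by decide) hr
  have e2 : cslCount latticeL 2 = 5 := by simpa using h2 1 le_rfl
  have e3 : cslCount latticeL 3 = 10 := by simpa using h3 1 le_rfl
  have e4 : cslCount latticeL 4 = 20 := by simpa using h2 2 (by norm_num)
  have e5 : cslCount latticeL 5 = 6 := by simpa using cslCount_latticeL_five_pow le_rfl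
  have e6 : cslCount latticeL 6 = 50 := by
    rw [show 6 = 2 * 3 by norm_num, cslCount_latticeL_mul (by norm_num), e2, e3]
  have e7 : cslCount latticeL 7 = 50 := by
    simpa using cslCount_latticeL_pmTwo (p := 7) (by norm_num) (by decide) le_rfl
  have e8 : cslCount latticeL 8 = 80 := by simpa using h2 3 (by norm_num)
  have e9 : cslCount latticeL 9 = 90 := by simpa using h3 2 (by norm_num)
  have e10 : cslCount latticeL 10 = 30 := by
    rw [show 10 = 2 * 5 by norm_num, cslCount_latticeL_mul (by norm_num), e2, e5]
  simp [List.range_succ, cslCount_latticeL_one, e2, e3, e4, e5, e6, e7, e8, e9, e10,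
    cslCount_latticeL_eleven]

theorem mainTheorem3 :
    -- for every index there are finitely many CSLs, and `A₄` and `L` have equally many; so does the
    -- dual lattice of `L` for the indices that are coprime to `5`
    (∀ n : ℕ, (cslsOfIndex rootLatticeA4 n).Finite ∧ (cslsOfIndex latticeL n).Finite ∧
      (cslsOfIndex (dualLattice latticeL) n).Finite) ∧
    (∀ n : ℕ, cslCount rootLatticeA4 n = cslCount latticeL n) ∧
    (∀ n : ℕ, n.Coprime 5 → cslCount (dualLattice latticeL) n = cslCount latticeL n) ∧
    -- the number of CSLs is multiplicative
    cslCount latticeL 1 = 1 ∧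
    (∀ m n : ℕ, m.Coprime n → cslCount latticeL (m * n) = cslCount latticeL m * cslCount latticeL n) ∧
    -- its values at prime powers
    (∀ r : ℕ, 1 ≤ r → cslCount latticeL (5 ^ r) = 6 * 5 ^ (2 * r - 2)) ∧
    (∀ p r : ℕ, p.Prime → (p ≡ 2 [MOD 5] ∨ p ≡ 3 [MOD 5]) → 1 ≤ r →
      cslCount latticeL (p ^ r) = (p ^ 2 + 1) * p ^ (2 * r - 2)) ∧
    (∀ p r : ℕ, p.Prime → (p ≡ 1 [MOD 5] ∨ p ≡ 4 [MOD 5]) → 1 ≤ r → Odd r →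
      (cslCount latticeL (p ^ r) : ℚ) = ((p : ℚ) + 1) ^ 2 / ((p : ℚ) ^ 3 - 1) *
        ((p : ℚ) ^ (2 * r + 1) + (p : ℚ) ^ (2 * r - 2) - 2 * (p : ℚ) ^ ((r - 1) / 2))) ∧
    (∀ p r : ℕ, p.Prime → (p ≡ 1 [MOD 5] ∨ p ≡ 4 [MOD 5]) → 1 ≤ r → Even r →
      (cslCount latticeL (p ^ r) : ℚ) = ((p : ℚ) + 1) ^ 2 / ((p : ℚ) ^ 3 - 1) *
        ((p : ℚ) ^ (2 * r + 1) + (p : ℚ) ^ (2 * r - 2)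
          - 2 * (((p : ℚ) ^ 2 + 1) / ((p : ℚ) + 1)) * (p : ℚ) ^ ((r - 2) / 2))) ∧
    -- its Dirichlet series and Euler product, in the half-plane of convergence
    (∀ s : ℂ, 3 < s.re →
      LSeriesSummable (fun n => (cslCount latticeL n : ℂ)) s ∧
      Multipliable (fun p : PrimesPmOne => eulerFactorPmOne p s) ∧
      Multipliable (fun p : PrimesPmTwo => eulerFactorPmTwo p s) ∧
      LSeries (fun n => (cslCount latticeL n : ℂ)) s =
        eulerFactorFive s * (∏' p : PrimesPmOne, eulerFactorPmOne p s) *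
          ∏' p : PrimesPmTwo, eulerFactorPmTwo p s) ∧
    -- the first coefficients of the Dirichlet series
    (List.range 11).map (fun i => cslCount latticeL (i + 1)) =
      [1, 5, 10, 20, 6, 50, 50, 80, 90, 30, 144] := by
  refine ⟨fun n => ⟨?_, ?_, ?_⟩, fun n => ?_, fun n hn => ?_, cslCount_latticeL_one,
    fun m n => cslCount_latticeL_mul, fun r => cslCount_latticeL_five_pow,
    fun p r => cslCount_latticeL_pmTwo, fun p r hp h hr hodd => ?_, fun p r hp h hr heven => ?_,
    fun s hs => ?_, cslCount_latticeL_first_terms⟩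
  · rw [← range_rootBasisA4]; exact finite_cslsOfIndex_range _ n
  · rw [← range_latticeLBasis]; exact finite_cslsOfIndex_range _ n
  · rw [← range_latticeLBasis, dualLattice_range isRootBasis_latticeLBasis]
    exact finite_cslsOfIndex_range _ n
  · rcases eq_or_ne n 0 with rfl | hn
    · rw [cslCount_zero, cslCount_zero]
    · rw [cslCount_rootLatticeA4 hn, cslCount_latticeL hn]
  · rw [← range_latticeLBasis]
    exact cslCount_dual isRootBasis_latticeLBasis hn
  · have : Fact p.Prime := ⟨hp⟩
    rw [cslCount_latticeL (pow_ne_zero _ hp.ne_zero)]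
    exact ncard_coincidentOfIndex_pm_one_odd h hodd
  · have : Fact p.Prime := ⟨hp⟩
    rw [cslCount_latticeL (pow_ne_zero _ hp.ne_zero)]
    exact ncard_coincidentOfIndex_pm_one_even h hr heven
  -- A Dirichlet series ignores index zero, so agreement at nonzero indices suffices.
  · have hcongr : ∀ {n : ℕ}, n ≠ 0 → (cslCount latticeL n : ℂ) = (coincidentCount n : ℂ) :=
      fun hn => by rw [cslCount_latticeL hn]
    rw [LSeriesSummable_congr s hcongr, LSeries_congr hcongr s]
    exact ⟨LSeriesSummable_coincidentCount hs, euler_product_coincidentCount hs⟩
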